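/- Let $C$ be a small exact category (in the sense of Quillen) with a chosen zero object, and let $M\colon C^{op}\otimes C\to Ab$ be a bimodule over $C$, i.e. a functor that is additive and exact in each variable. For $f\colon a\to b$ write $f_*\colon M(c,a)\to M(c,b)$ and $f^*\colon M(b,c)\to M(a,c)$ for the induced maps. Let $C\ltimes M$ be the category with the objects of $C$, morphism groups $(C\ltimes M)(a,b)=C(a,b)\oplus M(a,b)$ and composition $(f,m)\circ(g,n)=(f\circ g,\ f_*n+g^*m)$, where a sequence $a\xrightarrow{(i,m)}b\xrightarrow{(q,n)}c$ is called exact if $a\xrightarrow{i}b\xrightarrow{q}c$ is exact in $C$ and $q_*m+i^*n=0$ in $M(a,c)$. For $n\ge 0$ let $S^{(n)}_{\bullet}$ denote the $n$-fold Waldhausen $S_\bullet$-construction: for $\underline p=(p_1,\dots,p_n)$, the category $S^{(n)}_{\underline p}C$ consists of the diagrams $X\colon\prod_i Cat([1],[p_i])\to C$ such that in each variable, with the others fixed, $X_{aa}=0$ and $X_{ab}\to X_{ac}\to X_{bc}$ is exact for all $a\le b\le c$; the same definition is used for $C\ltimes M$. The symmetric spectrum $K(C\ltimes M)$ has level $n$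 the realization $|\mathcal N_\bullet\, iS^{(n)}_{\bullet}(C\ltimes M)|$ of the nerve of the groupoids of isomorphisms. Let $S^{(n)}_{\underline p}M(X,Y)\subset\bigoplus_\theta M(X_\theta,Y_\theta)$ be the subgroup of the families with $X(a)^*m_\theta=Y(a)_*m_\rho$ for all $a\colon\rho\to\theta$ in $\prod_i Cat([1],[p_i])$, and let $S^{(n)}_{\underline p}(C;M)=\coprod_{X\in Ob\,S^{(n)}_{\underline p}C}S^{(n)}_{\underline p}M(X,X)$ be the disjoint union of these groups, viewed as a groupoid with only automorphisms. The symmetric spectrum $K(C;M)$ has level $n$ the realization $|\mathcal N_\bullet S^{(n)}_{\bullet}(C;M)|$. In both spectra the symmetric groups permute the $S_\bullet$-constructions, and the structure maps are induced by the identification of $S^{(n)}$ with the part of simplicial degree one of $S^{(n+1)}$ in the additional direction. The functors $S^{(n)}_{\underline p}(C;M)\to iS^{(n)}_{\underline p}(C\ltimes M)$ that are the zero section on objects and send $m\in S^{(n)}_{\underline p}M(X,X)$ to the automorphism $(\mathrm{id},m)$ induce a map of symmetric spectra $K(C;M)\to K(C\ltimes M)$. Theorem. For every $n\ge 1$ the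 map $K(C;M)_n\to K(C\ltimes M)_n$ is a homotopy equivalence; that is, $K(C;M)\to K(C\ltimes M)$ is a levelwise equivalence of symmetric spectra in all levels $n\ge1$. -/

import Mathlib

open CategoryTheory CategoryTheory.Limits Opposite

universe w v u

/-! ### Exact categories -/

/-- A preadditive category with a chosen zero object and a class of sequences `a ⟶ b ⟶ c`, called
exact, that contains the sequences `0 ⟶ a = a` and `a = a ⟶ 0`.  This is the part of the data of
an exact category out of which the `S`-construction and the K-theory spectrum are made. -/
class ConflationCategory (E : Type u) [Category.{v} E] [Preadditive E] where
  zeroObj : E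
  isZero_zeroObj : IsZero zeroObj
  IsConflation : ∀ {a b c : E}, (a ⟶ b) → (b ⟶ c) → Prop
  conflation_zero_id : ∀ a : E, IsConflation (0 : zeroObj ⟶ a) (𝟙 a)
  conflation_id_zero : ∀ a : E, IsConflation (𝟙 a) (0 : a ⟶ zeroObj)

open ConflationCategory

/-- Admissible monomorphisms: the first maps of the exact sequences. -/
def IsInflation {E : Type u} [Category.{v} E] [Preadditive E] [ConflationCategory E]
    {a b : E} (i : a ⟶ b) : Prop :=
  ∃ (c : E) (q : b ⟶ c), IsConflation i q

/-- Admissible epimorphisms: the second maps of the exact sequences. -/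
def IsDeflation {E : Type u} [Category.{v} E] [Preadditive E] [ConflationCategory E]
    {b c : E} (q : b ⟶ c) : Prop :=
  ∃ (a : E) (i : a ⟶ b), IsConflation i q

/-- Quillen exact structures on an additive category, with a chosen zero object. -/
class ExactCategory (E : Type u) [Category.{v} E] [Preadditive E]
    extends ConflationCategory E where
  hasBinaryBiproducts : HasBinaryBiproducts E
  comp_zero : ∀ {a b c : E} {i : a ⟶ b} {q : b ⟶ c}, IsConflation i q → i ≫ q = 0
  isKernel : ∀ {a b c : E} {i : a ⟶ b} {q : b ⟶ c} (h : IsConflation i q),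
    Nonempty (IsLimit (KernelFork.ofι i (comp_zero h)))
  isCokernel : ∀ {a b c : E} {i : a ⟶ b} {q : b ⟶ c} (h : IsConflation i q),
    Nonempty (IsColimit (CokernelCofork.ofπ q (comp_zero h)))
  of_iso : ∀ {a b c a' b' c' : E} {i : a ⟶ b} {q : b ⟶ c} {i' : a' ⟶ b'} {q' : b' ⟶ c'}
    (α : a ≅ a') (β : b ≅ b') (γ : c ≅ c'), i ≫ β.hom = α.hom ≫ i' → q ≫ γ.hom = β.hom ≫ q' →
    IsConflation i q → IsConflation i' q'
  inflation_comp : ∀ {a b c : E} {i : a ⟶ b} {j : b ⟶ c},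
    IsInflation i → IsInflation j → IsInflation (i ≫ j)
  deflation_comp : ∀ {a b c : E} {p : a ⟶ b} {q : b ⟶ c},
    IsDeflation p → IsDeflation q → IsDeflation (p ≫ q)
  inflation_pushout : ∀ {a b a' : E} (i : a ⟶ b) (f : a ⟶ a'), IsInflation i →
    ∃ (b' : E) (g : b ⟶ b') (i' : a' ⟶ b'), IsPushout i f g i' ∧ IsInflation i'
  deflation_pullback : ∀ {b c c' : E} (q : b ⟶ c) (f : c' ⟶ c), IsDeflation q →
    ∃ (b' : E) (g : b' ⟶ b) (q' : b' ⟶ c'), IsPullback g q' q f ∧ IsDeflation q'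

/-! ### Bimodules and the category `C ⋉ M` -/

/-- A bimodule over an exact category: a functor of two variables to abelian groups, additive in
each variable, which takes exact sequences in either variable to short exact sequences. -/
structure Bimodule (C : Type u) [Category.{v} C] [Preadditive C] [ExactCategory C] where
  functor : Cᵒᵖ ⥤ C ⥤ AddCommGrpCat.{w}
  map_add_left : ∀ {a b : C} (f g : a ⟶ b) (c : C),
    (functor.map (f + g).op).app c = (functor.map f.op).app c + (functor.map g.op).app c
  map_add_right : ∀ (c : C) {a b : C} (f g : a ⟶ b),
    (functor.obj (op c)).map (f + g) = (functor.obj (op c)).map f + (functor.obj (op c)).map g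
  exact_right : ∀ (d : C) {a b c : C} (i : a ⟶ b) (q : b ⟶ c), IsConflation i q →
    Function.Injective ((functor.obj (op d)).map i) ∧
    Function.Exact ((functor.obj (op d)).map i) ((functor.obj (op d)).map q) ∧
    Function.Surjective ((functor.obj (op d)).map q)
  exact_left : ∀ (d : C) {a b c : C} (i : a ⟶ b) (q : b ⟶ c), IsConflation i q →
    Function.Injective ((functor.map q.op).app d) ∧
    Function.Exact ((functor.map q.op).app d) ((functor.map i.op).app d) ∧
    Function.Surjective ((functor.map i.op).app d)

namespace Bimodule

variable {C : Type u} [Category.{v} C] [Preadditive C] [ExactCategory C] (M : Bimodule.{w} C)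

/-- The abelian group `M(a, b)`. -/
abbrev Elt (a b : C) : Type w := (M.functor.obj (op a)).obj b

/-- `f_* : M(c, a) → M(c, b)`. -/
def push {a b : C} (f : a ⟶ b) (c : C) : M.Elt c a →+ M.Elt c b :=
  ((M.functor.obj (op c)).map f).hom

/-- `f^* : M(b, c) → M(a, c)`. -/
def pull {a b : C} (f : a ⟶ b) (c : C) : M.Elt b c →+ M.Elt a c :=
  ((M.functor.map f.op).app c).hom

lemma push_id (a c : C) (x : M.Elt c a) : M.push (𝟙 a) c x = x := by
  simp [push]

lemma pull_id (a c : C) (x : M.Elt a c) : M.pull (𝟙 a) c x = x := by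
  simp [pull]

lemma push_comp {a b d : C} (f : a ⟶ b) (g : b ⟶ d) (c : C) (x : M.Elt c a) :
    M.push (f ≫ g) c x = M.push g c (M.push f c x) := by
  simp [push]

lemma pull_comp {a b d : C} (f : a ⟶ b) (g : b ⟶ d) (c : C) (x : M.Elt d c) :
    M.pull (f ≫ g) c x = M.pull f c (M.pull g c x) := by
  simp [pull]

lemma push_pull {a b c d : C} (f : a ⟶ b) (g : c ⟶ d) (x : M.Elt b c) :
    M.push g a (M.pull f c x) = M.pull f d (M.push g b x) := by
  have h := (M.functor.map f.op).naturality g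
  exact (ConcreteCategory.congr_hom h x).symm

lemma push_add_hom {a b : C} (f g : a ⟶ b) (c : C) (x : M.Elt c a) :
    M.push (f + g) c x = M.push f c x + M.push g c x := by
  simp [push, M.map_add_right]

lemma pull_add_hom {a b : C} (f g : a ⟶ b) (c : C) (x : M.Elt b c) :
    M.pull (f + g) c x = M.pull f c x + M.pull g c x := by
  change ((M.functor.map (f + g).op).app c).hom x = _
  rw [M.map_add_left]
  rfl

lemma push_zero_hom (a b c : C) (x : M.Elt c a) : M.push (0 : a ⟶ b) c x = 0 := by
  have h := M.push_add_hom (0 : a ⟶ b) 0 c x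
  rwa [add_zero, left_eq_add] at h

lemma pull_zero_hom (a b c : C) (x : M.Elt b c) : M.pull (0 : a ⟶ b) c x = 0 := by
  have h := M.pull_add_hom (0 : a ⟶ b) 0 c x
  rwa [add_zero, left_eq_add] at h

end Bimodule

/-- The category `C ⋉ M`: it has the objects of `C`. -/
structure SplitExt {C : Type u} [Category.{v} C] [Preadditive C] [ExactCategory C]
    (_ : Bimodule.{w} C) where
  obj : C

namespace SplitExt

variable {C : Type u} [Category.{v} C] [Preadditive C] [ExactCategory C] (M : Bimodule.{w} C)

/-- `(C ⋉ M)(a, b) = C(a, b) ⊕ M(a, b)` with `(f, m) ∘ (g, n) = (f ∘ g, f_* n + g^* m)`. -/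
instance : Category (SplitExt M) where
  Hom a b := (a.obj ⟶ b.obj) × M.Elt a.obj b.obj
  id a := (𝟙 a.obj, 0)
  comp {a _ c} g f := (g.1 ≫ f.1, M.push f.1 a.obj g.2 + M.pull g.1 c.obj f.2)
  id_comp f := by ext <;> simp [M.pull_id]
  comp_id f := by ext <;> simp [M.push_id]
  assoc f g h := by
    ext
    · simp
    · simp [M.push_comp, M.pull_comp, M.push_pull, add_assoc]

variable {M}

@[simp] lemma id_fst (a : SplitExt M) : Prod.fst (𝟙 a) = 𝟙 a.obj := rfl
@[simp] lemma id_snd (a : SplitExt M) : Prod.snd (𝟙 a) = 0 := rfl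
@[simp] lemma comp_fst {a b c : SplitExt M} (g : a ⟶ b) (f : b ⟶ c) :
    Prod.fst (g ≫ f) = Prod.fst g ≫ Prod.fst f := rfl
@[simp] lemma comp_snd {a b c : SplitExt M} (g : a ⟶ b) (f : b ⟶ c) :
    Prod.snd (g ≫ f) = M.push (Prod.fst f) a.obj (Prod.snd g)
      + M.pull (Prod.fst g) c.obj (Prod.snd f) := rfl

lemma hom_ext {a b : SplitExt M} {f g : a ⟶ b} (h₁ : Prod.fst f = Prod.fst g)
    (h₂ : Prod.snd f = Prod.snd g) : f = g :=
  Prod.ext h₁ h₂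

variable (M)

instance : Preadditive (SplitExt M) where
  homGroup a b := inferInstanceAs (AddCommGroup ((a.obj ⟶ b.obj) × M.Elt a.obj b.obj))
  add_comp a b c f f' g := by
    refine hom_ext (Preadditive.add_comp _ _ _ _ _ _) ?_
    change M.push g.1 _ (f.2 + f'.2) + M.pull (f.1 + f'.1) _ g.2 =
      (M.push g.1 _ f.2 + M.pull f.1 _ g.2) + (M.push g.1 _ f'.2 + M.pull f'.1 _ g.2)
    rw [map_add, M.pull_add_hom]; abel
  comp_add a b c f g g' := by
    refine hom_ext (Preadditive.comp_add _ _ _ _ _ _) ?_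
    change M.push (g.1 + g'.1) _ f.2 + M.pull f.1 _ (g.2 + g'.2) =
      (M.push g.1 _ f.2 + M.pull f.1 _ g.2) + (M.push g'.1 _ f.2 + M.pull f.1 _ g'.2)
    rw [map_add, M.push_add_hom]; abel

@[simp] lemma zero_fst (a b : SplitExt M) : Prod.fst (0 : a ⟶ b) = 0 := rfl
@[simp] lemma zero_snd (a b : SplitExt M) : Prod.snd (0 : a ⟶ b) = 0 := rfl

/-- The sequence `a ⟶ b ⟶ c` with maps `(i, m)` and `(q, n)` is exact if `a ⟶ b ⟶ c` with maps
`i` and `q` is exact in `C` and `q_* m + i^* n = 0` in `M(a, c)`. -/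
instance : ConflationCategory (SplitExt M) where
  zeroObj := ⟨zeroObj⟩
  isZero_zeroObj := by
    rw [IsZero.iff_id_eq_zero]
    exact hom_ext (isZero_zeroObj.eq_of_src _ _) rfl
  IsConflation {a b c} f g := IsConflation (Prod.fst f) (Prod.fst g) ∧
    M.push (Prod.fst g) a.obj (Prod.snd f) + M.pull (Prod.fst f) c.obj (Prod.snd g) = 0
  conflation_zero_id a := ⟨conflation_zero_id a.obj, by simp⟩
  conflation_id_zero a := ⟨conflation_id_zero a.obj, by simp⟩

/-- The zero section `s : C ⥤ C ⋉ M`. -/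
def zeroSection : C ⥤ SplitExt M where
  obj a := ⟨a⟩
  map f := (f, 0)
  map_id _ := rfl
  map_comp f g := hom_ext rfl (by simp)

/-- The projection `p : C ⋉ M ⥤ C`. -/
def proj : SplitExt M ⥤ C where
  obj a := a.obj
  map f := Prod.fst f
  map_id _ := rfl
  map_comp _ _ := rfl

end SplitExt

/-! ### The iterated `S`-construction -/

/-- `Cat([1], [p])`: its objects are the pairs `i ≤ j` in `[p] = {0, …, p}`. -/
@[ext]
structure Ar (p : SimplexCategory) where
  src : Fin (p.len + 1)
  tgt : Fin (p.len + 1)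
  le : src ≤ tgt

instance (p : SimplexCategory) : PartialOrder (Ar p) where
  le θ ρ := θ.src ≤ ρ.src ∧ θ.tgt ≤ ρ.tgt
  le_refl θ := ⟨le_rfl, le_rfl⟩
  le_trans _ _ _ h h' := ⟨h.1.trans h'.1, h.2.trans h'.2⟩
  le_antisymm _ _ h h' := Ar.ext (le_antisymm h.1 h'.1) (le_antisymm h.2 h'.2)

/-- Composition with `f : [p] → [q]`. -/
def Ar.map {p q : SimplexCategory} (f : p ⟶ q) : Ar p →o Ar q where
  toFun θ := ⟨f.toOrderHom θ.src, f.toOrderHom θ.tgt, f.toOrderHom.monotone θ.le⟩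
  monotone' _ _ h := ⟨f.toOrderHom.monotone h.1, f.toOrderHom.monotone h.2⟩

/-- The product of the posets `Cat([1], [p i])`. -/
abbrev Cube {ι : Type} (p : ι → SimplexCategory) : Type := ∀ i, Ar (p i)

/-- The product poset, as a category. -/
instance cubeCategory {ι : Type} (p : ι → SimplexCategory) : Category.{0} (Cube p) :=
  Preorder.smallCategory _

/-- `θ ≤ θ' ≤ θ''` are, in the coordinate `i`, the pairs `a ≤ b`, `a ≤ c`, `b ≤ c` for some
`a ≤ b ≤ c`, and they agree in all the other coordinates. -/
structure IsTriangle {ι : Type} {p : ι → SimplexCategory} (i : ι) (θ θ' θ'' : Cube p) : Prop where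
  src_eq : (θ i).src = (θ' i).src
  tgt_eq : (θ' i).tgt = (θ'' i).tgt
  mid_eq : (θ i).tgt = (θ'' i).src
  other : ∀ j, j ≠ i → θ j = θ' j
  other' : ∀ j, j ≠ i → θ' j = θ'' j
  le : θ ≤ θ'
  le' : θ' ≤ θ''

section SConstruction

variable (E : Type u) [Category.{v} E] [Preadditive E] [ConflationCategory E]

/-- The condition for a diagram on `∏ i, Cat([1], [p i])` to lie in the iterated `S`-construction
`S_{p i₁} ⋯ S_{p iₙ} E` (where the exact sequences of `S_p E` are the pointwise exact ones, and its
zero object is the constant diagram): in each variable, with the others fixed, `X_{aa} = 0` and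
`X_{ab} ⟶ X_{ac} ⟶ X_{bc}` is exact for `a ≤ b ≤ c`. -/
def isSDiagram {ι : Type} (p : ι → SimplexCategory) : ObjectProperty (Cube p ⥤ E) := fun X =>
  (∀ (θ : Cube p) (i : ι), (θ i).src = (θ i).tgt → X.obj θ = zeroObj) ∧
  (∀ (i : ι) (θ θ' θ'' : Cube p) (h : IsTriangle i θ θ' θ''),
    IsConflation (X.map (homOfLE h.le)) (X.map (homOfLE h.le')))

/-- The category `S^{(n)}_p E`, where `n` is the number of elements of `ι`; a full subcategory of
the category of diagrams. -/
abbrev SCat {ι : Type} (p : ι → SimplexCategory) := (isSDiagram E p).FullSubcategory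

variable {E}

namespace SCat

variable {ι : Type} {p q : ι → SimplexCategory}

/-- The multisimplicial structure: restriction along `f : p ⟶ q`. -/
def restrict (f : ∀ i, p i ⟶ q i) : SCat E q ⥤ SCat E p :=
  (isSDiagram E p).lift
    ((isSDiagram E q).ι ⋙ (Functor.whiskeringLeft _ _ _).obj
      (Monotone.functor (f := fun (θ : Cube p) => (fun i => Ar.map (f i) (θ i) : Cube q))
        (fun _ _ h i => (Ar.map (f i)).monotone (h i))))
    (fun X => ⟨fun _ i h => X.property.1 _ i (congrArg (f i).toOrderHom h),
      fun i _ _ _ h => X.property.2 i _ _ _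
        { src_eq := congrArg (f i).toOrderHom h.src_eq
          tgt_eq := congrArg (f i).toOrderHom h.tgt_eq
          mid_eq := congrArg (f i).toOrderHom h.mid_eq
          other := fun j hj => congrArg (Ar.map (f j)) (h.other j hj)
          other' := fun j hj => congrArg (Ar.map (f j)) (h.other' j hj)
          le := fun j => (Ar.map (f j)).monotone (h.le j)
          le' := fun j => (Ar.map (f j)).monotone (h.le' j) }⟩)

/-- Permutation of the variables: `(σ X)(θ) = X(θ ∘ σ)`. -/
def permute (k : SimplexCategory) (σ : Equiv.Perm ι) :
    SCat E (fun _ : ι => k) ⥤ SCat E (fun _ : ι => k) :=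
  (isSDiagram E _).lift
    ((isSDiagram E _).ι ⋙ (Functor.whiskeringLeft _ _ _).obj
      (Monotone.functor (f := fun (θ : Cube (fun _ : ι => k)) =>
          (fun i => θ (σ i) : Cube (fun _ : ι => k)))
        (fun _ _ h i => h (σ i))))
    (fun X => ⟨fun θ i h => X.property.1 (fun j => θ (σ j)) (σ.symm i) (Eq.subst
        (motive := fun j => (θ j).src = (θ j).tgt) (σ.apply_symm_apply i).symm h),
      fun i θ θ' θ'' h => X.property.2 (σ.symm i) (fun j => θ (σ j)) (fun j => θ' (σ j))
        (fun j => θ'' (σ j))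
        { src_eq := Eq.subst (motive := fun j => (θ j).src = (θ' j).src)
            (σ.apply_symm_apply i).symm h.src_eq
          tgt_eq := Eq.subst (motive := fun j => (θ' j).tgt = (θ'' j).tgt)
            (σ.apply_symm_apply i).symm h.tgt_eq
          mid_eq := Eq.subst (motive := fun j => (θ j).tgt = (θ'' j).src)
            (σ.apply_symm_apply i).symm h.mid_eq
          other := fun j hj => h.other (σ j) (fun e => hj (by simp [← e]))
          other' := fun j hj => h.other' (σ j) (fun e => hj (by simp [← e]))
          le := fun j => h.le (σ j)
          le' := fun j => h.le' (σ j) }⟩)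

lemma conflation_zero_of (a b c : E) (ha : a = zeroObj) (hb : b = zeroObj) (hc : c = zeroObj)
    (f : a ⟶ b) (g : b ⟶ c) : IsConflation f g := by
  subst ha hb hc
  obtain rfl := isZero_zeroObj.eq_of_src f 0
  obtain rfl := isZero_zeroObj.eq_of_src g (𝟙 _)
  exact conflation_zero_id _

variable (E p) in
/-- The zero object of `S^{(n)}_p E`: the constant diagram at `0`. -/
def zero : SCat E p :=
  ⟨(Functor.const _).obj zeroObj, fun _ _ _ => rfl, fun _ _ _ _ _ =>
    conflation_zero_of _ _ _ rfl rfl rfl _ _⟩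

end SCat

/-- `A` or `0`, according to the value of a Boolean. -/
def extObj : Bool → E → E
  | true, A => A
  | false, _ => zeroObj

/-- Extension of a morphism by zero. -/
def extMap : ∀ (b c : Bool) {A B : E}, (A ⟶ B) → (extObj b A ⟶ extObj c B)
  | true, true, _, _, f => f
  | true, false, _, _, _ => 0
  | false, _, _, _, _ => 0

lemma extMap_id (b : Bool) (A : E) : extMap b b (𝟙 A) = 𝟙 (extObj b A) := by
  cases b
  · exact isZero_zeroObj.eq_of_src _ _
  · rfl

lemma extMap_comp {b₁ b₂ b₃ : Bool} (h : b₁ = true → b₃ = true → b₂ = true) {A B D : E}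
    (f : A ⟶ B) (g : B ⟶ D) :
    extMap b₁ b₃ (f ≫ g) = extMap b₁ b₂ f ≫ extMap b₂ b₃ g := by
  cases b₁ <;> cases b₂ <;> cases b₃ <;> first | exact absurd (h rfl rfl) (by decide) | skip
  all_goals first | rfl | exact zero_comp.symm | exact comp_zero.symm

/-- Whether the composite of `θ ∈ Cat([1], [k])` with `t : [k] → [1]` is the identity of `[1]`. -/
def spans {k : SimplexCategory} (t : k ⟶ SimplexCategory.mk 1) (θ : Ar k) : Bool :=
  decide (t.toOrderHom θ.src = 0 ∧ t.toOrderHom θ.tgt = 1)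

lemma spans_convex {k : SimplexCategory} (t : k ⟶ SimplexCategory.mk 1) {θ θ' θ'' : Ar k} (h : θ ≤ θ')
    (h' : θ' ≤ θ'') : spans t θ = true → spans t θ'' = true → spans t θ' = true := by
  simp only [spans, decide_eq_true_eq]
  intro h₁ h₂
  have a := t.toOrderHom.monotone h'.1
  have b := t.toOrderHom.monotone h.2
  rw [h₂.1] at a
  rw [h₁.2] at b
  exact ⟨Fin.le_zero_iff.mp a, le_antisymm (Fin.le_last _) b⟩

namespace SCat

/-- Extension by zero along `t`, on diagrams: the value at `θ` is `X(θ₀, …, θ_{n-1})` if `t ∘ θₙ` is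
the identity of `[1]`, and `0` otherwise. -/
def suspObj {n : ℕ} {k : SimplexCategory} (t : k ⟶ SimplexCategory.mk 1) (X : Cube (fun _ : Fin n => k) ⥤ E) :
    Cube (fun _ : Fin (n + 1) => k) ⥤ E where
  obj θ := extObj (spans t (θ (Fin.last n))) (X.obj (fun i => θ i.castSucc))
  map {θ θ'} f := extMap (spans t (θ (Fin.last n))) (spans t (θ' (Fin.last n)))
    (X.map (homOfLE (fun i => leOfHom f i.castSucc)))
  map_id _ := (congrArg _ (X.map_id _)).trans (extMap_id _ _)
  map_comp f g := (congrArg _ (X.map_comp _ _)).trans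
    (extMap_comp (spans_convex t (leOfHom f _) (leOfHom g _)) _ _)

lemma susp_conflation_aux {P : Type} [Preorder P] (X : P ⥤ E) {a a' a'' : P} (h : a ≤ a')
    (h' : a' ≤ a'') (e : a = a') (e' : a' = a'') (b b' b'' : Bool)
    (hb : b' = xor b b'') (hb' : (b && b'') = false) :
    IsConflation (extMap b b' (X.map (homOfLE h))) (extMap b' b'' (X.map (homOfLE h'))) := by
  subst e e'
  have e₁ : X.map (homOfLE h) = 𝟙 _ := X.map_id _
  rw [e₁]
  cases b <;> cases b'' <;> cases hb
  · exact conflation_zero_of _ _ _ rfl rfl rfl _ _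
  · exact conflation_zero_id _
  · exact conflation_id_zero _
  · cases hb'

lemma spans_triangle {k : SimplexCategory} (t : k ⟶ SimplexCategory.mk 1) (θ θ' θ'' : Ar k)
    (h₁ : θ.src = θ'.src) (h₂ : θ'.tgt = θ''.tgt) (h₃ : θ.tgt = θ''.src) :
    spans t θ' = xor (spans t θ) (spans t θ'') ∧ (spans t θ && spans t θ'') = false := by
  have a := t.toOrderHom.monotone θ.le
  have b := t.toOrderHom.monotone θ''.le
  simp only [spans, ← h₁, h₂, h₃] at *
  generalize t.toOrderHom θ.src = x at *
  generalize t.toOrderHom θ''.src = y at *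
  generalize t.toOrderHom θ''.tgt = z at *
  change Fin 2 at x
  change Fin 2 at y
  change Fin 2 at z
  revert x y z
  decide

lemma suspObj_isSDiagram {n : ℕ} {k : SimplexCategory} (t : k ⟶ SimplexCategory.mk 1)
    (X : Cube (fun _ : Fin n => k) ⥤ E) (hX : isSDiagram E _ X) :
    isSDiagram E _ (suspObj t X) := by
  refine ⟨fun θ i h => ?_, fun i θ θ' θ'' h => ?_⟩
  · induction i using Fin.lastCases with
    | last =>
      have : spans t (θ (Fin.last n)) = false := by
        simp only [spans, h]
        rw [decide_eq_false_iff_not]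
        rintro ⟨h₁, h₂⟩
        exact absurd (h₁.symm.trans h₂) (by decide)
      change extObj (spans t (θ (Fin.last n))) _ = _
      rw [this]
      rfl
    | cast i =>
      have e := hX.1 (fun j => θ j.castSucc) i h
      change extObj (spans t (θ (Fin.last n))) (X.obj (fun j => θ j.castSucc)) = _
      rw [e]
      cases spans t (θ (Fin.last n)) <;> rfl
  · induction i using Fin.lastCases with
    | last =>
      obtain ⟨h₁, h₂⟩ := spans_triangle t _ _ _ h.src_eq h.tgt_eq h.mid_eq
      exact susp_conflation_aux X _ _
        (funext fun j => h.other j.castSucc (Fin.castSucc_ne_last j))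
        (funext fun j => h.other' j.castSucc (Fin.castSucc_ne_last j)) _ _ _ h₁ h₂
    | cast i =>
      have e := h.other (Fin.last n) (Fin.castSucc_ne_last i).symm
      have e' := h.other' (Fin.last n) (Fin.castSucc_ne_last i).symm
      have key := hX.2 i _ _ _
        { src_eq := h.src_eq
          tgt_eq := h.tgt_eq
          mid_eq := h.mid_eq
          other := fun j hj => h.other j.castSucc (fun e => hj (Fin.castSucc_injective _ e))
          other' := fun j hj => h.other' j.castSucc (fun e => hj (Fin.castSucc_injective _ e))
          le := fun j => h.le j.castSucc
          le' := fun j => h.le' j.castSucc : IsTriangle (p := fun _ : Fin n => k) i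
            (fun j => θ j.castSucc) (fun j => θ' j.castSucc) (fun j => θ'' j.castSucc) }
      change IsConflation (extMap (spans t (θ (Fin.last n))) (spans t (θ' (Fin.last n))) _)
        (extMap (spans t (θ' (Fin.last n))) (spans t (θ'' (Fin.last n))) _)
      rw [← e', ← e]
      cases spans t (θ (Fin.last n))
      · exact conflation_zero_of _ _ _ rfl rfl rfl _ _
      · exact key

/-- Extension by zero along `t`, as a functor.  For `t = id : [1] → [1]` this is the identification
of `S^{(n)}_p` with `S^{(n+1)}_{(p, 1)}`. -/
def susp {n : ℕ} {k : SimplexCategory} (t : k ⟶ SimplexCategory.mk 1) :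
    SCat E (fun _ : Fin n => k) ⥤ SCat E (fun _ : Fin (n + 1) => k) where
  obj X := ⟨suspObj t X.obj, suspObj_isSDiagram t X.obj X.property⟩
  map {X Y} α := ObjectProperty.homMk
    { app := fun θ => extMap _ _ (α.hom.app (fun i => θ i.castSucc))
      naturality := fun θ θ' f => by
        change extMap _ _ _ ≫ extMap _ _ _ = extMap _ _ _ ≫ extMap _ _ _
        exact (extMap_comp (fun _ h => h) _ _).symm.trans ((congrArg _ (α.hom.naturality _)).trans
          (extMap_comp (fun h _ => h) _ _)) }
  map_id X := by
    ext θ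
    exact extMap_id _ _
  map_comp α β := by
    ext θ
    exact extMap_comp (fun h _ => h) _ _

end SCat

end SConstruction

/-! ### Symmetric spectra -/

/-- A symmetric spectrum of pointed simplicial sets.  The structure map `Xₙ ∧ S¹ → Xₙ₊₁`, with
`S¹ = Δ[1]/∂Δ[1]`, is given by the maps `susp n k t` on `k`-simplices, where `t : [k] → [1]` runs
through the `k`-simplices of `Δ[1]`.  Because transpositions of neighbours generate the symmetric
groups, the axioms `susp_act` and `susp_swap` say exactly that all the iterated structure maps
`Xₙ ∧ Sᵐ → Xₙ₊ₘ` are equivariant for the product of the `n`-th and `m`-th symmetric groups. -/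
structure SymmetricSpectrum where
  level : ℕ → SSet.{u}
  base : ∀ (n : ℕ) (k : SimplexCategoryᵒᵖ), (level n).obj k
  base_map : ∀ (n : ℕ) {k l : SimplexCategoryᵒᵖ} (f : k ⟶ l),
    (level n).map f (base n k) = base n l
  act : ∀ n : ℕ, Equiv.Perm (Fin n) → (level n ⟶ level n)
  act_one : ∀ n : ℕ, act n 1 = 𝟙 _
  act_mul : ∀ (n : ℕ) (σ τ : Equiv.Perm (Fin n)), act n (σ * τ) = act n τ ≫ act n σ
  act_base : ∀ (n : ℕ) (σ : Equiv.Perm (Fin n)) (k : SimplexCategoryᵒᵖ),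
    (act n σ).app k (base n k) = base n k
  susp : ∀ (n : ℕ) (k : SimplexCategoryᵒᵖ), (k.unop ⟶ SimplexCategory.mk 1) →
    (level n).obj k → (level (n + 1)).obj k
  susp_map : ∀ (n : ℕ) {k l : SimplexCategoryᵒᵖ} (f : k ⟶ l)
    (t : k.unop ⟶ SimplexCategory.mk 1) (x : (level n).obj k),
    (level (n + 1)).map f (susp n k t x) = susp n l (f.unop ≫ t) ((level n).map f x)
  susp_base : ∀ (n : ℕ) (k : SimplexCategoryᵒᵖ) (t : k.unop ⟶ SimplexCategory.mk 1),
    susp n k t (base n k) = base (n + 1) k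
  susp_const : ∀ (n : ℕ) (k : SimplexCategoryᵒᵖ) (t : k.unop ⟶ SimplexCategory.mk 1)
    (x : (level n).obj k), (∀ i j, t.toOrderHom i = t.toOrderHom j) →
    susp n k t x = base (n + 1) k
  susp_act : ∀ (n : ℕ) (k : SimplexCategoryᵒᵖ) (t : k.unop ⟶ SimplexCategory.mk 1)
    (x : (level n).obj k) (σ : Equiv.Perm (Fin n)) (σ' : Equiv.Perm (Fin (n + 1))),
    (∀ i, σ' i.castSucc = (σ i).castSucc) → σ' (Fin.last n) = Fin.last n →
    susp n k t ((act n σ).app k x) = (act (n + 1) σ').app k (susp n k t x)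
  susp_swap : ∀ (n : ℕ) (k : SimplexCategoryᵒᵖ) (s t : k.unop ⟶ SimplexCategory.mk 1)
    (x : (level n).obj k),
    susp (n + 1) k s (susp n k t x) =
      (act (n + 2) (Equiv.swap (Fin.last n).castSucc (Fin.last (n + 1)))).app k
        (susp (n + 1) k t (susp n k s x))

/-- Maps of symmetric spectra. -/
structure SymmetricSpectrum.Map (X Y : SymmetricSpectrum.{u}) where
  app : ∀ n : ℕ, X.level n ⟶ Y.level n
  app_base : ∀ (n : ℕ) (k : SimplexCategoryᵒᵖ), (app n).app k (X.base n k) = Y.base n k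
  app_act : ∀ (n : ℕ) (σ : Equiv.Perm (Fin n)), X.act n σ ≫ app n = app n ≫ Y.act n σ
  app_susp : ∀ (n : ℕ) (k : SimplexCategoryᵒᵖ) (t : k.unop ⟶ SimplexCategory.mk 1)
    (x : (X.level n).obj k),
    (app (n + 1)).app k (X.susp n k t x) = Y.susp n k t ((app n).app k x)

/-- A map of simplicial sets is an equivalence if its geometric realization is a homotopy
equivalence (equivalently, as the realizations are CW complexes, a weak one). -/
def IsEquivalence {X Y : SSet.{u}} (f : X ⟶ Y) : Prop :=
  ∃ e : ContinuousMap.HomotopyEquiv (SSet.toTop.obj X) (SSet.toTop.obj Y),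
    e.toFun = (SSet.toTop.map f).hom

/-! ### The K-theory spectrum -/

section KTheory

variable {E : Type u} [Category.{v} E] [Preadditive E] [ConflationCategory E]

namespace SCat

variable {ι : Type} {p : ι → SimplexCategory}

lemma eqToHom_app {X Y : Core (SCat E p)} (h : X = Y) (θ : Cube p) :
    (eqToHom h).iso.hom.hom.app θ = eqToHom (congrArg (fun Z => Z.of.obj.obj θ) h) := by
  subst h
  rfl

lemma core_ext {X Y : Core (SCat E p)} (h : ∀ θ, X.of.obj.obj θ = Y.of.obj.obj θ)
    (h' : ∀ (θ ρ : Cube p) (f : θ ⟶ ρ),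
      X.of.obj.map f = eqToHom (h θ) ≫ Y.of.obj.map f ≫ eqToHom (h ρ).symm) : X = Y := by
  obtain ⟨⟨X, hX⟩⟩ := X
  obtain ⟨⟨Y, hY⟩⟩ := Y
  obtain rfl : X = Y := CategoryTheory.Functor.ext h h'
  rfl

/-- Two functors into the groupoid of isomorphisms of `S^{(n)}_p E` are equal if they agree as
diagrams in `E`. -/
lemma functor_ext {J : Type} [Category.{0} J] {F G : J ⥤ Core (SCat E p)}
    (h : ∀ a θ, (F.obj a).of.obj.obj θ = (G.obj a).of.obj.obj θ)
    (h₁ : ∀ (a : J) (θ ρ : Cube p) (f : θ ⟶ ρ),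
      (F.obj a).of.obj.map f = eqToHom (h a θ) ≫ (G.obj a).of.obj.map f ≫ eqToHom (h a ρ).symm)
    (h₂ : ∀ (a b : J) (f : a ⟶ b) (θ : Cube p),
      (F.map f).iso.hom.hom.app θ =
        eqToHom (h a θ) ≫ (G.map f).iso.hom.hom.app θ ≫ eqToHom (h b θ).symm) : F = G := by
  refine CategoryTheory.Functor.ext (fun a => core_ext (h a) (h₁ a)) (fun a b f => ?_)
  apply Core.hom_ext
  ext θ
  refine (h₂ a b f θ).trans ?_
  change _ = (eqToHom (core_ext (h a) (h₁ a))).iso.hom.hom.app θ ≫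
    (G.map f).iso.hom.hom.app θ ≫ (eqToHom (core_ext (h b) (h₁ b)).symm).iso.hom.hom.app θ
  rw [eqToHom_app, eqToHom_app]

/-- Two such functors are equal if all their values vanish. -/
lemma functor_ext_zero {J : Type} [Category.{0} J] {F G : J ⥤ Core (SCat E p)}
    (hF : ∀ a θ, (F.obj a).of.obj.obj θ = zeroObj)
    (hG : ∀ a θ, (G.obj a).of.obj.obj θ = zeroObj) : F = G := by
  have hz : ∀ a θ, IsZero ((F.obj a).of.obj.obj θ) := fun a θ => by
    rw [hF]; exact isZero_zeroObj
  exact functor_ext (fun a θ => (hF a θ).trans (hG a θ).symm)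
    (fun a θ ρ f => (hz a θ).eq_of_src _ _) (fun a b f θ => (hz a θ).eq_of_src _ _)

end SCat

lemma extObj_zero (b : Bool) : extObj b (zeroObj : E) = zeroObj := by
  cases b <;> rfl

lemma extObj_comm (b c : Bool) (A : E) : extObj b (extObj c A) = extObj c (extObj b A) := by
  cases b <;> cases c <;> rfl

lemma extMap_comm (b b' c c' : Bool) {A B : E} (f : A ⟶ B) :
    extMap b b' (extMap c c' f) = eqToHom (extObj_comm b c A) ≫ extMap c c' (extMap b b' f) ≫
      eqToHom (extObj_comm b' c' B).symm := by
  cases b <;> cases b' <;> cases c <;> cases c' <;>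
    first
    | exact isZero_zeroObj.eq_of_src _ _
    | exact isZero_zeroObj.eq_of_tgt _ _
    | exact (Category.comp_id f).symm.trans (Category.id_comp _).symm

section

variable {n : ℕ} {k : SimplexCategory} (s t : k ⟶ SimplexCategory.mk 1)

lemma susp_act_obj {m m' : Fin (n + 1)} {g g' : Fin n → Fin (n + 1)} (hm : m = m') (hg : g = g')
    (X : Cube (fun _ : Fin n => k) → E) (θ : Cube (fun _ : Fin (n + 1) => k)) :
    extObj (spans t (θ m)) (X (fun i => θ (g i))) =
      extObj (spans t (θ m')) (X (fun i => θ (g' i))) := by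
  subst hm hg
  rfl

lemma susp_act_map {m m' : Fin (n + 1)} {g g' : Fin n → Fin (n + 1)} (hm : m = m') (hg : g = g')
    (X : Cube (fun _ : Fin n => k) ⥤ E) {θ ρ : Cube (fun _ : Fin (n + 1) => k)} (h : θ ≤ ρ) :
    extMap (spans t (θ m)) (spans t (ρ m))
      (X.map (homOfLE (fun i => h (g i)) : (fun i => θ (g i)) ⟶ (fun i => ρ (g i)))) =
    eqToHom (susp_act_obj t hm hg X.obj θ) ≫ extMap (spans t (θ m')) (spans t (ρ m'))
      (X.map (homOfLE (fun i => h (g' i)) : (fun i => θ (g' i)) ⟶ (fun i => ρ (g' i)))) ≫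
    eqToHom (susp_act_obj t hm hg X.obj ρ).symm := by
  subst hm hg
  exact (Category.comp_id _).symm.trans (Category.id_comp _).symm

lemma susp_act_app {m m' : Fin (n + 1)} {g g' : Fin n → Fin (n + 1)} (hm : m = m') (hg : g = g')
    {X Y : Cube (fun _ : Fin n => k) → E} (α : ∀ θ, X θ ⟶ Y θ)
    (θ : Cube (fun _ : Fin (n + 1) => k)) :
    extMap (spans t (θ m)) (spans t (θ m)) (α (fun i => θ (g i))) =
    eqToHom (susp_act_obj t hm hg X θ) ≫ extMap (spans t (θ m')) (spans t (θ m'))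
      (α (fun i => θ (g' i))) ≫ eqToHom (susp_act_obj t hm hg Y θ).symm := by
  subst hm hg
  exact (Category.comp_id _).symm.trans (Category.id_comp _).symm

lemma susp_swap_obj {m₁ m₁' m₂ m₂' : Fin (n + 2)} {g g' : Fin n → Fin (n + 2)} (h₁ : m₁ = m₁')
    (h₂ : m₂ = m₂') (hg : g = g') (X : Cube (fun _ : Fin n => k) → E)
    (θ : Cube (fun _ : Fin (n + 2) => k)) :
    extObj (spans s (θ m₁)) (extObj (spans t (θ m₂)) (X (fun i => θ (g i)))) =
      extObj (spans t (θ m₂')) (extObj (spans s (θ m₁')) (X (fun i => θ (g' i)))) := by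
  subst h₁ h₂ hg
  exact extObj_comm _ _ _

lemma susp_swap_map {m₁ m₁' m₂ m₂' : Fin (n + 2)} {g g' : Fin n → Fin (n + 2)} (h₁ : m₁ = m₁')
    (h₂ : m₂ = m₂') (hg : g = g') (X : Cube (fun _ : Fin n => k) ⥤ E)
    {θ ρ : Cube (fun _ : Fin (n + 2) => k)} (h : θ ≤ ρ) :
    extMap (spans s (θ m₁)) (spans s (ρ m₁)) (extMap (spans t (θ m₂)) (spans t (ρ m₂))
      (X.map (homOfLE (fun i => h (g i)) : (fun i => θ (g i)) ⟶ (fun i => ρ (g i))))) =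
    eqToHom (susp_swap_obj s t h₁ h₂ hg X.obj θ) ≫
      extMap (spans t (θ m₂')) (spans t (ρ m₂')) (extMap (spans s (θ m₁')) (spans s (ρ m₁'))
        (X.map (homOfLE (fun i => h (g' i)) : (fun i => θ (g' i)) ⟶ (fun i => ρ (g' i))))) ≫
    eqToHom (susp_swap_obj s t h₁ h₂ hg X.obj ρ).symm := by
  subst h₁ h₂ hg
  exact extMap_comm _ _ _ _ _

lemma susp_swap_app {m₁ m₁' m₂ m₂' : Fin (n + 2)} {g g' : Fin n → Fin (n + 2)} (h₁ : m₁ = m₁')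
    (h₂ : m₂ = m₂') (hg : g = g') {X Y : Cube (fun _ : Fin n => k) → E} (α : ∀ θ, X θ ⟶ Y θ)
    (θ : Cube (fun _ : Fin (n + 2) => k)) :
    extMap (spans s (θ m₁)) (spans s (θ m₁)) (extMap (spans t (θ m₂)) (spans t (θ m₂))
      (α (fun i => θ (g i)))) =
    eqToHom (susp_swap_obj s t h₁ h₂ hg X θ) ≫
      extMap (spans t (θ m₂')) (spans t (θ m₂')) (extMap (spans s (θ m₁')) (spans s (θ m₁'))
        (α (fun i => θ (g' i)))) ≫
    eqToHom (susp_swap_obj s t h₁ h₂ hg Y θ).symm := by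
  subst h₁ h₂ hg
  exact extMap_comm _ _ _ _ _

end

lemma swap_last_castSucc {n : ℕ} (i : Fin n) :
    Equiv.swap (Fin.last n).castSucc (Fin.last (n + 1)) i.castSucc.castSucc =
      i.castSucc.castSucc :=
  Equiv.swap_apply_of_ne_of_ne
    (fun h => Fin.castSucc_ne_last i (Fin.castSucc_injective _ h)) (Fin.castSucc_ne_last _)

variable (E) in
/-- The simplicial set at level `n` of the K-theory spectrum of `E`: the diagonal of the
`(n + 1)`-simplicial set `N iS^{(n)} E`, the nerve of the groupoid of isomorphisms of the `n`-fold
`S`-construction. -/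
def kLevel (n : ℕ) : SSet.{max u v} where
  obj k := (nerve (Core (SCat E (fun _ : Fin n => k.unop)))).obj k
  map {k l} f := (nerve (Core (SCat E (fun _ : Fin n => k.unop)))).map f ≫
    (nerveMap (SCat.restrict (fun _ : Fin n => f.unop)).core).app l
  map_id _ := rfl
  map_comp _ _ := rfl

variable (E) in
/-- The K-theory symmetric spectrum of `E`. -/
def kTheory : SymmetricSpectrum.{max u v} where
  level := kLevel E
  base n k := (Functor.const _).obj ⟨SCat.zero E _⟩
  base_map n k l f := rfl
  act n σ := { app := fun k => (nerveMap (SCat.permute k.unop σ).core).app k }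
  act_one n := rfl
  act_mul n σ τ := rfl
  act_base n σ k := rfl
  susp n k t := (nerveMap (SCat.susp t).core).app k
  susp_map n k l f t x := rfl
  susp_base n k t := SCat.functor_ext_zero (fun _ _ => extObj_zero _) (fun _ _ => rfl)
  susp_const n k t x h := SCat.functor_ext_zero (fun a θ => by
    have : spans t (θ (Fin.last n)) = false := by
      simp only [spans]
      rw [decide_eq_false_iff_not]
      rintro ⟨h₁, h₂⟩
      exact absurd (h₁.symm.trans ((h _ _).trans h₂)) (by decide)
    change extObj (spans t (θ (Fin.last n))) _ = _
    rw [this]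
    rfl) (fun _ _ => rfl)
  susp_act n k t x σ σ' h h' := by
    have hg : (fun i => (σ i).castSucc) = fun i : Fin n => σ' i.castSucc :=
      funext fun i => (h i).symm
    exact SCat.functor_ext (fun a θ => susp_act_obj t h'.symm hg (x.obj a).of.obj.obj θ)
      (fun a θ ρ f => susp_act_map t h'.symm hg (x.obj a).of.obj (leOfHom f))
      (fun a b f θ => susp_act_app t h'.symm hg (x.map f).iso.hom.hom.app θ)
  susp_swap n k s t x := by
    have h₁ := (Equiv.swap_apply_left (Fin.last n).castSucc (Fin.last (n + 1))).symm
    have h₂ := (Equiv.swap_apply_right (Fin.last n).castSucc (Fin.last (n + 1))).symm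
    have hg := funext fun i : Fin n => (swap_last_castSucc i).symm
    exact SCat.functor_ext (fun a θ => susp_swap_obj s t h₁ h₂ hg (x.obj a).of.obj.obj θ)
      (fun a θ ρ f => susp_swap_map s t h₁ h₂ hg (x.obj a).of.obj (leOfHom f))
      (fun a b f θ => susp_swap_app s t h₁ h₂ hg (x.map f).iso.hom.hom.app θ)

end KTheory

/-! ### The spectrum `K(C; M)` and the map to `K(C ⋉ M)` -/

/-- The classifying space `BG` of an abelian group: the nerve of the category with one object. -/
abbrev classifying (G : Type w) [AddCommGroup G] : SSet.{w} :=
  nerve (SingleObj (Multiplicative G))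

/-- Functoriality of the classifying space. -/
abbrev classifyingMap {G H : Type w} [AddCommGroup G] [AddCommGroup H] (φ : G →+ H) :
    classifying G ⟶ classifying H :=
  nerveMap (SingleObj.mapHom _ _ (AddMonoidHom.toMultiplicative φ))

namespace Bimodule

variable {C : Type u} [Category.{v} C] [Preadditive C] [ExactCategory C] (M : Bimodule.{w} C)

section

variable {ι : Type} {p q : ι → SimplexCategory}

/-- The bimodule `S^{(n)}_p M` over `S^{(n)}_p C`: collections of `m_θ ∈ M(X_θ, Y_θ)` with
`X(a)^* m_θ = Y(a)_* m_ρ` in `M(X_ρ, Y_θ)` for all `a : ρ ⟶ θ`. -/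
def sBimod (X Y : SCat C p) : AddSubgroup (∀ θ : Cube p, M.Elt (X.obj.obj θ) (Y.obj.obj θ)) where
  carrier := {m | ∀ (ρ θ : Cube p) (a : ρ ⟶ θ),
    M.pull (X.obj.map a) _ (m θ) = M.push (Y.obj.map a) _ (m ρ)}
  zero_mem' ρ θ a := by simp
  add_mem' h h' ρ θ a := by simp [h ρ θ a, h' ρ θ a]
  neg_mem' h ρ θ a := by simp [h ρ θ a]

/-- Restriction along `f : p ⟶ q`. -/
def sRestrict (f : ∀ i, p i ⟶ q i) (X Y : SCat C q) :
    M.sBimod X Y →+ M.sBimod ((SCat.restrict f).obj X) ((SCat.restrict f).obj Y) where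
  toFun m := ⟨fun _ => m.1 _, fun _ _ _ => m.2 _ _ _⟩
  map_zero' := rfl
  map_add' _ _ := rfl

/-- Permutation of the variables. -/
def sPermute (k : SimplexCategory) (σ : Equiv.Perm ι) (X Y : SCat C (fun _ : ι => k)) :
    M.sBimod X Y →+ M.sBimod ((SCat.permute k σ).obj X) ((SCat.permute k σ).obj Y) where
  toFun m := ⟨fun θ => m.1 (fun i => θ (σ i)), fun _ _ _ => m.2 _ _ _⟩
  map_zero' := rfl
  map_add' _ _ := rfl

/-- Extension by zero, on elements. -/
def extElt : ∀ (b : Bool) {A B : C}, M.Elt A B → M.Elt (extObj b A) (extObj b B)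
  | true, _, _, m => m
  | false, _, _, _ => 0

lemma extElt_zero (b : Bool) (A B : C) : M.extElt b (0 : M.Elt A B) = 0 := by
  cases b <;> rfl

lemma extElt_add (b : Bool) {A B : C} (m m' : M.Elt A B) :
    M.extElt b (m + m') = M.extElt b m + M.extElt b m' := by
  cases b
  · exact (add_zero _).symm
  · rfl

lemma extElt_natural (b b' : Bool) {A A' B B' : C} (f : A ⟶ A') (g : B ⟶ B') (m : M.Elt A B)
    (m' : M.Elt A' B') (h : M.pull f _ m' = M.push g _ m) :
    M.pull (extMap b b' f) _ (M.extElt b' m') = M.push (extMap b b' g) _ (M.extElt b m) := by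
  cases b <;> cases b'
  · exact (M.pull_zero_hom _ _ _ _).trans (M.push_zero_hom _ _ _ _).symm
  · exact (M.pull_zero_hom _ _ _ _).trans (M.push_zero_hom _ _ _ _).symm
  · exact (M.pull_zero_hom _ _ _ _).trans (M.push_zero_hom _ _ _ _).symm
  · exact h

/-- Extension by zero along `t`. -/
def sSusp {n : ℕ} {k : SimplexCategory} (t : k ⟶ SimplexCategory.mk 1)
    (X Y : SCat C (fun _ : Fin n => k)) :
    M.sBimod X Y →+ M.sBimod ((SCat.susp t).obj X) ((SCat.susp t).obj Y) where
  toFun m := ⟨fun θ => M.extElt (spans t (θ (Fin.last n))) (m.1 (fun i => θ i.castSucc)),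
    fun _ _ _ => M.extElt_natural _ _ _ _ _ _ (m.2 _ _ _)⟩
  map_zero' := Subtype.ext (funext fun _ => M.extElt_zero _ _ _)
  map_add' _ _ := Subtype.ext (funext fun _ => M.extElt_add _ _ _)

/-- The functor `S^{(n)}_p C ⥤ S^{(n)}_p (C ⋉ M)` induced by the zero section, on objects. -/
def sSection (X : SCat C p) : SCat (SplitExt M) p :=
  ⟨X.obj ⋙ SplitExt.zeroSection M,
    fun θ i h => congrArg (SplitExt.zeroSection M).obj (X.property.1 θ i h),
    fun i θ θ' θ'' h => ⟨X.property.2 i θ θ' θ'' h,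
      (congrArg₂ (· + ·) (map_zero _) (map_zero _)).trans (add_zero _)⟩⟩

/-- The endomorphism of `s X` with components `(id, m_θ)`. -/
def sEnd (X : SCat C p) (m : M.sBimod X X) : M.sSection X ⟶ M.sSection X :=
  ObjectProperty.homMk
    { app := fun θ => ((𝟙 (X.obj.obj θ), m.1 θ) :
        (SplitExt.zeroSection M).obj (X.obj.obj θ) ⟶ (SplitExt.zeroSection M).obj (X.obj.obj θ))
      naturality := fun ρ θ a => SplitExt.hom_ext
        ((Category.comp_id _).trans (Category.id_comp _).symm) (by
          have := m.2 ρ θ a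
          simpa [sSection, SplitExt.zeroSection, M.push_id, M.pull_id] using this) }

lemma sEnd_zero (X : SCat C p) : M.sEnd X 0 = 𝟙 _ := by
  ext θ
  rfl

lemma sEnd_add (X : SCat C p) (m m' : M.sBimod X X) :
    M.sEnd X (m + m') = M.sEnd X m' ≫ M.sEnd X m := by
  ext θ
  refine SplitExt.hom_ext (Category.comp_id _).symm ?_
  simp [sEnd, sSection, SplitExt.zeroSection, M.push_id, M.pull_id, add_comm]

/-- `Ψ` on the summand of `∐_{S^{(n)}_p C} S^{(n)}_p M` indexed by `X`: the functor from the group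
`S^{(n)}_p M(X, X)` to `i S^{(n)}_p (C ⋉ M)` that takes `m` to the automorphism `(id, m)`. -/
def psiFunctor (X : SCat C p) :
    SingleObj (Multiplicative (M.sBimod X X)) ⥤ Core (SCat (SplitExt M) p) :=
  Core.functorToCore
    { obj := fun _ => M.sSection X
      map := fun m => M.sEnd X (Multiplicative.toAdd m)
      map_id := fun _ => M.sEnd_zero X
      map_comp := fun m m' => M.sEnd_add X (Multiplicative.toAdd m') (Multiplicative.toAdd m) }

end

/-- The simplicial set at level `n` of `K(C; M)`: the diagonal of the `(n + 1)`-simplicial set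
`N S^{(n)}(C; M) = ∐_{X ∈ Ob S^{(n)} C} B (S^{(n)} M (X, X))`. -/
def kLevel (n : ℕ) : SSet.{max u v w} where
  obj k := Σ X : SCat C (fun _ : Fin n => k.unop), (classifying (M.sBimod X X)).obj k
  map {_ l} f := TypeCat.ofHom fun x => ⟨(SCat.restrict (fun _ => f.unop)).obj x.1,
    (classifyingMap (M.sRestrict (fun _ => f.unop) x.1 x.1)).app l
      ((classifying _).map f x.2)⟩
  map_id _ := rfl
  map_comp _ _ := rfl

/-- The level `n` of the map `K(C; M) → K(C ⋉ M)`. -/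
def psi (n : ℕ) : M.kLevel n ⟶ _root_.kLevel (SplitExt M) n where
  app _ := TypeCat.ofHom fun x => x.2 ⋙ M.psiFunctor x.1
  naturality _ _ _ := rfl

lemma psi_injective (n : ℕ) (k : SimplexCategoryᵒᵖ) :
    Function.Injective ((M.psi n).app k) := by
  rintro ⟨X, F⟩ ⟨Y, G⟩ h
  change F ⋙ M.psiFunctor X = G ⋙ M.psiFunctor Y at h
  have hX : X = Y := by
    have h₁ : M.sSection X = M.sSection Y :=
      congrArg (fun H : ComposableArrows (Core (SCat (SplitExt M) _)) _ => (H.obj 0).of) h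
    have h₂ : X.obj ⋙ SplitExt.zeroSection M = Y.obj ⋙ SplitExt.zeroSection M :=
      congrArg (fun Z => Z.obj) h₁
    refine ObjectProperty.FullSubcategory.ext ?_
    exact congrArg (fun Z => Z ⋙ SplitExt.proj M) h₂
  subst hX
  have hF : F = G := by
    refine CategoryTheory.Functor.ext (fun _ => rfl) (fun a b f => ?_)
    have h₁ := CategoryTheory.Functor.congr_hom h f
    simp only [eqToHom_refl, Category.id_comp, Category.comp_id] at h₁ ⊢
    have h₂ : ∀ θ, (Multiplicative.toAdd (F.map f)).1 θ = (Multiplicative.toAdd (G.map f)).1 θ :=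
      fun θ => congrArg (fun u => Prod.snd (u.iso.hom.hom.app θ)) h₁
    exact Subtype.ext (funext h₂)
  subst hF
  rfl

/-- The suspension maps of `K(C; M)`. -/
def kSusp (n : ℕ) (k : SimplexCategoryᵒᵖ) (t : k.unop ⟶ SimplexCategory.mk 1)
    (x : (M.kLevel n).obj k) : (M.kLevel (n + 1)).obj k :=
  ⟨(SCat.susp t).obj x.1, (classifyingMap (M.sSusp t x.1 x.1)).app k x.2⟩

/-- The action of the symmetric group on `K(C; M)`. -/
def kAct (n : ℕ) (σ : Equiv.Perm (Fin n)) : M.kLevel n ⟶ M.kLevel n where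
  app k := TypeCat.ofHom fun x => ⟨(SCat.permute k.unop σ).obj x.1,
    (classifyingMap (M.sPermute k.unop σ x.1 x.1)).app k x.2⟩
  naturality _ _ _ := rfl

lemma section_extObj (b : Bool) (A : C) :
    (SplitExt.zeroSection M).obj (extObj b A) = extObj b ((SplitExt.zeroSection M).obj A) := by
  cases b <;> rfl

lemma section_extMap (b b' : Bool) {A B : C} (f : A ⟶ B) :
    (SplitExt.zeroSection M).map (extMap b b' f) = eqToHom (M.section_extObj b A) ≫
      extMap b b' ((SplitExt.zeroSection M).map f) ≫ eqToHom (M.section_extObj b' B).symm := by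
  cases b <;> cases b' <;> exact (Category.comp_id _).symm.trans (Category.id_comp _).symm

lemma section_extElt (b : Bool) {A : C} (m : M.Elt A A) :
    ((𝟙 (extObj b A), M.extElt b m) :
      (SplitExt.zeroSection M).obj (extObj b A) ⟶ (SplitExt.zeroSection M).obj (extObj b A)) =
    eqToHom (M.section_extObj b A) ≫
      extMap b b ((𝟙 A, m) : (SplitExt.zeroSection M).obj A ⟶ (SplitExt.zeroSection M).obj A) ≫
      eqToHom (M.section_extObj b A).symm := by
  cases b
  · exact isZero_zeroObj.eq_of_src (C := SplitExt M) _ _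
  · have e : ∀ {X : SplitExt M} (f : X ⟶ X), f = 𝟙 X ≫ f ≫ 𝟙 X := fun f => by simp
    exact e (X := ⟨A⟩) (𝟙 A, m)

lemma psi_susp (n : ℕ) (k : SimplexCategoryᵒᵖ) (t : k.unop ⟶ SimplexCategory.mk 1)
    (x : (M.kLevel n).obj k) :
    (M.psi (n + 1)).app k (M.kSusp n k t x) =
      (kTheory (SplitExt M)).susp n k t ((M.psi n).app k x) :=
  SCat.functor_ext (fun _ _ => M.section_extObj _ _) (fun _ _ _ _ => M.section_extMap _ _ _)
    (fun _ _ f _ => M.section_extElt _ ((Multiplicative.toAdd (x.2.map f)).1 _))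

/-- The base points of `K(C; M)`. -/
def kBase (n : ℕ) (k : SimplexCategoryᵒᵖ) : (M.kLevel n).obj k :=
  ⟨SCat.zero C _, (Functor.const _).obj (SingleObj.star _)⟩

lemma psi_base (n : ℕ) (k : SimplexCategoryᵒᵖ) :
    (M.psi n).app k (M.kBase n k) = (kTheory (SplitExt M)).base n k :=
  SCat.functor_ext_zero (fun _ _ => rfl) (fun _ _ => rfl)

/-- The symmetric spectrum `K(C; M)`. -/
def kTheory : SymmetricSpectrum.{max u v w} where
  level := M.kLevel
  base := M.kBase
  base_map _ _ _ _ := rfl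
  act := M.kAct
  act_one _ := rfl
  act_mul _ _ _ := rfl
  act_base _ _ _ := rfl
  susp := M.kSusp
  susp_map n k l f t x := rfl
  susp_base n k t := M.psi_injective _ _ (by
    rw [psi_susp, psi_base, psi_base]
    exact (_root_.kTheory (SplitExt M)).susp_base n k t)
  susp_const n k t x h := M.psi_injective _ _ (by
    rw [psi_susp, psi_base]
    exact (_root_.kTheory (SplitExt M)).susp_const n k t _ h)
  susp_act n k t x σ σ' h h' := M.psi_injective _ _ (by
    rw [psi_susp]
    exact ((_root_.kTheory (SplitExt M)).susp_act n k t ((M.psi n).app k x) σ σ' h h').trans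
      (congrArg (((_root_.kTheory (SplitExt M)).act (n + 1) σ').app k) (M.psi_susp n k t x).symm))
  susp_swap n k s t x := M.psi_injective _ _ (by
    rw [psi_susp, psi_susp]
    refine ((_root_.kTheory (SplitExt M)).susp_swap n k s t _).trans ?_
    rw [← psi_susp, ← psi_susp]
    rfl)

/-- The map of symmetric spectra `K(C; M) → K(C ⋉ M)` induced by `Ψ`. -/
def psiMap : SymmetricSpectrum.Map M.kTheory (_root_.kTheory (SplitExt M)) where
  app := M.psi
  app_base := M.psi_base
  app_act _ _ := rfl
  app_susp := M.psi_susp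

end Bimodule

/-!
Why `psi` is an equivalence in positive levels.

**Objects of the `S`-construction of `C ⋉ M`.** A diagram in `C ⋉ M` over a diagram `X` in `C`
consists of elements `z(f)` of `M(X_ρ, X_θ)` for the maps `f : ρ ⟶ θ` of the cube, and
functoriality says that `z` is a derivation. Exactness of `M` makes all these derivations inner,
`z(f) = f^* c_θ - f_* c_ρ`: on the row of the pairs `0 ≤ j` of one direction the `c_θ` are found one
after the other because restriction along an inflation is surjective, exactness extends them to all
pairs, and a Künneth type argument (`TrianglePoset.IsAcyclic.prod`) reduces the cube to the single
directions. So every object is a conjugate of a zero section by the automorphisms `(id, c_θ)`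
(`Bimodule.exists_eq_pull_sub_push`, `Bimodule.conj_surjective`), and two families `c`, `c'` give
the same object if and only if `c - c'` lies in `S^{(n)} M(X, X)` (`Bimodule.conj_eq_iff`). In other
words, conjugation is a surjection of simplicial sets from the pairs `(X, c)` to the objects, and
its Čech complex consists of the tuples of families with natural differences.

**The nerve direction.** If `n ≥ 1`, a chain of isomorphisms `F_0 ⟶ ⋯ ⟶ F_k` of diagrams over
`k`-simplices can be mixed: the diagram with the value `F_{a(θ)}(θ)` at `θ`, where `a(θ)` is the
source of the component of `θ` in a fixed direction, is again in the `S`-construction, and the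
mixture depends on the chain in a simplicial way. This gives a simplicial homotopy equivalence
between the nerve of the isomorphisms and the set of objects (`isEquivalence_mixObjects`), and the
same substitution identifies the chains in the groups `S^{(n)} M(X, X)`, up to a simplicial
homotopy equivalence, with the above Čech complex (`Bimodule.isEquivalence_toTuples`). Under these
equivalences `psi` becomes the augmentation of the Čech complex (`Bimodule.psi_comp_mixObjects`).

**Čech complexes of surjections.** The augmentation of the Čech complex of a surjection
`π : U ⟶ V` is an equivalence (`isEquivalence_cechBase`). This holds for `U ⊔ V ⟶ V`, which has a
section, and the inclusion of the Čech complex of `U` into that of `U ⊔ V` is anodyne: this can be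
checked over the simplices of `V`, relatively to their boundaries
(`anodyneExtensions_of_relBoundary`), where a point of `U` over the simplex provides a deformation.

**Realization.** Anodyne extensions and simplicial homotopies realize to homotopy equivalences and
homotopies. By adjunction this amounts to filling horns in the singular complexes of spaces, and
in those of path spaces relatively to the end points. Both fillings come from pushing a point of
the simplex towards a vertex until it reaches one of the faces that contain the vertex.
-/

/-! ### Faces and horns of the topological simplex -/

section HornFilling

open Simplicial

/-- Continuous maps on the members of a finite closed cover that agree on overlaps glue. -/
lemma exists_continuousMap_of_closedCover {X T α : Type*} [TopologicalSpace X]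
    [TopologicalSpace T] [Finite α] (S : α → Set X) (hS : ∀ a, IsClosed (S a))
    (hcov : ∀ x, ∃ a, x ∈ S a) (f : α → C(X, T))
    (hf : ∀ a b x, x ∈ S a → x ∈ S b → f a x = f b x) :
    ∃ g : C(X, T), ∀ a, ∀ x ∈ S a, g x = f a x := by
  choose ix hix using hcov
  have key : ∀ a, ∀ x ∈ S a, f (ix x) x = f a x := fun a x hx => hf _ _ _ (hix x) hx
  refine ⟨⟨fun x => f (ix x) x, ?_⟩, key⟩
  refine (locallyFinite_of_finite S).continuous
    (Set.eq_univ_of_forall fun x => Set.mem_iUnion.2 ⟨_, hix x⟩) hS (fun a => ?_)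
  exact (f a).continuous.continuousOn.congr (key a)

namespace stdSimplex

variable {n : ℕ}

/-- The projection of the simplex onto its `j`-th face induced by a left inverse of the `j`-th
coface map. -/
noncomputable def toFace (j : Fin (n + 2)) :
    C(stdSimplex ℝ (Fin (n + 2)), stdSimplex ℝ (Fin (n + 1))) :=
  ⟨stdSimplex.map (Function.invFun j.succAbove), stdSimplex.continuous_map _⟩

/-- The inclusion of the `j`-th face. -/
noncomputable def face (j : Fin (n + 2)) :
    C(stdSimplex ℝ (Fin (n + 1)), stdSimplex ℝ (Fin (n + 2))) :=
  ⟨stdSimplex.map j.succAbove, stdSimplex.continuous_map _⟩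

lemma toFace_face (j : Fin (n + 2)) (y : stdSimplex ℝ (Fin (n + 1))) :
    toFace j (face j y) = y := by
  change stdSimplex.map _ (stdSimplex.map _ y) = y
  rw [stdSimplex.map_comp_apply, Function.invFun_comp Fin.succAbove_right_injective,
    stdSimplex.map_id_apply]

lemma face_injective (j : Fin (n + 2)) : Function.Injective (face (n := n) j) :=
  Function.LeftInverse.injective (toFace_face j)

lemma map_apply_of_injective {α β : Type*} [Fintype α] [Fintype β] {f : α → β}
    (hf : Function.Injective f) (y : stdSimplex ℝ α) (a : α) : stdSimplex.map f y (f a) = y a := by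
  classical
  change FunOnFinite.linearMap ℝ ℝ f y (f a) = _
  rw [FunOnFinite.linearMap_apply_apply]
  rw [Finset.sum_eq_single a]
  · intro b hb hba
    exact absurd (hf (Finset.mem_filter.1 hb).2) hba
  · intro h
    simp at h

lemma map_apply_of_notMem_range {α β : Type*} [Fintype α] [Fintype β] {f : α → β}
    (y : stdSimplex ℝ α) (b : β) (hb : ∀ a, f a ≠ b) : stdSimplex.map f y b = 0 := by
  classical
  change FunOnFinite.linearMap ℝ ℝ f y b = _
  rw [FunOnFinite.linearMap_apply_apply]
  exact Finset.sum_eq_zero fun a ha => absurd (Finset.mem_filter.1 ha).2 (hb a)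

lemma face_apply_self (j : Fin (n + 2)) (y : stdSimplex ℝ (Fin (n + 1))) : face j y j = 0 :=
  map_apply_of_notMem_range y j fun a => Fin.succAbove_ne j a

lemma face_apply_succAbove (j : Fin (n + 2)) (y : stdSimplex ℝ (Fin (n + 1))) (a : Fin (n + 1)) :
    face j y (j.succAbove a) = y a :=
  map_apply_of_injective Fin.succAbove_right_injective y a

lemma exists_face_eq {j : Fin (n + 2)} {x : stdSimplex ℝ (Fin (n + 2))} (hx : x j = 0) :
    ∃ y, face j y = x := by
  refine ⟨⟨fun a => x (j.succAbove a), fun a => stdSimplex.zero_le x _, ?_⟩, ?_⟩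
  · have h := stdSimplex.sum_eq_one x
    rw [Fin.sum_univ_succAbove _ j, hx, zero_add] at h
    exact h
  · apply stdSimplex.ext
    funext b
    rcases Fin.eq_self_or_eq_succAbove j b with rfl | ⟨a, rfl⟩
    · rw [face_apply_self, hx]
    · rw [face_apply_succAbove]
      rfl

lemma face_toFace {j : Fin (n + 2)} {x : stdSimplex ℝ (Fin (n + 2))} (hx : x j = 0) :
    face j (toFace j x) = x := by
  obtain ⟨y, rfl⟩ := exists_face_eq hx
  rw [toFace_face]

/-- The smallest barycentric coordinate other than the `i`-th one.  It vanishes exactly on the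
horn `Λ[n + 1, i]`. -/
noncomputable def hornHeight (i : Fin (n + 2)) (x : stdSimplex ℝ (Fin (n + 2))) : ℝ :=
  Finset.univ.inf' Finset.univ_nonempty fun a : Fin (n + 1) => x (i.succAbove a)

lemma continuous_apply (j : Fin (n + 2)) :
    Continuous fun x : stdSimplex ℝ (Fin (n + 2)) => x j :=
  (_root_.continuous_apply j).comp continuous_subtype_val

lemma continuous_hornHeight (i : Fin (n + 2)) : Continuous (hornHeight i) :=
  Continuous.finset_inf'_apply _ fun _ _ => continuous_apply _

lemma hornHeight_le (i : Fin (n + 2)) (x : stdSimplex ℝ (Fin (n + 2))) (a : Fin (n + 1)) :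
    hornHeight i x ≤ x (i.succAbove a) :=
  Finset.inf'_le _ (Finset.mem_univ a)

lemma hornHeight_nonneg (i : Fin (n + 2)) (x : stdSimplex ℝ (Fin (n + 2))) :
    0 ≤ hornHeight i x :=
  Finset.le_inf' _ _ fun _ _ => stdSimplex.zero_le x _

lemma exists_hornHeight_eq (i : Fin (n + 2)) (x : stdSimplex ℝ (Fin (n + 2))) :
    ∃ a, x (i.succAbove a) = hornHeight i x := by
  obtain ⟨a, -, ha⟩ := Finset.exists_mem_eq_inf' Finset.univ_nonempty
    fun a : Fin (n + 1) => x (i.succAbove a)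
  exact ⟨a, ha.symm⟩

lemma hornHeight_eq_zero {i j : Fin (n + 2)} (hj : j ≠ i) {x : stdSimplex ℝ (Fin (n + 2))}
    (hx : x j = 0) : hornHeight i x = 0 := by
  obtain ⟨a, rfl⟩ := Fin.exists_succAbove_eq hj
  exact le_antisymm ((hornHeight_le i x a).trans hx.le) (hornHeight_nonneg i x)

/-- The point of the simplex reached from `x` by moving, at constant speed and for the time `d`,
towards the `i`-th vertex along the direction orthogonal to the opposite face. -/
noncomputable def push (i : Fin (n + 2)) (x : stdSimplex ℝ (Fin (n + 2))) (d : ℝ) (hd : 0 ≤ d)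
    (hd' : d ≤ hornHeight i x) : stdSimplex ℝ (Fin (n + 2)) :=
  ⟨i.insertNth (x i + (n + 1) * d) fun a => x (i.succAbove a) - d, by
    constructor
    · intro b
      rcases Fin.eq_self_or_eq_succAbove i b with rfl | ⟨a, rfl⟩
      · rw [Fin.insertNth_apply_same]
        have := stdSimplex.zero_le x b
        positivity
      · rw [Fin.insertNth_apply_succAbove]
        exact sub_nonneg.2 (hd'.trans (hornHeight_le i x a))
    · rw [Fin.sum_univ_succAbove _ i]
      have h := stdSimplex.sum_eq_one x
      rw [Fin.sum_univ_succAbove _ i] at h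
      simp only [Fin.insertNth_apply_same, Fin.insertNth_apply_succAbove, Finset.sum_sub_distrib,
        Finset.sum_const, Finset.card_univ, Fintype.card_fin, nsmul_eq_mul, Nat.cast_add,
        Nat.cast_one]
      linarith⟩

lemma push_apply_succAbove (i : Fin (n + 2)) (x : stdSimplex ℝ (Fin (n + 2))) (d : ℝ) (hd : 0 ≤ d)
    (hd' : d ≤ hornHeight i x) (a : Fin (n + 1)) :
    push i x d hd hd' (i.succAbove a) = x (i.succAbove a) - d := by
  change Fin.insertNth (α := fun _ => ℝ) i (x i + (n + 1) * d) (fun a => x (i.succAbove a) - d)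
    (i.succAbove a) = _
  rw [Fin.insertNth_apply_succAbove]

lemma push_zero (i : Fin (n + 2)) (x : stdSimplex ℝ (Fin (n + 2))) (d : ℝ) (hd : 0 ≤ d)
    (hd' : d ≤ hornHeight i x) (h : d = 0) : push i x d hd hd' = x := by
  subst h
  apply stdSimplex.ext
  funext b
  rcases Fin.eq_self_or_eq_succAbove i b with rfl | ⟨a, rfl⟩
  · change Fin.insertNth (α := fun _ => ℝ) b (x b + (n + 1) * 0) (fun a => x (b.succAbove a) - 0)
      b = _
    rw [Fin.insertNth_apply_same, mul_zero, add_zero]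
  · rw [push_apply_succAbove, sub_zero]

/-- The motion `push` along a family of points and times. -/
noncomputable def pushMap {X : Type*} [TopologicalSpace X] (i : Fin (n + 2))
    (x : C(X, stdSimplex ℝ (Fin (n + 2)))) (d : C(X, ℝ)) (h : ∀ t, 0 ≤ d t)
    (h' : ∀ t, d t ≤ hornHeight i (x t)) : C(X, stdSimplex ℝ (Fin (n + 2))) where
  toFun t := push i (x t) (d t) (h t) (h' t)
  continuous_toFun := by
    refine Continuous.subtype_mk (continuous_pi fun b => ?_) _
    rcases Fin.eq_self_or_eq_succAbove i b with rfl | ⟨a, rfl⟩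
    · simp only [Fin.insertNth_apply_same]
      exact ((continuous_apply b).comp x.continuous).add (continuous_const.mul d.continuous)
    · simp only [Fin.insertNth_apply_succAbove]
      exact ((continuous_apply _).comp x.continuous).sub d.continuous

section

variable {X : Type*} [TopologicalSpace X] (i : Fin (n + 2))
  (x : C(X, stdSimplex ℝ (Fin (n + 2)))) (d : C(X, ℝ)) (h : ∀ t, 0 ≤ d t)
  (h' : ∀ t, d t ≤ hornHeight i (x t))

lemma pushMap_eq_self {t : X} (ht : d t = 0) : pushMap i x d h h' t = x t :=
  push_zero i (x t) (d t) (h t) (h' t) ht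

lemma exists_pushMap_eq_zero {t : X} (ht : d t = hornHeight i (x t)) :
    ∃ j : {j // j ≠ i}, pushMap i x d h h' t j = 0 := by
  obtain ⟨a, ha⟩ := exists_hornHeight_eq i (x t)
  exact ⟨⟨i.succAbove a, Fin.succAbove_ne i a⟩,
    (push_apply_succAbove i (x t) (d t) (h t) (h' t) a).trans (by rw [ha, ht, sub_self])⟩

end

end stdSimplex

end HornFilling

/-! ### Extension of maps from horns -/

section Fibrations

open Simplicial HomotopicalAlgebra

namespace stdSimplex

variable {n : ℕ}

/-- A compatible family of maps on the faces other than the `i`-th one agrees on intersections. -/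
def FaceCompatible {T : Type*} [TopologicalSpace T] (i : Fin (n + 2))
    (F : ∀ j : Fin (n + 2), j ≠ i → C(stdSimplex ℝ (Fin (n + 1)), T)) : Prop :=
  ∀ (j k : Fin (n + 2)) (hj : j ≠ i) (hk : k ≠ i) (y z : stdSimplex ℝ (Fin (n + 1))),
    face j y = face k z → F j hj y = F k hk z

/-- Maps on a horn extend to the simplex: the horn is a retract, by pushing points towards the
`i`-th vertex until another coordinate vanishes. -/
lemma exists_extension_of_horn {T : Type*} [TopologicalSpace T] (i : Fin (n + 2))
    (F : ∀ j : Fin (n + 2), j ≠ i → C(stdSimplex ℝ (Fin (n + 1)), T))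
    (hF : FaceCompatible i F) :
    ∃ g : C(stdSimplex ℝ (Fin (n + 2)), T), ∀ j hj, g.comp (face j) = F j hj := by
  let r : C(stdSimplex ℝ (Fin (n + 2)), stdSimplex ℝ (Fin (n + 2))) :=
    pushMap i (.id _) ⟨hornHeight i, continuous_hornHeight i⟩ (hornHeight_nonneg i)
      fun _ => le_rfl
  obtain ⟨g, hg⟩ := exists_continuousMap_of_closedCover
    (fun j : {j // j ≠ i} => {x | r x j = 0})
    (fun j => isClosed_eq ((continuous_apply _).comp r.continuous) continuous_const)
    (fun x => exists_pushMap_eq_zero i _ _ _ _ rfl)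
    (fun j => (F j j.2).comp ((toFace j).comp r))
    (fun j k x hj hk => hF j k j.2 k.2 (toFace j (r x)) (toFace k (r x))
      ((face_toFace hj).trans (face_toFace hk).symm))
  refine ⟨g, fun j hj => ContinuousMap.ext fun y => ?_⟩
  have hr : r (face j y) = face j y :=
    pushMap_eq_self i _ _ _ _ (hornHeight_eq_zero hj (face_apply_self j y))
  refine (hg ⟨j, hj⟩ (face j y) ?_).trans ?_
  · change r (face j y) j = 0
    rw [hr, face_apply_self]
  · change F j hj (toFace j (r (face j y))) = _
    rw [hr, toFace_face]

/-- Extension of maps from `Λ[n + 1, i] × [0, 1] ∪ Δ[n + 1] × {0, 1}` to `Δ[n + 1] × [0, 1]`.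
In terms of the height `m` over the horn and of `a = |2 s - 1|`, the retraction takes `a` to
`min 1 (a (1 + m))` and `m` to `max 0 (a (1 + m) - 1)`. -/
lemma exists_path_extension_of_horn {T : Type*} [TopologicalSpace T] (i : Fin (n + 2))
    (F : ∀ j : Fin (n + 2), j ≠ i → C(stdSimplex ℝ (Fin (n + 1)), C(unitInterval, T)))
    (hF : FaceCompatible i F) (b₀ b₁ : C(stdSimplex ℝ (Fin (n + 2)), T))
    (h₀ : ∀ j hj y, F j hj y 0 = b₀ (face j y)) (h₁ : ∀ j hj y, F j hj y 1 = b₁ (face j y)) :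
    ∃ g : C(stdSimplex ℝ (Fin (n + 2)), C(unitInterval, T)),
      (∀ j hj, g.comp (face j) = F j hj) ∧ (∀ x, g x 0 = b₀ x) ∧ (∀ x, g x 1 = b₁ x) := by
  let X := stdSimplex ℝ (Fin (n + 2)) × unitInterval
  let m : X → ℝ := fun t => hornHeight i t.1
  have hm : Continuous m := (continuous_hornHeight i).comp continuous_fst
  have hm0 : ∀ t, 0 ≤ m t := fun t => hornHeight_nonneg i t.1
  let σ : X → ℝ := fun t => 2 * (t.2 : ℝ) - 1
  have hσ : Continuous σ :=
    (continuous_const.mul (continuous_subtype_val.comp continuous_snd)).sub continuous_const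
  have hσ1 : ∀ t, |σ t| ≤ 1 := fun t => by
    have := t.2.2.1
    have := t.2.2.2
    rw [abs_le]
    constructor <;> simp only [σ] <;> linarith
  let m' : X → ℝ := fun t => max 0 (|σ t| * (1 + m t) - 1)
  have hm' : Continuous m' :=
    continuous_const.max ((hσ.abs.mul (continuous_const.add hm)).sub continuous_const)
  have hm'm : ∀ t, m' t ≤ m t := fun t => by
    refine max_le (hm0 t) ?_
    nlinarith [hσ1 t, hm0 t]
  have hm'0 : ∀ t, 0 ≤ m' t := fun t => le_max_left _ _
  let r : C(X, stdSimplex ℝ (Fin (n + 2))) :=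
    pushMap i ⟨Prod.fst, continuous_fst⟩ ⟨fun t => m t - m' t, hm.sub hm'⟩
      (fun t => sub_nonneg.2 (hm'm t)) (fun t => sub_le_self _ (hm'0 t))
  let s : C(X, unitInterval) :=
    ⟨fun t => Set.projIcc 0 1 zero_le_one ((1 + σ t * (1 + m t)) / 2),
      continuous_projIcc.comp
        ((continuous_const.add (hσ.mul (continuous_const.add hm))).div_const _)⟩
  let S : {j // j ≠ i} ⊕ Bool → Set X := fun a => match a with
    | .inl j => {t | r t j = 0}
    | .inr false => {t | s t = 0}
    | .inr true => {t | s t = 1}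
  let f : {j // j ≠ i} ⊕ Bool → C(X, T) := fun a => match a with
    | .inl j => ContinuousMap.comp ⟨fun p : C(unitInterval, T) × unitInterval => p.1 p.2,
        ContinuousEval.continuous_eval⟩ (((F j j.2).comp ((toFace j).comp r)).prodMk s)
    | .inr false => b₀.comp r
    | .inr true => b₁.comp r
  have e₀ : ∀ j t, t ∈ S (.inl j) → t ∈ S (.inr false) → f (.inl j) t = f (.inr false) t := by
    intro j t hj hs
    change F j j.2 (toFace j (r t)) (s t) = b₀ (r t)
    rw [show s t = 0 from hs, h₀, face_toFace hj]
  have e₁ : ∀ j t, t ∈ S (.inl j) → t ∈ S (.inr true) → f (.inl j) t = f (.inr true) t := by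
    intro j t hj hs
    change F j j.2 (toFace j (r t)) (s t) = b₁ (r t)
    rw [show s t = 1 from hs, h₁, face_toFace hj]
  obtain ⟨g, hg⟩ := exists_continuousMap_of_closedCover S
    (by
      rintro (j | _ | _)
      · exact isClosed_eq ((continuous_apply _).comp r.continuous) continuous_const
      · exact isClosed_eq s.continuous continuous_const
      · exact isClosed_eq s.continuous continuous_const)
    (by
      intro t
      by_cases h : |σ t| * (1 + m t) < 1
      · have : m' t = 0 := max_eq_left (by linarith)
        obtain ⟨j, hj⟩ := exists_pushMap_eq_zero i ⟨Prod.fst, continuous_fst⟩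
          ⟨fun t => m t - m' t, hm.sub hm'⟩ (fun t => sub_nonneg.2 (hm'm t))
          (fun t => sub_le_self _ (hm'0 t)) (t := t) (by
            change m t - m' t = m t
            rw [this, sub_zero])
        exact ⟨.inl j, hj⟩
      · push Not at h
        rcases le_total 0 (σ t) with h' | h'
        · rw [abs_of_nonneg h'] at h
          exact ⟨.inr true, Set.projIcc_of_right_le zero_le_one (by linarith)⟩
        · rw [abs_of_nonpos h'] at h
          exact ⟨.inr false, Set.projIcc_of_le_left zero_le_one (by linarith)⟩)
    f
    (by
      rintro (j | _ | _) (k | _ | _) t hj hk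
      · change F j j.2 (toFace j (r t)) (s t) = F k k.2 (toFace k (r t)) (s t)
        rw [hF j k j.2 k.2 _ _ ((face_toFace hj).trans (face_toFace hk).symm)]
      · exact e₀ j t hj hk
      · exact e₁ j t hj hk
      · exact (e₀ k t hk hj).symm
      · rfl
      · exact absurd ((show s t = 0 from hj).symm.trans hk) zero_ne_one
      · exact (e₁ k t hk hj).symm
      · exact absurd ((show s t = 0 from hk).symm.trans hj) zero_ne_one
      · rfl)
  have hend : ∀ t, |σ t| = 1 → r t = t.1 := fun t ht => by
    refine pushMap_eq_self i _ _ _ _ ?_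
    have : m' t = m t := by
      simp only [m', ht, one_mul, add_sub_cancel_left]
      exact max_eq_right (hm0 t)
    change m t - m' t = 0
    rw [this, sub_self]
  refine ⟨g.curry, fun j hj => ContinuousMap.ext fun y => ContinuousMap.ext fun u => ?_,
    fun x => ?_, fun x => ?_⟩
  · let t : X := (face j y, u)
    have hmt : m t = 0 := hornHeight_eq_zero hj (face_apply_self j y)
    have hr : r t = face j y := pushMap_eq_self i _ _ _ _ (by
      change m t - m' t = 0
      have h1 := hm'm t
      have h2 := hm'0 t
      linarith)
    have hs : s t = u := by
      change Set.projIcc 0 1 zero_le_one ((1 + σ t * (1 + m t)) / 2) = u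
      rw [hmt]
      have : (1 + σ t * (1 + 0)) / 2 = (u : ℝ) := by
        simp only [σ, t]
        ring
      rw [this, Set.projIcc_val]
    refine (hg (.inl ⟨j, hj⟩) t ?_).trans ?_
    · change r t j = 0
      rw [hr, face_apply_self]
    · change F j hj (toFace j (r t)) (s t) = _
      rw [hr, toFace_face, hs]
  · have hσt : σ (x, 0) = -1 := by simp [σ]
    refine (hg (.inr false) (x, 0) ?_).trans (congrArg b₀ (hend _ (by rw [hσt]; simp)))
    refine Set.projIcc_of_le_left zero_le_one ?_
    rw [hσt]
    have := hm0 (x, 0)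
    linarith
  · have hσt : σ (x, 1) = 1 := by simp [σ]; norm_num
    refine (hg (.inr true) (x, 1) ?_).trans (congrArg b₁ (hend _ (by rw [hσt]; simp)))
    refine Set.projIcc_of_right_le zero_le_one ?_
    rw [hσt]
    have := hm0 (x, 1)
    linarith

end stdSimplex

end Fibrations

/-! ### Singular complexes and anodyne extensions -/

section Realization

open Simplicial HomotopicalAlgebra SSet SSet.modelCategoryQuillen MonoidalCategory

lemma fibrations_of_exists_lift {E B : SSet.{u}} (p : E ⟶ B)
    (h : ∀ (n : ℕ) (i : Fin (n + 2)) (f : ∀ j : Fin (n + 2), j ≠ i → (Δ[n] ⟶ E))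
      (_ : horn.IsCompatible f) (b : Δ[n + 1] ⟶ B)
      (_ : ∀ j hj, f j hj ≫ p = stdSimplex.δ j ≫ b),
      ∃ φ : Δ[n + 1] ⟶ E, (∀ j hj, stdSimplex.δ j ≫ φ = f j hj) ∧ φ ≫ p = b) :
    fibrations SSet p := by
  rw [fibrations_eq]
  intro _ _ _ hf
  simp only [J, MorphismProperty.iSup_iff] at hf
  obtain ⟨n, ⟨i⟩⟩ := hf
  refine ⟨fun {t b} sq => ?_⟩
  obtain ⟨φ, hφ, hφ'⟩ := h n i _ (horn.IsCompatible.of_hom t) b (fun j hj => by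
    rw [Category.assoc, sq.w, horn.ι_ι_assoc])
  exact ⟨⟨{ l := φ
            fac_left := horn.hom_ext' (by simpa using hφ)
            fac_right := hφ' }⟩⟩

/-- Simplices of the singular simplicial set as continuous maps on the standard simplex. -/
noncomputable def singularEquiv (n : ℕ) (T : TopCat.{u}) :
    (Δ[n] ⟶ TopCat.toSSet.obj T) ≃ C(stdSimplex ℝ (Fin (n + 1)), T) :=
  yonedaEquiv.trans (T.toSSetObjEquiv (op ⦋n⦌))

lemma singularEquiv_δ {n : ℕ} {T : TopCat.{u}} (j : Fin (n + 2))
    (φ : Δ[n + 1] ⟶ TopCat.toSSet.obj T) :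
    singularEquiv n T (stdSimplex.δ j ≫ φ) =
      (singularEquiv (n + 1) T φ).comp (_root_.stdSimplex.face j) := by
  have h : yonedaEquiv (stdSimplex.δ j ≫ φ) = (TopCat.toSSet.obj T).δ j (yonedaEquiv φ) := by
    exact (yonedaEquiv_naturality (SimplexCategory.δ j) φ).symm
  change T.toSSetObjEquiv _ (yonedaEquiv _) = _
  rw [h]
  rfl

lemma singularEquiv_comp {n : ℕ} {T T' : TopCat.{u}} (g : T ⟶ T')
    (φ : Δ[n] ⟶ TopCat.toSSet.obj T) :
    singularEquiv n T' (φ ≫ TopCat.toSSet.map g) = g.hom.comp (singularEquiv n T φ) := by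
  rfl

lemma faceCompatible_of_isCompatible {n : ℕ} {T : TopCat.{u}} {i : Fin (n + 2)}
    {f : ∀ j : Fin (n + 2), j ≠ i → (Δ[n] ⟶ TopCat.toSSet.obj T)} (hf : horn.IsCompatible f) :
    _root_.stdSimplex.FaceCompatible i fun j hj => singularEquiv n T (f j hj) := by
  have key : ∀ (j k : Fin (n + 2)) (hj : j ≠ i) (hk : k ≠ i), j < k → ∀ y z,
      _root_.stdSimplex.face j y = _root_.stdSimplex.face k z →
      singularEquiv n T (f j hj) y = singularEquiv n T (f k hk) z := by
    intro j k hj hk hjk y z h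
    obtain _ | n := n
    · exfalso
      lia
    · obtain ⟨j, rfl⟩ := j.eq_castSucc_of_ne_last (Fin.ne_last_of_lt hjk)
      obtain ⟨k, rfl⟩ := k.eq_succ_of_ne_zero (Fin.ne_zero_of_lt hjk)
      have hy : y k = 0 := by
        rw [← _root_.stdSimplex.face_apply_succAbove j.castSucc y k,
          Fin.succAbove_of_lt_succ _ _ hjk, h, _root_.stdSimplex.face_apply_self]
      obtain ⟨x, rfl⟩ := _root_.stdSimplex.exists_face_eq hy
      have hz : z = _root_.stdSimplex.face j x := by
        apply _root_.stdSimplex.face_injective k.succ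
        rw [← h]
        change _root_.stdSimplex.map _ (_root_.stdSimplex.map _ x) =
          _root_.stdSimplex.map _ (_root_.stdSimplex.map _ x)
        rw [_root_.stdSimplex.map_comp_apply, _root_.stdSimplex.map_comp_apply]
        have e := SimplexCategory.δ_comp_δ (Fin.castSucc_lt_succ_iff.1 hjk : j ≤ k)
        have e' := congrArg (fun q => (q.toOrderHom : _ → _)) e.symm
        exact congrArg (fun q => _root_.stdSimplex.map q x) e'
      have e := hf.δ_pred_comp j.castSucc k.succ hj hk hjk
      rw [Fin.pred_succ, Fin.castPred_castSucc] at e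
      have e' := congrArg (singularEquiv n T) e
      rw [singularEquiv_δ, singularEquiv_δ] at e'
      rw [hz]
      exact DFunLike.congr_fun e' x
  intro j k hj hk y z h
  rcases lt_trichotomy j k with hjk | rfl | hjk
  · exact key j k hj hk hjk y z h
  · rw [_root_.stdSimplex.face_injective j h]
  · exact (key k j hk hj hjk z y h.symm).symm

/-- The singular simplicial set of a space is a Kan complex. -/
lemma fibrations_toSSet_to_terminal (T : TopCat.{u}) {B : SSet.{u}} (hB : IsTerminal B)
    (p : TopCat.toSSet.obj T ⟶ B) : fibrations SSet p := by
  refine fibrations_of_exists_lift p fun n i f hf b _ => ?_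
  obtain ⟨g, hg⟩ := _root_.stdSimplex.exists_extension_of_horn i _
    (faceCompatible_of_isCompatible hf)
  refine ⟨(singularEquiv (n + 1) T).symm g, fun j hj => ?_, hB.hom_ext _ _⟩
  apply (singularEquiv n T).injective
  rw [singularEquiv_δ, Equiv.apply_symm_apply, hg]

/-- The space of paths in `T`. -/
abbrev pathSpace (T : TopCat.{u}) : TopCat.{u} := TopCat.of C(unitInterval, T)

/-- The evaluation of paths at the end points. -/
def pathEnds (T : TopCat.{u}) : pathSpace T ⟶ TopCat.of (T × T) :=
  TopCat.ofHom ⟨fun γ => (γ 0, γ 1), by fun_prop⟩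

/-- The evaluation of paths at both end points is a fibration on singular complexes. -/
lemma fibrations_toSSet_map_pathEnds (T : TopCat.{u}) :
    fibrations SSet (TopCat.toSSet.map (pathEnds T)) := by
  refine fibrations_of_exists_lift _ fun n i f hf b hb => ?_
  let b' := singularEquiv (n + 1) _ b
  have hb' : ∀ j hj y, ((singularEquiv n (pathSpace T) (f j hj) y) 0,
      (singularEquiv n (pathSpace T) (f j hj) y) 1) = b' (_root_.stdSimplex.face j y) := by
    intro j hj y
    have e := congrArg (singularEquiv n _) (hb j hj)
    rw [singularEquiv_comp, singularEquiv_δ] at e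
    exact DFunLike.congr_fun e y
  obtain ⟨g, hg, hg₀, hg₁⟩ := _root_.stdSimplex.exists_path_extension_of_horn i _
    (faceCompatible_of_isCompatible hf) (ContinuousMap.fst.comp b') (ContinuousMap.snd.comp b')
    (fun j hj y => congrArg Prod.fst (hb' j hj y)) (fun j hj y => congrArg Prod.snd (hb' j hj y))
  refine ⟨(singularEquiv (n + 1) (pathSpace T)).symm g, fun j hj => ?_, ?_⟩
  · apply (singularEquiv n (pathSpace T)).injective
    rw [singularEquiv_δ, Equiv.apply_symm_apply, hg]
  · apply (singularEquiv (n + 1) _).injective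
    rw [singularEquiv_comp, Equiv.apply_symm_apply]
    ext x
    · exact hg₀ x
    · exact hg₁ x

lemma hasLiftingProperty_toTop {A B : SSet.{u}} {i : A ⟶ B} (hi : anodyneExtensions i)
    {E T : TopCat.{u}} (p : E ⟶ T) (hp : fibrations SSet (TopCat.toSSet.map p)) :
    HasLiftingProperty (SSet.toTop.map i) p :=
  (sSetTopAdj.hasLiftingProperty_iff i p).2 (hi _ hp)

/-- Maps that agree along an anodyne extension are homotopic after realization. -/
lemma homotopic_of_anodyne {A B : SSet.{u}} {i : A ⟶ B} (hi : anodyneExtensions i)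
    {T : TopCat.{u}} (g g' : SSet.toTop.obj B ⟶ T)
    (h : SSet.toTop.map i ≫ g = SSet.toTop.map i ≫ g') :
    ContinuousMap.Homotopic g.hom g'.hom := by
  have := hasLiftingProperty_toTop hi (pathEnds T) (fibrations_toSSet_map_pathEnds T)
  let c : T ⟶ pathSpace T := TopCat.ofHom ContinuousMap.const'
  have sq : CommSq (SSet.toTop.map i ≫ g ≫ c) (SSet.toTop.map i) (pathEnds T)
      (TopCat.ofHom (g.hom.prodMk g'.hom)) := ⟨by
    ext x
    · rfl
    · exact congrArg (fun k => k.hom x) h⟩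
  have hl : ∀ x, ((sq.lift.hom x) 0, (sq.lift.hom x) 1) = (g.hom x, g'.hom x) := fun x =>
    congrArg (fun k => k.hom x) sq.fac_right
  exact ⟨{ toFun := fun t => (sq.lift.hom t.2) t.1
           continuous_toFun := by
             have : Continuous fun t : unitInterval × SSet.toTop.obj B =>
               (sq.lift.hom t.2, t.1) := by fun_prop
             exact ContinuousEval.continuous_eval.comp this
           map_zero_left := fun x => congrArg Prod.fst (hl x)
           map_one_left := fun x => congrArg Prod.snd (hl x) }⟩

end Realization

/-! ### Equivalences of simplicial sets -/

section Equivalences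

open Simplicial HomotopicalAlgebra SSet SSet.modelCategoryQuillen MonoidalCategory

lemma IsEquivalence.of_homotopic {X Y : SSet.{u}} (f : X ⟶ Y)
    (g : SSet.toTop.obj Y ⟶ SSet.toTop.obj X)
    (h : ContinuousMap.Homotopic (SSet.toTop.map f ≫ g).hom (𝟙 (SSet.toTop.obj X) : _ ⟶ _).hom)
    (h' : ContinuousMap.Homotopic (g ≫ SSet.toTop.map f).hom (𝟙 (SSet.toTop.obj Y) : _ ⟶ _).hom) :
    IsEquivalence f :=
  ⟨⟨(SSet.toTop.map f).hom, g.hom, h, h'⟩, rfl⟩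

lemma IsEquivalence.comp {X Y Z : SSet.{u}} {f : X ⟶ Y} {g : Y ⟶ Z} (hf : IsEquivalence f)
    (hg : IsEquivalence g) : IsEquivalence (f ≫ g) := by
  obtain ⟨e, he⟩ := hf
  obtain ⟨e', he'⟩ := hg
  refine ⟨e.trans e', ?_⟩
  rw [Functor.map_comp, TopCat.hom_comp, ← he, ← he']
  rfl

lemma IsEquivalence.of_comp_right {X Y Z : SSet.{u}} {f : X ⟶ Y} {g : Y ⟶ Z}
    (hfg : IsEquivalence (f ≫ g)) (hg : IsEquivalence g) : IsEquivalence f := by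
  obtain ⟨e, he⟩ := hfg
  obtain ⟨e', he'⟩ := hg
  have key : e.toFun = e'.toFun.comp (SSet.toTop.map f).hom := by
    rw [he, he', Functor.map_comp, TopCat.hom_comp]
  refine ⟨⟨(SSet.toTop.map f).hom, e.invFun.comp e'.toFun, ?_, ?_⟩, rfl⟩
  · have := e.left_inv
    rwa [key, ← ContinuousMap.comp_assoc] at this
  · have h₁ : ContinuousMap.Homotopic ((e'.invFun.comp e'.toFun).comp
        ((SSet.toTop.map f).hom.comp (e.invFun.comp e'.toFun)))
        ((SSet.toTop.map f).hom.comp (e.invFun.comp e'.toFun)) :=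
      (e'.left_inv.comp (.refl _)).trans (by rw [ContinuousMap.id_comp])
    have h₂ : (e'.invFun.comp e'.toFun).comp
        ((SSet.toTop.map f).hom.comp (e.invFun.comp e'.toFun)) =
        e'.invFun.comp ((e.toFun.comp e.invFun).comp e'.toFun) := by
      rw [key]
      rfl
    rw [h₂] at h₁
    refine h₁.symm.trans (.trans ?_ e'.left_inv)
    exact .comp (.refl _) ((e.right_inv.comp (.refl _)).trans (by rw [ContinuousMap.id_comp]))

lemma IsEquivalence.of_isIso {X Y : SSet.{u}} (f : X ⟶ Y) [IsIso f] : IsEquivalence f :=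
  .of_homotopic f (SSet.toTop.map (inv f))
    (by rw [← Functor.map_comp, IsIso.hom_inv_id, CategoryTheory.Functor.map_id])
    (by rw [← Functor.map_comp, IsIso.inv_hom_id, CategoryTheory.Functor.map_id])

/-- The lift of the identity along an anodyne extension is a homotopy inverse after realization. -/
lemma IsEquivalence.of_anodyne {X Y : SSet.{u}} {f : X ⟶ Y} (hf : anodyneExtensions f) :
    IsEquivalence f := by
  have := hasLiftingProperty_toTop hf (terminal.from (SSet.toTop.obj X))
    (fibrations_toSSet_to_terminal _ (IsTerminal.isTerminalObj TopCat.toSSet _ terminalIsTerminal)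
      _)
  have sq : CommSq (𝟙 _) (SSet.toTop.map f) (terminal.from (SSet.toTop.obj X))
    (terminal.from (SSet.toTop.obj Y)) := ⟨terminal.hom_ext _ _⟩
  refine .of_homotopic f sq.lift (by rw [sq.fac_left])
    (homotopic_of_anodyne hf _ _ ?_)
  rw [← Category.assoc, sq.fac_left, Category.id_comp, Category.comp_id]

lemma homotopic_map_comp {X Z Y : SSet.{u}} {c : Z ⟶ Z}
    (hc : ContinuousMap.Homotopic (SSet.toTop.map c).hom (𝟙 (SSet.toTop.obj Z) : _ ⟶ _).hom)
    (f : X ⟶ Z) (g : Z ⟶ Y) :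
    ContinuousMap.Homotopic (SSet.toTop.map (f ≫ c ≫ g)).hom (SSet.toTop.map (f ≫ g)).hom := by
  have h := ContinuousMap.Homotopic.comp (.refl (SSet.toTop.map g).hom)
    (hc.comp (.refl (SSet.toTop.map f).hom))
  rw [← TopCat.hom_comp, ← TopCat.hom_comp, ← TopCat.hom_comp, ← TopCat.hom_comp,
    Category.comp_id, ← Functor.map_comp, ← Functor.map_comp, ← Functor.map_comp,
    Category.assoc] at h
  exact h

/-- A simplicial homotopy `X ⊗ Δ[1] ⟶ Y`, as an operation on the simplices of `X` that depends
on a simplex of `Δ[1]`. -/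
structure HomotopyFamily (X Y : SSet.{u}) where
  /-- The value on a simplex of `X` and a simplex of `Δ[1]`. -/
  h : ∀ k : SimplexCategoryᵒᵖ, (k.unop ⟶ ⦋1⦌) → X.obj k → Y.obj k
  natural : ∀ {k l : SimplexCategoryᵒᵖ} (f : k ⟶ l) (t : k.unop ⟶ ⦋1⦌) (x : X.obj k),
    Y.map f (h k t x) = h l (f.unop ≫ t) (X.map f x)

namespace HomotopyFamily

variable {X Y : SSet.{u}} (H : HomotopyFamily X Y)

/-- The map `X ⊗ Δ[1] ⟶ Y`. -/
def hom : X ⊗ Δ[1] ⟶ Y where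
  app k := TypeCat.ofHom fun p => H.h k (stdSimplex.objEquiv p.2) p.1
  naturality k l f := by
    ext p
    exact (H.natural f (stdSimplex.objEquiv p.2) p.1).symm

/-- The constant maps to `[1]`. -/
abbrev vertex (k : SimplexCategory) (i : Fin 2) : k ⟶ ⦋1⦌ :=
  SimplexCategory.const k ⦋1⦌ i

lemma eq_vertex_of_mem_horn {k : SimplexCategoryᵒᵖ} (t : Δ[1].obj k)
    (ht : t ∈ (horn.{u} 1 0).obj k) : stdSimplex.objEquiv t = vertex k.unop 0 := by
  rw [mem_horn_iff] at ht
  ext a : 3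
  by_contra h
  refine ht (Set.eq_univ_of_forall fun b => ?_)
  have ha : (stdSimplex.objEquiv t).toOrderHom a = 1 := by
    have : ∀ c : Fin 2, c ≠ 0 → c = 1 := by decide
    exact this _ h
  have hb : b = 1 ∨ b = 0 := by
    revert b
    decide
  rcases hb with rfl | rfl
  · exact Or.inl ⟨a, ha⟩
  · exact Or.inr rfl

/-- The end points of a simplicial homotopy have homotopic realizations. -/
lemma homotopic {g₀ g₁ : X ⟶ Y} (h₀ : ∀ k x, H.h k (vertex k.unop 0) x = g₀.app k x)
    (h₁ : ∀ k x, H.h k (vertex k.unop 1) x = g₁.app k x) :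
    ContinuousMap.Homotopic (SSet.toTop.map g₀).hom (SSet.toTop.map g₁).hom := by
  have e₀ : ι₀ ≫ H.hom = g₀ := by
    ext k x
    exact h₀ k x
  have e₁ : ι₁ ≫ H.hom = g₁ := by
    ext k x
    exact h₁ k x
  have key : ContinuousMap.Homotopic
      (SSet.toTop.map (SemiCartesianMonoidalCategory.fst X Δ[1] ≫ ι₀)).hom
      (𝟙 (SSet.toTop.obj (X ⊗ Δ[1])) : _ ⟶ _).hom := by
    refine homotopic_of_anodyne ((anodyneExtensions.horn_ι (0 : Fin 2)).whiskerLeft X) _ _ ?_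
    rw [Category.comp_id, ← Functor.map_comp]
    congr 1
    ext k ⟨x, t⟩
    · rfl
    · apply stdSimplex.objEquiv.injective
      exact (eq_vertex_of_mem_horn t.1 t.2).symm
  have e : ι₀ ≫ H.hom = ι₁ ≫ (SemiCartesianMonoidalCategory.fst X Δ[1] ≫ ι₀) ≫ H.hom := by
    rw [Category.assoc, ι₁_fst_assoc]
  rw [← e₀, ← e₁, e]
  exact homotopic_map_comp key _ _

end HomotopyFamily

/-- Simplicial deformation retracts realize to homotopy equivalences. -/
lemma IsEquivalence.of_homotopyFamily {X Y : SSet.{u}} (f : X ⟶ Y) (g : Y ⟶ X)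
    (H : HomotopyFamily X X)
    (h₀ : ∀ k x, H.h k (HomotopyFamily.vertex k.unop 0) x = x)
    (h₁ : ∀ k x, H.h k (HomotopyFamily.vertex k.unop 1) x = g.app k (f.app k x))
    (hgf : ∀ k y, f.app k (g.app k y) = y) : IsEquivalence f ∧ IsEquivalence g := by
  have e : g ≫ f = 𝟙 Y := by
    ext k y
    exact hgf k y
  have h := (H.homotopic (g₀ := 𝟙 X) (g₁ := f ≫ g) h₀ h₁).symm
  rw [CategoryTheory.Functor.map_id, Functor.map_comp] at h
  have h' : ContinuousMap.Homotopic (SSet.toTop.map g ≫ SSet.toTop.map f).hom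
      (𝟙 (SSet.toTop.obj Y) : _ ⟶ _).hom := by
    rw [← Functor.map_comp, e, CategoryTheory.Functor.map_id]
  exact ⟨.of_homotopic f (SSet.toTop.map g) h h', .of_homotopic g (SSet.toTop.map f) h' h⟩

end Equivalences

/-! ### Anodyne extensions over a base -/

section LocalAnodyne

open Simplicial HomotopicalAlgebra SSet SSet.modelCategoryQuillen MonoidalCategory

/-- If a simplicial set deforms into a subcomplex, through maps that preserve the subcomplex, then
the inclusion of the subcomplex is anodyne: it is a retract of
`A ⊗ Δ[1] ∪ B ⊗ {0} ⟶ B ⊗ Δ[1]`. -/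
lemma anodyneExtensions_of_deformation {B : SSet.{u}} (A : B.Subcomplex) (H : HomotopyFamily B B)
    (h₀ : ∀ k x, H.h k (HomotopyFamily.vertex k.unop 0) x ∈ A.obj k)
    (h₁ : ∀ k x, H.h k (HomotopyFamily.vertex k.unop 1) x = x)
    (hA : ∀ k t x, x ∈ A.obj k → H.h k t x ∈ A.obj k) : anodyneExtensions A.ι := by
  let U := A.unionProd (horn.{u} 1 0)
  have hU : anodyneExtensions U.ι := anodyneExtensions_unionProd_ι _ _ (.horn_ι 0)
  have e₁ : ι₁ ≫ H.hom = 𝟙 B := by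
    ext k x
    exact h₁ k x
  let i : (A : SSet) ⟶ U := Subcomplex.lift (A.ι ≫ ι₁) (by
    rintro k _ ⟨x, rfl⟩
    exact Or.inr ⟨x.2, trivial⟩)
  let r : (U : SSet) ⟶ A := Subcomplex.lift (U.ι ≫ H.hom) (by
    rintro k _ ⟨⟨⟨x, t⟩, hx⟩, rfl⟩
    change H.h k (stdSimplex.objEquiv t) x ∈ A.obj k
    rcases hx with hx | hx
    · rw [HomotopyFamily.eq_vertex_of_mem_horn t hx.2]
      exact h₀ k x
    · exact hA k _ x hx.1)
  refine MorphismProperty.of_retract (P := anodyneExtensions) (f := A.ι) (g := U.ι)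
    { i := Arrow.homMk i ι₁ rfl
      r := Arrow.homMk r H.hom rfl
      retract := ?_ } hU
  ext1
  · rw [← cancel_mono A.ι]
    change A.ι ≫ ι₁ ≫ H.hom = A.ι
    rw [e₁, Category.comp_id]
  · exact e₁

variable {D V : SSet.{u}} (p : D ⟶ V)

/-- The pullback of `p : D ⟶ V` along a simplex of `V`. -/
def simplexPullback {k : SimplexCategoryᵒᵖ} (v : V.obj k) : SSet.{u} where
  obj l := {q : (l.unop ⟶ k.unop) × D.obj l // p.app l q.2 = V.map q.1.op v}
  map {l l'} g := TypeCat.ofHom fun q => ⟨(g.unop ≫ q.1.1, D.map g q.1.2), by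
    rw [NatTrans.naturality_apply, q.2, op_comp, Functor.map_comp]
    rfl⟩
  map_id l := by
    refine ConcreteCategory.hom_ext _ _ fun ⟨⟨f, x⟩, hq⟩ => ?_
    exact Subtype.ext <| Prod.ext (Category.id_comp f) (CategoryTheory.Functor.map_id_apply D l x)
  map_comp g g' := by
    refine ConcreteCategory.hom_ext _ _ fun ⟨⟨f, x⟩, hq⟩ => ?_
    exact Subtype.ext <| Prod.ext (Category.assoc g'.unop g.unop f)
      (CategoryTheory.Functor.map_comp_apply D g g' x)

/-- The part of the pullback along a simplex that lies in a given subcomplex or over the boundary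
of the simplex. -/
def relBoundary (A : D.Subcomplex) {k : SimplexCategoryᵒᵖ} (v : V.obj k) :
    (simplexPullback p v).Subcomplex where
  obj l := {q | q.1.2 ∈ A.obj l ∨ ¬ Function.Surjective q.1.1.toOrderHom}
  map g q hq := hq.imp (fun h => A.map g h) fun h h' => h fun b => by
    obtain ⟨a, ha⟩ := h' b
    exact ⟨g.unop.toOrderHom a, ha⟩

section Lifts

variable (A : D.Subcomplex) {E B : SSet.{u}} (q : E ⟶ B) (a : (A : SSet) ⟶ E) (b : D ⟶ B)

/-- A simplex `v` of `V`, with a lift to `E` of the restriction of `b` to the pullback of `D` along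
`v`, extending the restriction of `a`. -/
structure SimplexLift (k : SimplexCategoryᵒᵖ) where
  /-- The simplex of the base. -/
  base : V.obj k
  /-- The lift on the pullback of `D` along the simplex. -/
  lift : ∀ (l : SimplexCategoryᵒᵖ) (f : k ⟶ l) (x : D.obj l), p.app l x = V.map f base → E.obj l
  natural : ∀ {l l' : SimplexCategoryᵒᵖ} (g : l ⟶ l') (f : k ⟶ l) (x : D.obj l)
    (h : p.app l x = V.map f base) (h' : p.app l' (D.map g x) = V.map (f ≫ g) base),
    E.map g (lift l f x h) = lift l' (f ≫ g) (D.map g x) h'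
  fac : ∀ (l : SimplexCategoryᵒᵖ) (f : k ⟶ l) (x : D.obj l) (h : p.app l x = V.map f base),
    q.app l (lift l f x h) = b.app l x
  eqOn : ∀ (l : SimplexCategoryᵒᵖ) (f : k ⟶ l) (x : D.obj l) (h : p.app l x = V.map f base)
    (hx : x ∈ A.obj l), lift l f x h = a.app l ⟨x, hx⟩

variable {p A q a b}

lemma SimplexLift.ext {k : SimplexCategoryᵒᵖ} {s s' : SimplexLift p A q a b k}
    (h : s.base = s'.base)
    (h' : ∀ l f x h₁ h₂, s.lift l f x h₁ = s'.lift l f x h₂) : s = s' := by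
  obtain ⟨v, lift, _, _, _⟩ := s
  obtain ⟨v', lift', _, _, _⟩ := s'
  obtain rfl : v = v' := h
  obtain rfl : lift = lift' := by
    funext l f x hx
    exact h' l f x hx hx
  rfl

variable (p A q a b)

/-- The simplicial set of lifts over the simplices of `V`. -/
def simplexLifts : SSet.{u} where
  obj k := SimplexLift p A q a b k
  map {k k'} g := TypeCat.ofHom fun s =>
    { base := V.map g s.base
      lift := fun l f x h => s.lift l (g ≫ f) x
        (h.trans (CategoryTheory.Functor.map_comp_apply V g f s.base).symm)
      natural := fun g' f x h h' => by
        refine (s.natural g' (g ≫ f) x _ ?_).trans ?_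
        · rw [h', ← CategoryTheory.Functor.map_comp_apply, Category.assoc]
        · congr 1
      fac := fun l f x h => s.fac l _ x _
      eqOn := fun l f x h hx => s.eqOn l _ x _ hx }
  map_id k := by
    ext s
    refine SimplexLift.ext (CategoryTheory.Functor.map_id_apply V k s.base) fun l f x h₁ h₂ => ?_
    change s.lift l (𝟙 k ≫ f) x _ = _
    congr 1
    exact Category.id_comp f
  map_comp {k k' k''} g g' := by
    ext s
    refine SimplexLift.ext (CategoryTheory.Functor.map_comp_apply V g g' s.base)
      fun l f x h₁ h₂ => ?_
    change s.lift l ((g ≫ g') ≫ f) x _ = s.lift l (g ≫ g' ≫ f) x _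
    congr 1

/-- The projection of lifts to the base. -/
def simplexLiftsBase : simplexLifts p A q a b ⟶ V where
  app _ := TypeCat.ofHom fun s => s.base
  naturality _ _ _ := rfl

variable {p A q a b}

/-- The value of a lift on a simplex of `D`. -/
def SimplexLift.eval {k : SimplexCategoryᵒᵖ} (s : SimplexLift p A q a b k) (x : D.obj k)
    (h : p.app k x = s.base) : E.obj k :=
  s.lift k (𝟙 k) x (h.trans (CategoryTheory.Functor.map_id_apply V k s.base).symm)

lemma SimplexLift.eval_map {k l : SimplexCategoryᵒᵖ} (s : (simplexLifts p A q a b).obj k)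
    (f : k ⟶ l) (x : D.obj l)
    (h : p.app l x = SimplexLift.base ((simplexLifts p A q a b).map f s)) :
    SimplexLift.eval ((simplexLifts p A q a b).map f s) x h = s.lift l f x h := by
  change s.lift l (f ≫ 𝟙 l) x _ = _
  congr 1
  exact Category.comp_id f

lemma SimplexLift.eval_congr {k : SimplexCategoryᵒᵖ} {s s' : SimplexLift p A q a b k} (e : s = s')
    (x : D.obj k) (h : p.app k x = s.base) (h' : p.app k x = s'.base) :
    s.eval x h = s'.eval x h' := by
  subst e
  rfl

lemma SimplexLift.map_eval {k l : SimplexCategoryᵒᵖ} (s : (simplexLifts p A q a b).obj k)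
    (f : k ⟶ l) (x : D.obj k) (h : p.app k x = s.base)
    (h' : p.app l (D.map f x) = SimplexLift.base ((simplexLifts p A q a b).map f s)) :
    E.map f (s.eval x h) =
      SimplexLift.eval ((simplexLifts p A q a b).map f s) (D.map f x) h' := by
  rw [SimplexLift.eval_map]
  refine (s.natural f (𝟙 k) x _ ?_).trans ?_
  · rw [h', Category.id_comp]
    rfl
  · congr 1
    exact Category.id_comp f

/-- If the inclusion of the relative boundary over a simplex `v` is anodyne, then compatible lifts
over the boundary of `v` extend to a lift over `v`. -/
lemma SimplexLift.exists_of_boundary {k : SimplexCategoryᵒᵖ}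
    (hq : fibrations SSet q) (w : CommSq a A.ι q b) (v : V.obj k)
    (hA : anodyneExtensions (relBoundary p A v).ι)
    (β : ∀ (l : SimplexCategoryᵒᵖ) (f : k ⟶ l), ¬ Function.Surjective f.unop.toOrderHom →
      (simplexLifts p A q a b).obj l)
    (β_base : ∀ l f hf, (β l f hf).base = V.map f v)
    (β_map : ∀ {l l'} (f : k ⟶ l) (g : l ⟶ l') hf hf',
      (simplexLifts p A q a b).map g (β l f hf) = β l' (f ≫ g) hf') :
    ∃ s : (simplexLifts p A q a b).obj k, s.base = v ∧
      ∀ l f hf, (simplexLifts p A q a b).map f s = β l f hf := by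
  classical
  -- the lift over the relative boundary
  let ρ' : ∀ (l : SimplexCategoryᵒᵖ) (f : l.unop ⟶ k.unop) (x : D.obj l)
      (h : p.app l x = V.map f.op v), (x ∈ A.obj l ∨ ¬ Function.Surjective f.toOrderHom) →
      E.obj l := fun l f x h hx =>
    if hf : Function.Surjective f.toOrderHom then a.app l ⟨x, hx.resolve_right (not_not.2 hf)⟩
    else (β l f.op hf).eval x (h.trans (β_base l f.op hf).symm)
  have ρ_A : ∀ l f x h hx (hxA : x ∈ A.obj l), ρ' l f x h hx = a.app l ⟨x, hxA⟩ := by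
    intro l f x h hx hxA
    by_cases hf : Function.Surjective f.toOrderHom
    · exact dif_pos hf
    · exact (dif_neg hf).trans ((β l f.op hf).eqOn l _ x _ hxA)
  have ρ_β : ∀ l f x h hx (hf : ¬ Function.Surjective f.toOrderHom),
      ρ' l f x h hx = (β l f.op hf).eval x (h.trans (β_base l f.op hf).symm) :=
    fun l f x h hx hf => dif_neg hf
  let ρ : (relBoundary p A v : SSet) ⟶ E :=
    { app := fun l => TypeCat.ofHom fun z => ρ' l z.1.1.1 z.1.1.2 z.1.2 z.2
      naturality := fun l l' g => by
        refine ConcreteCategory.hom_ext _ _ fun ⟨⟨⟨f, x⟩, h⟩, hx⟩ => ?_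
        have h'' : p.app l' (D.map g x) = V.map (g.unop ≫ f).op v :=
          ((simplexPullback p v).map g ⟨(f, x), h⟩).2
        change ρ' l' (g.unop ≫ f) (D.map g x) h'' ((relBoundary p A v).map g hx) =
          E.map g (ρ' l f x h hx)
        have hx₀ : x ∈ A.obj l ∨ ¬ Function.Surjective f.toOrderHom := hx
        rcases hx₀ with hxA | hxf
        · rw [ρ_A l f x h hx hxA, ρ_A l' _ _ h'' (Or.inl (A.map g hxA)) (A.map g hxA)]
          exact NatTrans.naturality_apply a g ⟨x, hxA⟩
        · have hx' : ¬ Function.Surjective (g.unop ≫ f).toOrderHom := fun h' => hxf fun b => by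
            obtain ⟨a, ha⟩ := h' b
            exact ⟨g.unop.toOrderHom a, ha⟩
          have hm := β_map f.op g hxf hx'
          rw [ρ_β l f x h hx hxf, ρ_β l' _ _ h'' (Or.inr hx') hx']
          have h₃ : p.app l' (D.map g x) =
              SimplexLift.base ((simplexLifts p A q a b).map g (β l f.op hxf)) := by
            rw [hm, β_base, h'']
            rfl
          exact (SimplexLift.eval_congr hm.symm _ _ h₃).trans
            (SimplexLift.map_eval (β l f.op hxf) g x _ h₃).symm }
  let π : simplexPullback p v ⟶ D :=
    { app := fun l => TypeCat.ofHom fun z => z.1.2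
      naturality := fun _ _ _ => rfl }
  have := hA q hq
  have sq : CommSq ρ (relBoundary p A v).ι q (π ≫ b) := ⟨by
    ext l ⟨⟨⟨f, x⟩, h⟩, hx⟩
    change q.app l (ρ' l f x h hx) = b.app l x
    by_cases hf : Function.Surjective f.toOrderHom
    · have hxA := hx.resolve_right (not_not.2 hf)
      rw [ρ_A l f x h hx hxA]
      exact ConcreteCategory.congr_hom (congr_app w.w l) ⟨x, hxA⟩
    · rw [ρ_β l f x h hx hf]
      exact (β l f.op hf).fac _ _ _ _⟩
  have hl : ∀ l f x h hx, sq.lift.app l ⟨(f, x), h⟩ = ρ' l f x h hx := fun l f x h hx =>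
    ConcreteCategory.congr_hom (congr_app sq.fac_left l) ⟨⟨(f, x), h⟩, hx⟩
  let s : SimplexLift p A q a b k :=
    { base := v
      lift := fun l f x h => sq.lift.app l ⟨(f.unop, x), h⟩
      natural := fun {l l'} g f x h h' =>
        (NatTrans.naturality_apply sq.lift g ⟨(f.unop, x), h⟩).symm
      fac := fun l f x h => ConcreteCategory.congr_hom (congr_app sq.fac_right l) ⟨(f.unop, x), h⟩
      eqOn := fun l f x h hx =>
        (hl l f.unop x h (Or.inl hx)).trans (ρ_A l f.unop x h (Or.inl hx) hx) }
  refine ⟨s, rfl, fun l f hf => SimplexLift.ext (β_base l f hf).symm fun l' g x h₁ h₂ => ?_⟩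
  have hf' : ¬ Function.Surjective (f ≫ g).unop.toOrderHom := fun h' => hf fun b => by
    obtain ⟨a, ha⟩ := h' b
    exact ⟨g.unop.toOrderHom a, ha⟩
  have h₃ : p.app l' x = V.map (f ≫ g) v :=
    h₁.trans (CategoryTheory.Functor.map_comp_apply V f g v).symm
  have h₄ : p.app l' x = SimplexLift.base ((simplexLifts p A q a b).map g (β l f hf)) := h₂
  refine (hl l' (f ≫ g).unop x h₃ (Or.inr hf')).trans ((ρ_β l' _ x h₃ (Or.inr hf') hf').trans ?_)
  refine Eq.trans ?_ (SimplexLift.eval_map (β l f hf) g x h₄)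
  exact SimplexLift.eval_congr (β_map f g hf hf').symm x _ _

end Lifts

/-- Being anodyne is local on a base: the inclusion of `A` into `D` is anodyne if it is so
relatively to the boundary over each simplex of `V`. The lifts over the simplices of `V`
form a simplicial set over `V`, and the hypothesis makes the projection to `V` a trivial fibration;
a section of it is a lift. -/
lemma anodyneExtensions_of_relBoundary (A : D.Subcomplex)
    (h : ∀ (k : SimplexCategoryᵒᵖ) (v : V.obj k), anodyneExtensions (relBoundary p A v).ι) :
    anodyneExtensions A.ι := by
  intro E B q hq
  refine ⟨fun {a b} w => ?_⟩
  have hI : I.rlp (simplexLiftsBase p A q a b) := by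
    rintro _ _ _ ⟨n⟩
    refine ⟨fun {t v'} sq => ?_⟩
    let β : ∀ (l : SimplexCategoryᵒᵖ) (f : op ⦋n⦌ ⟶ l), ¬ Function.Surjective f.unop.toOrderHom →
        (simplexLifts p A q a b).obj l := fun l f hf =>
      t.app l ⟨stdSimplex.objEquiv.symm f.unop, hf⟩
    have hbase : ∀ l f hf, (β l f hf).base = V.map f (SSet.yonedaEquiv v') := fun l f hf => by
      have h₁ : (simplexLiftsBase p A q a b).app l (t.app l ⟨stdSimplex.objEquiv.symm f.unop, hf⟩) =
          v'.app l (stdSimplex.objEquiv.symm f.unop) :=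
        ConcreteCategory.congr_hom (congr_app sq.w l) ⟨stdSimplex.objEquiv.symm f.unop, hf⟩
      refine h₁.trans ?_
      rw [← SSet.yonedaEquiv.symm_apply_apply v', SSet.yonedaEquiv_symm_app_objEquiv_symm,
        Equiv.symm_apply_apply]
      rfl
    obtain ⟨s, hs, hs'⟩ := SimplexLift.exists_of_boundary hq w (SSet.yonedaEquiv v') (h _ _) β hbase
      (fun {l l'} f g hf hf' =>
        (NatTrans.naturality_apply t g ⟨stdSimplex.objEquiv.symm f.unop, hf⟩).symm)
    refine ⟨⟨⟨SSet.yonedaEquiv.symm s, ?_, ?_⟩⟩⟩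
    · ext l ⟨x, hx⟩
      exact hs' l (stdSimplex.objEquiv x).op hx
    · rw [SSet.yonedaEquiv_symm_comp, Equiv.symm_apply_eq]
      exact hs
  have hm := rlp_monomorphisms.{u} ▸ hI
  have := hm (initial.to V) (inferInstanceAs (Mono _))
  have sq : CommSq (initial.to _) (initial.to V) (simplexLiftsBase p A q a b) (𝟙 V) :=
    ⟨initial.hom_ext _ _⟩
  have hb : ∀ k v, (sq.lift.app k v).base = v := fun k v =>
    (ConcreteCategory.congr_hom (congr_app sq.fac_right k) v :
      (simplexLiftsBase p A q a b).app k (sq.lift.app k v) = v)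
  refine ⟨⟨⟨{
    app := fun k => TypeCat.ofHom fun x => (sq.lift.app k (p.app k x)).eval x (hb _ _).symm
    naturality := fun k l f => ?_ }, ?_, ?_⟩⟩⟩
  · refine ConcreteCategory.hom_ext _ _ fun x => ?_
    change (sq.lift.app l (p.app l (D.map f x))).eval (D.map f x) (hb _ _).symm =
      E.map f ((sq.lift.app k (p.app k x)).eval x (hb _ _).symm)
    have e : (simplexLifts p A q a b).map f (sq.lift.app k (p.app k x)) =
        sq.lift.app l (p.app l (D.map f x)) := by
      rw [NatTrans.naturality_apply p, NatTrans.naturality_apply sq.lift]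
    rw [SimplexLift.map_eval (h' := by rw [e, hb])]
    exact SimplexLift.eval_congr e.symm _ _ _
  · ext k ⟨x, hx⟩
    exact (sq.lift.app k (p.app k x)).eqOn _ _ _ _ hx
  · ext k x
    exact (sq.lift.app k (p.app k x)).fac _ _ _ _

end LocalAnodyne

/-! ### Čech complexes -/

section Cech

open Simplicial HomotopicalAlgebra SSet SSet.modelCategoryQuillen MonoidalCategory

variable {U V : SSet.{u}} (π : U ⟶ V)

/-- The Čech complex of `π : U ⟶ V`: the diagonal of the bisimplicial set with `(k, l)`-simplices
the `(l + 1)`-tuples of `k`-simplices of `U` over the same simplex of `V`. -/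
def cech : SSet.{u} where
  obj k := {c : Fin (k.unop.len + 1) → U.obj k // ∀ i j, π.app k (c i) = π.app k (c j)}
  map {k l} f := TypeCat.ofHom fun c => ⟨fun i => U.map f (c.1 (f.unop.toOrderHom i)), fun i j => by
    rw [NatTrans.naturality_apply, NatTrans.naturality_apply, c.2]⟩
  map_id k := by
    refine ConcreteCategory.hom_ext _ _ fun c => ?_
    exact Subtype.ext (funext fun i => CategoryTheory.Functor.map_id_apply U k (c.1 i))
  map_comp f g := by
    refine ConcreteCategory.hom_ext _ _ fun c => ?_
    exact Subtype.ext (funext fun i => CategoryTheory.Functor.map_comp_apply U f g _)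

/-- The augmentation of the Čech complex. -/
def cechBase : cech π ⟶ V where
  app k := TypeCat.ofHom fun c => π.app k (c.1 0)
  naturality k l f := by
    refine ConcreteCategory.hom_ext _ _ fun c => ?_
    change π.app l (U.map f (c.1 _)) = V.map f (π.app k (c.1 0))
    rw [NatTrans.naturality_apply, c.2 _ 0]

lemma cechBase_app (k : SimplexCategoryᵒᵖ) (c : (cech π).obj k) (i : Fin (k.unop.len + 1)) :
    (cechBase π).app k c = π.app k (c.1 i) :=
  c.2 0 i

/-- The choice between two elements according to the value at `i` of a simplex of `Δ[1]`. -/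
def switch {k : SimplexCategory} (t : k ⟶ ⦋1⦌) (i : Fin (k.len + 1)) {α : Type*} (x y : α) : α :=
  if t.toOrderHom i = 0 then x else y

lemma switch_or {k : SimplexCategory} (t : k ⟶ ⦋1⦌) (i : Fin (k.len + 1)) {α : Type*} (x y : α) :
    switch t i x y = x ∨ switch t i x y = y :=
  ite_eq_or_eq _ _ _

lemma switch_vertex_zero (k : SimplexCategory) (i : Fin (k.len + 1)) {α : Type*} (x y : α) :
    switch (HomotopyFamily.vertex k 0) i x y = x :=
  if_pos rfl

lemma switch_vertex_one (k : SimplexCategory) (i : Fin (k.len + 1)) {α : Type*} (x y : α) :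
    switch (HomotopyFamily.vertex k 1) i x y = y :=
  if_neg (show ¬ (1 : Fin 2) = 0 from one_ne_zero)

lemma apply_switch {k : SimplexCategory} (t : k ⟶ ⦋1⦌) (i : Fin (k.len + 1)) {α β : Type*}
    (f : α → β) (x y : α) : f (switch t i x y) = switch t i (f x) (f y) :=
  apply_ite f _ x y

/-- The disjoint union of `U` and `V`, with the simplices given by the sum type. -/
def sumSimplicial (U V : SSet.{u}) : SSet.{u} where
  obj k := U.obj k ⊕ V.obj k
  map f := TypeCat.ofHom (Sum.map (U.map f) (V.map f))
  map_id k := by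
    refine ConcreteCategory.hom_ext _ _ fun c => ?_
    rcases c with c | c
    · exact congrArg Sum.inl (CategoryTheory.Functor.map_id_apply U k c)
    · exact congrArg Sum.inr (CategoryTheory.Functor.map_id_apply V k c)
  map_comp f g := by
    refine ConcreteCategory.hom_ext _ _ fun c => ?_
    rcases c with c | c
    · exact congrArg Sum.inl (CategoryTheory.Functor.map_comp_apply U f g c)
    · exact congrArg Sum.inr (CategoryTheory.Functor.map_comp_apply V f g c)

/-- The map `U ⊔ V ⟶ V` given by `π` and the identity. -/
def sumBase : sumSimplicial U V ⟶ V where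
  app k := TypeCat.ofHom (Sum.elim (π.app k) id)
  naturality k l f := by
    refine ConcreteCategory.hom_ext _ _ fun c => ?_
    rcases c with c | c
    · exact NatTrans.naturality_apply π f c
    · rfl

/-- The Čech complex of `U ⊔ V ⟶ V` is equivalent to `V`: it deforms into the constant tuples of
simplices of `V`. -/
lemma isEquivalence_cechBase_sumBase : IsEquivalence (cechBase (sumBase π)) := by
  let s : V ⟶ cech (sumBase π) :=
    { app := fun k => TypeCat.ofHom fun v => ⟨fun _ => Sum.inr v, fun _ _ => rfl⟩
      naturality := fun _ _ _ => rfl }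
  let H : HomotopyFamily (cech (sumBase π)) (cech (sumBase π)) :=
    { h := fun k t c => ⟨fun i => switch t i (c.1 i) (Sum.inr ((cechBase (sumBase π)).app k c)), by
        have : ∀ i, (sumBase π).app k (switch t i (c.1 i)
            (Sum.inr ((cechBase (sumBase π)).app k c))) = (cechBase (sumBase π)).app k c := by
          intro i
          rcases switch_or t i (c.1 i) (Sum.inr ((cechBase (sumBase π)).app k c)) with h | h
          · rw [h, cechBase_app _ k c i]
          · rw [h]
            rfl
        exact fun i j => (this i).trans (this j).symm⟩
      natural := fun {k l} f t c => by
        refine Subtype.ext (funext fun i => ?_)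
        refine (apply_switch t (f.unop.toOrderHom i) ((sumSimplicial U V).map f) _ _).trans ?_
        refine congrArg (switch t (f.unop.toOrderHom i) _) (congrArg Sum.inr ?_)
        exact (NatTrans.naturality_apply (cechBase (sumBase π)) f c).symm }
  refine (IsEquivalence.of_homotopyFamily (cechBase (sumBase π)) s H (fun k c => ?_) (fun k c => ?_)
    fun k v => rfl).1
  · exact Subtype.ext (funext fun i =>
      switch_vertex_zero k.unop i (c.1 i) (Sum.inr ((cechBase (sumBase π)).app k c)))
  · exact Subtype.ext (funext fun i =>
      switch_vertex_one k.unop i (c.1 i) (Sum.inr ((cechBase (sumBase π)).app k c)))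

/-- The Čech complex of `U`, inside that of `U ⊔ V`. -/
def cechSubcomplex : (cech (sumBase π)).Subcomplex where
  obj k := {c | ∀ i, ∃ x, c.1 i = Sum.inl x}
  map f c hc i := by
    obtain ⟨x, hx⟩ := hc (f.unop.toOrderHom i)
    refine ⟨U.map f x, ?_⟩
    change (sumSimplicial U V).map f (c.1 _) = _
    rw [hx]
    rfl

/-- Over a simplex `v` of `V`, the Čech complex of `U ⊔ V` deforms into a constant tuple at a point
of `U` over `v`, and the deformation preserves the Čech complex of `U` and the boundary of `v`. -/
lemma anodyneExtensions_cechSubcomplex (hπ : ∀ k v, ∃ x, π.app k x = v) :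
    anodyneExtensions (cechSubcomplex π).ι := by
  refine anodyneExtensions_of_relBoundary (cechBase (sumBase π)) _ fun k v => ?_
  obtain ⟨x₀, hx₀⟩ := hπ k v
  -- contract to the constant family at a point of `U` over `v`
  let c₀ : ∀ (l : SimplexCategoryᵒᵖ) (f : l.unop ⟶ k.unop), (sumSimplicial U V).obj l :=
    fun l f => Sum.inl (U.map f.op x₀)
  have hc₀ : ∀ l f, (sumBase π).app l (c₀ l f) = V.map f.op v := fun l f => by
    change π.app l (U.map f.op x₀) = _
    rw [NatTrans.naturality_apply, hx₀]
  have aux : ∀ (l : SimplexCategoryᵒᵖ) (t : l.unop ⟶ ⦋1⦌)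
      (z : (simplexPullback (cechBase (sumBase π)) v).obj l) (i : Fin (l.unop.len + 1)),
      (sumBase π).app l (switch t i (c₀ l z.1.1) (z.1.2.1 i)) = V.map z.1.1.op v :=
    fun l t z i => by
    rcases switch_or t i (c₀ l z.1.1) (z.1.2.1 i) with h | h
    · rw [h, hc₀]
    · rw [h]
      exact (cechBase_app _ l z.1.2 i).symm.trans z.2
  let H : HomotopyFamily (simplexPullback (cechBase (sumBase π)) v)
      (simplexPullback (cechBase (sumBase π)) v) :=
    { h := fun l t z => ⟨(z.1.1, ⟨fun i => switch t i (c₀ l z.1.1) (z.1.2.1 i),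
        fun i j => (aux l t z i).trans (aux l t z j).symm⟩), aux l t z 0⟩
      natural := fun {l l'} f t z => by
        refine Subtype.ext (Prod.ext rfl (Subtype.ext (funext fun i => ?_)))
        refine (apply_switch t (f.unop.toOrderHom i) ((sumSimplicial U V).map f) _ _).trans ?_
        exact congrArg (fun x => switch t (f.unop.toOrderHom i) x _)
          (congrArg Sum.inl (CategoryTheory.Functor.map_comp_apply U z.1.1.op f x₀).symm) }
  refine anodyneExtensions_of_deformation _ H (fun l z => ?_) (fun l z => ?_) fun l t z hz => ?_
  · exact Or.inl fun i => ⟨U.map z.1.1.op x₀, switch_vertex_zero l.unop i (c₀ l z.1.1) (z.1.2.1 i)⟩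
  · exact Subtype.ext (Prod.ext rfl (Subtype.ext (funext fun i =>
      switch_vertex_one l.unop i (c₀ l z.1.1) (z.1.2.1 i))))
  · refine hz.imp (fun h i => ?_) id
    change ∃ x, switch t i (c₀ l z.1.1) (z.1.2.1 i) = Sum.inl x
    rcases switch_or t i (c₀ l z.1.1) (z.1.2.1 i) with h' | h'
    · exact ⟨_, h'⟩
    · rw [h']
      exact h i

/-- The Čech complex of a surjection is equivalent to the base. -/
theorem isEquivalence_cechBase (hπ : ∀ k v, ∃ x, π.app k x = v) : IsEquivalence (cechBase π) := by
  let j : cech π ⟶ (cechSubcomplex π : SSet) :=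
    { app := fun k => TypeCat.ofHom fun c =>
        ⟨⟨fun i => Sum.inl (c.1 i), c.2⟩, fun i => ⟨c.1 i, rfl⟩⟩
      naturality := fun _ _ _ => rfl }
  have hj : ∀ k, Function.Bijective (j.app k) := by
    refine fun k => ⟨fun c c' h => ?_, fun ⟨⟨c, hc⟩, h⟩ => ?_⟩
    · exact Subtype.ext (funext fun i => Sum.inl_injective
        (congrFun (congrArg (fun z => z.1.1) h) i))
    · have h' : ∀ i, ∃ x, c i = Sum.inl x := h
      choose x hx using h'
      obtain rfl : c = fun i => Sum.inl (x i) := funext hx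
      exact ⟨⟨x, hc⟩, rfl⟩
  have : ∀ k, IsIso (j.app k) := fun k => (isIso_iff_bijective _).2 (hj k)
  have : IsIso j := NatIso.isIso_of_isIso_app j
  have h := ((IsEquivalence.of_isIso j).comp
    (.of_anodyne (anodyneExtensions_cechSubcomplex π hπ))).comp (isEquivalence_cechBase_sumBase π)
  exact h

end Cech

/-! ### Derivations over posets with triangles -/

/-- A poset with a class of degenerate elements and a class of triangles `a ≤ b ≤ c`, as the poset
of pairs `i ≤ j` in `[p]` has: the pairs `i = j`, and the triangles `(i, j) ≤ (i, k) ≤ (j, k)`. -/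
class TrianglePoset (P : Type) extends PartialOrder P where
  Degenerate : P → Prop
  Triangle : P → P → P → Prop
  triangle_left : ∀ {a b c : P}, Triangle a b c → a ≤ b
  triangle_right : ∀ {a b c : P}, Triangle a b c → b ≤ c

open TrianglePoset

/-- Abelian groups `S(a, b)`, contravariantly functorial in `a` and covariantly in `b`: a bimodule
over the poset `P`. -/
structure PosetBimodule (P : Type) [Preorder P] where
  obj : P → P → Type w
  [group : ∀ a b, AddCommGroup (obj a b)]
  pull : ∀ {a a' : P} (_ : a ≤ a') (b : P), obj a' b →+ obj a b
  push : ∀ (a : P) {b b' : P} (_ : b ≤ b'), obj a b →+ obj a b'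
  pull_refl : ∀ (a b : P) (x : obj a b), pull (le_refl a) b x = x
  push_refl : ∀ (a b : P) (x : obj a b), push a (le_refl b) x = x
  pull_pull : ∀ {a a' a'' : P} (h : a ≤ a') (h' : a' ≤ a'') (b : P) (x : obj a'' b),
    pull h b (pull h' b x) = pull (h.trans h') b x
  push_push : ∀ (a : P) {b b' b'' : P} (h : b ≤ b') (h' : b' ≤ b'') (x : obj a b),
    push a h' (push a h x) = push a (h.trans h') x
  push_pull : ∀ {a a' b b' : P} (h : a ≤ a') (h' : b ≤ b') (x : obj a' b),
    push a h' (pull h b x) = pull h b' (push a' h' x)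

namespace PosetBimodule

attribute [instance] PosetBimodule.group

section

variable {P : Type} [Preorder P] (S : PosetBimodule.{w} P)

/-- Derivations with values in a bimodule: families `z` on the relations `a ≤ b` which satisfy the
Leibniz rule. -/
def IsDerivation (z : ∀ a b : P, a ≤ b → S.obj a b) : Prop :=
  ∀ (a b c : P) (h : a ≤ b) (h' : b ≤ c),
    z a c (h.trans h') = S.push a h' (z a b h) + S.pull h c (z b c h')

/-- Inner derivations: those of the form `c_b - c_a`, moved to `S(a, b)`. -/
def IsInner (z : ∀ a b : P, a ≤ b → S.obj a b) : Prop :=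
  ∃ c : ∀ a, S.obj a a, ∀ (a b : P) (h : a ≤ b), z a b h = S.pull h b (c b) - S.push a h (c a)

variable {S}

lemma IsDerivation.refl {z : ∀ a b : P, a ≤ b → S.obj a b} (hz : S.IsDerivation z) (a : P) :
    z a a le_rfl = 0 := by
  have h := hz a a a le_rfl le_rfl
  rwa [S.push_refl, S.pull_refl, left_eq_add] at h

lemma IsDerivation.sub_inner {z : ∀ a b : P, a ≤ b → S.obj a b} (hz : S.IsDerivation z)
    (c : ∀ a, S.obj a a) :
    S.IsDerivation fun a b h => z a b h - (S.pull h b (c b) - S.push a h (c a)) := by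
  intro a b d h h'
  simp only [hz a b d h h', map_sub, S.push_push, S.pull_pull, S.push_pull]
  abel

variable (S)

/-- The restriction of a bimodule along two monotone maps, one for each variable. -/
def comap {Q : Type} [Preorder Q] (f g : Q →o P) : PosetBimodule.{w} Q where
  obj a b := S.obj (f a) (g b)
  pull h b := S.pull (f.monotone h) (g b)
  push a _ _ h := S.push (f a) (g.monotone h)
  pull_refl _ _ := S.pull_refl _ _
  push_refl _ _ := S.push_refl _ _
  pull_pull _ _ _ := S.pull_pull _ _ _
  push_push _ _ _ _ _ _ := S.push_push _ _ _
  push_pull _ _ := S.push_pull _ _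

end

/-- A bimodule over a chain whose restrictions `S(j + 1, b) → S(j, b)` are surjective for
`b = j + 1` has only inner derivations. -/
lemma isInner_of_chain {m : ℕ} (S : PosetBimodule.{w} (Fin (m + 1)))
    (hS : ∀ j : Fin m, Function.Surjective (S.pull (Fin.castSucc_le_succ j) j.succ))
    {z : ∀ a b : Fin (m + 1), a ≤ b → S.obj a b} (hz : S.IsDerivation z) : S.IsInner z := by
  have step : ∀ (j : Fin m) (x : S.obj j.castSucc j.castSucc), ∃ y : S.obj j.succ j.succ,
      z _ _ (Fin.castSucc_le_succ j) =
        S.pull (Fin.castSucc_le_succ j) _ y - S.push _ (Fin.castSucc_le_succ j) x := fun j x => by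
    obtain ⟨y, hy⟩ := hS j (z _ _ (Fin.castSucc_le_succ j) + S.push _ (Fin.castSucc_le_succ j) x)
    exact ⟨y, by rw [hy, add_sub_cancel_right]⟩
  choose next hnext using step
  let c : ∀ a, S.obj a a := Fin.induction (motive := fun a => S.obj a a) 0 next
  have hc : ∀ j : Fin m, z _ _ (Fin.castSucc_le_succ j) =
      S.pull (Fin.castSucc_le_succ j) _ (c j.succ) -
        S.push _ (Fin.castSucc_le_succ j) (c j.castSucc) := fun j => hnext j _
  refine ⟨c, fun a b => ?_⟩
  induction b using Fin.induction with
  | zero =>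
    intro h
    obtain rfl : a = 0 := Fin.le_zero_iff.1 h
    rw [hz.refl, S.pull_refl, S.push_refl, sub_self]
  | succ j ih =>
    intro h
    rcases h.eq_or_lt with rfl | h'
    · rw [hz.refl, S.pull_refl, S.push_refl, sub_self]
    · have h'' : a ≤ j.castSucc := Fin.le_castSucc_iff.2 h'
      rw [hz a _ _ h'' (Fin.castSucc_le_succ j), ih h'', hc j, map_sub, map_sub, S.push_push,
        S.pull_pull, S.push_pull]
      abel

/-- Exactness of a bimodule over a poset with triangles: it vanishes at degenerate elements, and the
triangles in the contravariant variable give short exact sequences. -/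
structure IsExact {P : Type} [TrianglePoset P] (S : PosetBimodule.{w} P) : Prop where
  left_zero : ∀ (a b : P), Degenerate a → ∀ x : S.obj a b, x = 0
  right_zero : ∀ (a b : P), Degenerate b → ∀ x : S.obj a b, x = 0
  injective : ∀ {a b c : P} (h : Triangle a b c) (d : P),
    ∀ x, S.pull (triangle_right h) d x = 0 → x = 0
  pull_pull_eq_zero : ∀ {a b c : P} (h : Triangle a b c) (d : P) (x : S.obj c d),
    S.pull (triangle_left h) d (S.pull (triangle_right h) d x) = 0
  exact : ∀ {a b c : P} (h : Triangle a b c) (d : P) (x : S.obj b d),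
    S.pull (triangle_left h) d x = 0 → ∃ y, S.pull (triangle_right h) d y = x
  surjective : ∀ {a b c : P} (h : Triangle a b c) (d : P),
    Function.Surjective (S.pull (triangle_left h) d)

end PosetBimodule

/-- A poset with triangles is acyclic if all derivations with values in exact bimodules are
inner. -/
def TrianglePoset.IsAcyclic (P : Type) [TrianglePoset P] : Prop :=
  ∀ S : PosetBimodule.{w} P, S.IsExact → ∀ z, S.IsDerivation z → S.IsInner z

/-- The triangles `(i, j) ≤ (i, k) ≤ (j, k)`. -/
instance (p : SimplexCategory) : TrianglePoset (Ar p) where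
  Degenerate θ := θ.src = θ.tgt
  Triangle θ θ' θ'' := θ.src = θ'.src ∧ θ'.tgt = θ''.tgt ∧ θ.tgt = θ''.src ∧ θ ≤ θ' ∧ θ' ≤ θ''
  triangle_left h := h.2.2.2.1
  triangle_right h := h.2.2.2.2

open PosetBimodule

/-- For `[p]`: the values of a derivation on the relations between the pairs `0 ≤ j` are inner
because restriction is surjective there, and by exactness the rest follows from them. -/
lemma Ar.isAcyclic (p : SimplexCategory) : IsAcyclic.{w} (Ar p) := by
  intro S hS z hz
  let e : Fin (p.len + 1) →o Ar p := ⟨fun j => ⟨0, j, Fin.zero_le j⟩, fun _ _ h => ⟨le_rfl, h⟩⟩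
  obtain ⟨c₀, hc₀⟩ : ∃ c₀ : ∀ j, S.obj (e j) (e j), ∀ (a b) (h : a ≤ b) (h' : e a ≤ e b),
      z (e a) (e b) h' = S.pull h' _ (c₀ b) - S.push _ h' (c₀ a) := by
    obtain ⟨c₀, hc₀⟩ := isInner_of_chain (S.comap e e)
      (fun j => hS.surjective (a := e j.castSucc) (b := e j.succ)
        (c := ⟨j.castSucc, j.succ, Fin.castSucc_le_succ j⟩)
        ⟨rfl, rfl, rfl, ⟨le_rfl, Fin.castSucc_le_succ j⟩, ⟨Fin.zero_le _, le_rfl⟩⟩ (e j.succ))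
      (z := fun a b h => z (e a) (e b) (e.monotone h))
      (fun a b c h h' => hz _ _ _ (e.monotone h) (e.monotone h'))
    exact ⟨c₀, fun a b h _ => hc₀ a b h⟩
  have hle : ∀ θ : Ar p, e θ.tgt ≤ θ := fun θ => ⟨Fin.zero_le _, le_rfl⟩
  have hle' : ∀ θ : Ar p, e θ.src ≤ e θ.tgt := fun θ => e.monotone θ.le
  have hmono : ∀ θ θ' : Ar p, θ ≤ θ' → e θ.tgt ≤ e θ'.tgt := fun θ θ' h => e.monotone h.2
  have htri : ∀ θ : Ar p, Triangle (e θ.src) (e θ.tgt) θ := fun θ =>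
    ⟨rfl, rfl, rfl, e.monotone θ.le, hle θ⟩
  have hdiag : ∀ θ : Ar p, e θ.src ≤ ⟨θ.src, θ.src, le_rfl⟩ := fun θ => ⟨Fin.zero_le _, le_rfl⟩
  clear_value e
  have key : ∀ θ : Ar p, ∃ c : S.obj θ θ,
      S.pull (hle θ) θ c = z _ _ (hle θ) + S.push _ (hle θ) (c₀ θ.tgt) := fun θ => by
    refine hS.exact (htri θ) θ _ ?_
    -- the restriction to `(0, a)` factors through the degenerate pair `(a, a)`
    have h₁ := hdiag θ
    have h₂ : ⟨θ.src, θ.src, le_rfl⟩ ≤ θ := ⟨le_rfl, θ.le⟩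
    have h₃ := hz _ _ _ (hle' θ) (hle θ)
    rw [hc₀ _ _ θ.le, hz _ _ _ h₁ h₂, hS.right_zero _ _ rfl (z _ _ h₁),
      hS.left_zero _ _ rfl (z _ _ h₂), map_zero, map_zero, add_zero, map_sub, S.push_push,
      ← S.push_push _ h₁ h₂, hS.right_zero _ _ rfl (S.push _ h₁ _), map_zero, sub_zero,
      S.push_pull] at h₃
    exact (map_add _ _ _).trans ((add_comm _ _).trans h₃.symm)
  choose c hc using key
  refine ⟨c, fun θ θ' h => ?_⟩
  have he := hmono θ θ' h
  have h₁ := hz _ _ _ (hle θ) h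
  have h₂ := hz _ _ _ he (hle θ')
  have h₃ := hc₀ _ _ h.2 he
  rw [← sub_eq_zero]
  refine hS.injective (htri θ) θ' _ ?_
  rw [map_sub, map_sub, S.pull_pull, ← S.push_pull, hc, sub_eq_zero,
    ← S.pull_pull he (hle θ') θ' (c θ'), hc, map_add, map_add, S.push_push]
  rw [h₃, map_sub, S.push_push, S.push_pull] at h₂
  rw [h₂] at h₁
  rw [eq_comm, ← sub_eq_iff_eq_add'] at h₁
  rw [← h₁]
  abel

/-- The triangles of a product of two posets: those in one variable, with the other one fixed. -/
instance (P Q : Type) [TrianglePoset P] [TrianglePoset Q] : TrianglePoset (P × Q) where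
  Degenerate x := Degenerate x.1 ∨ Degenerate x.2
  Triangle x y z := (Triangle x.1 y.1 z.1 ∧ x.2 = y.2 ∧ y.2 = z.2) ∨
    (Triangle x.2 y.2 z.2 ∧ x.1 = y.1 ∧ y.1 = z.1)
  triangle_left h := h.elim (fun h => ⟨triangle_left h.1, h.2.1.le⟩)
    fun h => ⟨h.2.1.le, triangle_left h.1⟩
  triangle_right h := h.elim (fun h => ⟨triangle_right h.1, h.2.2.le⟩)
    fun h => ⟨h.2.2.le, triangle_right h.1⟩

namespace PosetBimodule

section Product

variable {P Q : Type} [TrianglePoset P] [TrianglePoset Q] (S : PosetBimodule.{w} (P × Q))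

lemma triangle_mk_left {a b c : P} (h : Triangle a b c) (q : Q) :
    Triangle (a, q) (b, q) (c, q) :=
  Or.inl ⟨h, rfl, rfl⟩

lemma triangle_mk_right (a : P) {q r t : Q} (h : Triangle q r t) :
    Triangle (a, q) (a, r) (a, t) :=
  Or.inr ⟨h, rfl, rfl⟩

/-- The inclusion of `Q` in `P × Q` at an element of `P`. -/
def sliceHom (a : P) : Q →o P × Q := ⟨fun q => (a, q), fun _ _ h => ⟨le_rfl, h⟩⟩

/-- Restriction to slices. -/
def slice (a b : P) : PosetBimodule.{w} Q := S.comap (sliceHom a) (sliceHom b)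

variable {S} in
lemma IsExact.slice (hS : S.IsExact) (a b : P) : (S.slice a b).IsExact where
  left_zero q r h := hS.left_zero (a, q) (b, r) (Or.inr h)
  right_zero q r h := hS.right_zero (a, q) (b, r) (Or.inr h)
  injective h d := hS.injective (triangle_mk_right a h) (b, d)
  pull_pull_eq_zero h d := hS.pull_pull_eq_zero (triangle_mk_right a h) (b, d)
  exact h d := hS.exact (triangle_mk_right a h) (b, d)
  surjective h d := hS.surjective (triangle_mk_right a h) (b, d)

/-- The families that are natural in the variable in `Q`. -/
def naturalFamilies (a b : P) : AddSubgroup (∀ q : Q, S.obj (a, q) (b, q)) where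
  carrier := {m | ∀ (q r : Q) (h : q ≤ r),
    S.push (a, q) (⟨le_rfl, h⟩ : (b, q) ≤ (b, r)) (m q) =
      S.pull (⟨le_rfl, h⟩ : (a, q) ≤ (a, r)) (b, r) (m r)}
  add_mem' h h' q r l := by simp only [Pi.add_apply, map_add, h q r l, h' q r l]
  zero_mem' q r l := by simp only [Pi.zero_apply, map_zero]
  neg_mem' h q r l := by simp only [Pi.neg_apply, map_neg, h q r l]

/-- The bimodule over `P` of families that are natural in the variable in `Q`. -/
def natural : PosetBimodule.{w} P where
  obj a b := S.naturalFamilies a b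
  pull {a a'} h b :=
    { toFun := fun m => ⟨fun q => S.pull ⟨h, le_refl q⟩ (b, q) (m.1 q), fun q r l => by
        rw [S.push_pull, m.2 q r l, S.pull_pull, S.pull_pull]⟩
      map_zero' := Subtype.ext (funext fun _ => map_zero _)
      map_add' := fun _ _ => Subtype.ext (funext fun _ => map_add _ _ _) }
  push a {b b'} h :=
    { toFun := fun m => ⟨fun q => S.push (a, q) ⟨h, le_refl q⟩ (m.1 q), fun q r l => by
        rw [← S.push_pull, ← m.2 q r l, S.push_push, S.push_push]⟩
      map_zero' := Subtype.ext (funext fun _ => map_zero _)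
      map_add' := fun _ _ => Subtype.ext (funext fun _ => map_add _ _ _) }
  pull_refl _ _ _ := Subtype.ext (funext fun _ => S.pull_refl _ _ _)
  push_refl _ _ _ := Subtype.ext (funext fun _ => S.push_refl _ _ _)
  pull_pull _ _ _ _ := Subtype.ext (funext fun _ => S.pull_pull _ _ _ _)
  push_push _ _ _ _ _ _ _ := Subtype.ext (funext fun _ => S.push_push _ _ _ _)
  push_pull _ _ _ := Subtype.ext (funext fun _ => S.push_pull _ _ _)

variable {S}

/-- Passing to natural families preserves exactness. A pointwise lift of a natural family fails to
be natural by a derivation, which is inner by acyclicity of `Q`, so that the lift can be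
corrected. -/
lemma IsExact.natural (hS : S.IsExact) (hQ : IsAcyclic.{w} Q) : S.natural.IsExact where
  left_zero a b h x := Subtype.ext (funext fun q => hS.left_zero (a, q) (b, q) (Or.inl h) _)
  right_zero a b h x := Subtype.ext (funext fun q => hS.right_zero (a, q) (b, q) (Or.inl h) _)
  injective {a b c} h d x hx := Subtype.ext (funext fun q =>
    hS.injective (triangle_mk_left h q) (d, q) _ (congrFun (congrArg Subtype.val hx) q))
  pull_pull_eq_zero h d x := Subtype.ext (funext fun q =>
    hS.pull_pull_eq_zero (triangle_mk_left h q) (d, q) (x.1 q))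
  exact {a b c} h d x hx := by
    have hx' : ∀ q : Q, S.pull (⟨triangle_left h, le_rfl⟩ : (a, q) ≤ (b, q)) (d, q) (x.1 q) = 0 :=
      congrFun (congrArg Subtype.val hx)
    have := fun q => hS.exact (triangle_mk_left h q) (d, q) (x.1 q) (hx' q)
    choose y hy using this
    refine ⟨⟨y, fun q r l => ?_⟩, Subtype.ext (funext hy)⟩
    rw [← sub_eq_zero]
    refine hS.injective (triangle_mk_left h q) (d, r) _ ?_
    rw [map_sub, sub_eq_zero, ← S.push_pull, hy, x.2 q r l, S.pull_pull, ← hy r, S.pull_pull]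
  surjective {a b c} h d x := by
    have := fun q => hS.surjective (triangle_mk_left h q) (d, q) (x.1 q)
    choose y hy using this
    -- the defect of naturality of a pointwise lift is a derivation with values in a slice
    have hz : ∀ (q r : Q) (l : q ≤ r), ∃ u : S.obj (c, q) (d, r),
        S.pull (⟨triangle_right h, le_rfl⟩ : (b, q) ≤ (c, q)) (d, r) u =
          S.pull (⟨le_rfl, l⟩ : (b, q) ≤ (b, r)) (d, r) (y r) -
            S.push (b, q) (⟨le_rfl, l⟩ : (d, q) ≤ (d, r)) (y q) := fun q r l => by
      refine hS.exact (triangle_mk_left h q) (d, r) _ ?_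
      have h₁ : (a, q) ≤ (a, r) := ⟨le_rfl, l⟩
      have h₂ : (a, r) ≤ (b, r) := ⟨triangle_left h, le_rfl⟩
      rw [map_sub, sub_eq_zero, S.pull_pull, ← S.push_pull, hy q, x.2 q r l, ← hy r, S.pull_pull]
    choose z hz using hz
    have hinj : ∀ (q r : Q) (u u' : S.obj (c, q) (d, r)),
        S.pull (⟨triangle_right h, le_rfl⟩ : (b, q) ≤ (c, q)) (d, r) u =
          S.pull (⟨triangle_right h, le_rfl⟩ : (b, q) ≤ (c, q)) (d, r) u' → u = u' :=
      fun q r u u' hu => sub_eq_zero.1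
        (hS.injective (triangle_mk_left h q) (d, r) _ (by rw [map_sub, hu, sub_self]))
    have hder : ∀ (q r t : Q) (l : q ≤ r) (l' : r ≤ t), z q t (l.trans l') =
        S.push (c, q) (⟨le_rfl, l'⟩ : (d, r) ≤ (d, t)) (z q r l) +
          S.pull (⟨le_rfl, l⟩ : (c, q) ≤ (c, r)) (d, t) (z r t l') := fun q r t l l' => by
      refine hinj q t _ _ ?_
      have h₃ : (b, q) ≤ (b, r) := ⟨le_rfl, l⟩
      have h₄ : (b, r) ≤ (c, r) := ⟨triangle_right h, le_rfl⟩
      rw [map_add, hz q t, ← S.push_pull, hz q r l, S.pull_pull, ← S.pull_pull h₃ h₄, hz r t l',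
        map_sub, map_sub, S.push_push, S.pull_pull, S.push_pull]
      abel
    obtain ⟨e, he⟩ : ∃ e : ∀ q, S.obj (c, q) (d, q), ∀ (q r : Q) (l : q ≤ r), z q r l =
        S.pull (⟨le_rfl, l⟩ : (c, q) ≤ (c, r)) (d, r) (e r) -
          S.push (c, q) (⟨le_rfl, l⟩ : (d, q) ≤ (d, r)) (e q) :=
      hQ (S.slice c d) (hS.slice c d) z hder
    refine ⟨⟨fun q => y q - S.pull (⟨triangle_right h, le_rfl⟩ : (b, q) ≤ (c, q)) (d, q) (e q),
      fun q r l => ?_⟩, Subtype.ext (funext fun q => ?_)⟩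
    · have h₁ := hz q r l
      have h₂ : (b, q) ≤ (b, r) := ⟨le_rfl, l⟩
      rw [he q r l, map_sub, S.pull_pull, ← S.push_pull, sub_eq_sub_iff_sub_eq_sub] at h₁
      rw [map_sub, map_sub, S.pull_pull, ← sub_eq_zero, ← sub_eq_zero.2 h₁]
      abel
    · refine (map_sub (S.pull (⟨triangle_left h, le_rfl⟩ : (a, q) ≤ (b, q)) (d, q)) _ _).trans ?_
      rw [hy q]
      exact (congrArg (x.1 q - ·) (hS.pull_pull_eq_zero (triangle_mk_left h q) (d, q) (e q))).trans
        (sub_zero _)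

/-- Acyclic posets are closed under products: by acyclicity of `Q`, a derivation can be made to
vanish on the relations in the direction of `Q`, and then it is a derivation on `P` with values in
natural families. -/
lemma _root_.TrianglePoset.IsAcyclic.prod (hP : IsAcyclic.{w} P) (hQ : IsAcyclic.{w} Q) :
    IsAcyclic.{w} (P × Q) := by
  intro S hS z hz
  have hslice : ∀ a : P, ∃ c : ∀ q, S.obj (a, q) (a, q), ∀ (q r : Q) (l : q ≤ r),
      z (a, q) (a, r) ⟨le_rfl, l⟩ = S.pull (⟨le_rfl, l⟩ : (a, q) ≤ (a, r)) (a, r) (c r) -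
          S.push (a, q) (⟨le_rfl, l⟩ : (a, q) ≤ (a, r)) (c q) := fun a =>
    hQ (S.slice a a) (hS.slice a a) (fun q r l => z (a, q) (a, r) ⟨le_rfl, l⟩)
      (fun q r t l l' => hz (a, q) (a, r) (a, t) ⟨le_rfl, l⟩ ⟨le_rfl, l'⟩)
  choose c hc using hslice
  let c' : ∀ x, S.obj x x := fun x => c x.1 x.2
  let z' : ∀ x y : P × Q, x ≤ y → S.obj x y := fun x y h =>
    z x y h - (S.pull h y (c' y) - S.push x h (c' x))
  have hz' : S.IsDerivation z' := hz.sub_inner c'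
  have hzero : ∀ (a : P) (q r : Q) (l : q ≤ r), z' (a, q) (a, r) ⟨le_rfl, l⟩ = 0 :=
    fun a q r l => sub_eq_zero.2 (hc a q r l)
  obtain ⟨d, hd⟩ : ∃ d : ∀ a, S.naturalFamilies a a, ∀ (a b : P) (h : a ≤ b) (q : Q),
      z' (a, q) (b, q) ⟨h, le_rfl⟩ =
        S.pull (⟨h, le_rfl⟩ : (a, q) ≤ (b, q)) (b, q) ((d b).1 q) -
          S.push (a, q) (⟨h, le_rfl⟩ : (a, q) ≤ (b, q)) ((d a).1 q) := by
    obtain ⟨d, hd⟩ := hP S.natural (hS.natural hQ)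
      (fun a b h => ⟨fun q => z' (a, q) (b, q) ⟨h, le_rfl⟩, fun q r l => by
        have h₁ := hz' (a, q) (b, q) (b, r) ⟨h, le_rfl⟩ ⟨le_rfl, l⟩
        have h₂ := hz' (a, q) (a, r) (b, r) ⟨le_rfl, l⟩ ⟨h, le_rfl⟩
        rw [hzero b q r l, map_zero, add_zero] at h₁
        rw [hzero a q r l, map_zero, zero_add] at h₂
        exact h₁.symm.trans h₂⟩)
      (fun a b c h h' => Subtype.ext (funext fun q =>
        hz' (a, q) (b, q) (c, q) ⟨h, le_rfl⟩ ⟨h', le_rfl⟩))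
    exact ⟨d, fun a b h q => congrFun (congrArg Subtype.val (hd a b h)) q⟩
  refine ⟨fun x => (d x.1).1 x.2 + c' x, fun ⟨a, q⟩ ⟨b, r⟩ h => ?_⟩
  have h₁ : (a, q) ≤ (b, q) := ⟨h.1, le_rfl⟩
  have h₂ : (b, q) ≤ (b, r) := ⟨le_rfl, h.2⟩
  have h₃ := hz' _ _ _ h₁ h₂
  rw [hzero b q r h.2, map_zero, add_zero, hd a b h.1, map_sub, S.push_pull, (d b).2 q r h.2,
    S.pull_pull, S.push_push] at h₃
  have h₄ := sub_eq_iff_eq_add.1 h₃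
  rw [h₄, map_add, map_add]
  abel

end Product

end PosetBimodule

/-- Acyclicity of posets with triangles is preserved by order isomorphisms that preserve the
degenerate elements and the triangles. -/
lemma TrianglePoset.IsAcyclic.of_orderIso {P Q : Type} [TrianglePoset P] [TrianglePoset Q]
    (hP : IsAcyclic.{w} P) (e : P ≃o Q) (hdeg : ∀ a, Degenerate a → Degenerate (e a))
    (htri : ∀ a b c, Triangle a b c → Triangle (e a) (e b) (e c)) : IsAcyclic.{w} Q := by
  intro S hS z hz
  obtain ⟨c, hc⟩ : ∃ c : ∀ a, S.obj (e a) (e a), ∀ (a b) (_ : a ≤ b) (h : e a ≤ e b),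
      z (e a) (e b) h = S.pull h _ (c b) - S.push _ h (c a) := by
    obtain ⟨c, hc⟩ := hP (S.comap ⟨e, e.monotone⟩ ⟨e, e.monotone⟩)
      { left_zero := fun a b h => hS.left_zero _ _ (hdeg a h)
        right_zero := fun a b h => hS.right_zero _ _ (hdeg b h)
        injective := fun h d => hS.injective (htri _ _ _ h) (e d)
        pull_pull_eq_zero := fun h d => hS.pull_pull_eq_zero (htri _ _ _ h) (e d)
        exact := fun h d => hS.exact (htri _ _ _ h) (e d)
        surjective := fun h d => hS.surjective (htri _ _ _ h) (e d) }
      (fun a b h => z (e a) (e b) (e.monotone h))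
      (fun a b c h h' => hz _ _ _ (e.monotone h) (e.monotone h'))
    exact ⟨c, fun a b h _ => hc a b h⟩
  have key : ∀ y : Q, ∃ d : S.obj y y, ∀ (x : P) (h : y ≤ e x) (h' : e x ≤ y),
      d = S.pull h _ (S.push _ h' (c x)) := fun y => by
    obtain ⟨x, rfl⟩ := e.surjective y
    refine ⟨c x, fun x' h h' => ?_⟩
    obtain rfl : x = x' := e.injective (le_antisymm h h')
    rw [S.push_refl, S.pull_refl]
  choose d hd using key
  have hd' : ∀ x, d (e x) = c x := fun x => by
    rw [hd (e x) x le_rfl le_rfl, S.push_refl, S.pull_refl]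
  refine ⟨d, fun y y' h => ?_⟩
  obtain ⟨x, rfl⟩ := e.surjective y
  obtain ⟨x', rfl⟩ := e.surjective y'
  rw [hd', hd', hc x x' (e.le_iff_le.1 h)]

/-- The triangles of the exactness conditions of the iterated `S`-construction. -/
instance {n : ℕ} (p : Fin n → SimplexCategory) : TrianglePoset (Cube p) where
  Degenerate θ := ∃ i, (θ i).src = (θ i).tgt
  Triangle θ θ' θ'' := ∃ i, IsTriangle i θ θ' θ''
  triangle_left h := h.choose_spec.le
  triangle_right h := h.choose_spec.le'

/-- By induction on the number of directions. -/
lemma Cube.isAcyclic : ∀ {n : ℕ} (p : Fin n → SimplexCategory), IsAcyclic.{w} (Cube p)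
  | 0, p => fun S _ z hz => ⟨fun _ => 0, fun a b h => by
      obtain rfl : a = b := Subsingleton.elim _ _
      rw [hz.refl, map_zero, map_zero, sub_zero]⟩
  | n + 1, p => by
      refine ((Ar.isAcyclic (p 0)).prod (Cube.isAcyclic fun i => p i.succ)).of_orderIso
        (Fin.consOrderIso fun i => Ar (p i)) ?_ ?_
      · rintro ⟨a, θ⟩ (h | ⟨i, h⟩)
        · exact ⟨0, h⟩
        · exact ⟨i.succ, h⟩
      · rintro ⟨a, θ⟩ ⟨a', θ'⟩ ⟨a'', θ''⟩ (⟨h, rfl, rfl⟩ | ⟨⟨i, h⟩, rfl, rfl⟩)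
        · refine ⟨0, ⟨h.1, h.2.1, h.2.2.1, ?_, ?_, ?_, ?_⟩⟩
          · exact fun j => Fin.cases (fun h => absurd rfl h) (fun j _ => rfl) j
          · exact fun j => Fin.cases (fun h => absurd rfl h) (fun j _ => rfl) j
          · exact Fin.cases h.2.2.2.1 fun j => le_rfl
          · exact Fin.cases h.2.2.2.2 fun j => le_rfl
        · refine ⟨i.succ, ⟨h.src_eq, h.tgt_eq, h.mid_eq, ?_, ?_, ?_, ?_⟩⟩
          · exact fun j => Fin.cases (fun _ => rfl)
              (fun j hj => h.other j fun e => hj (congrArg Fin.succ e)) j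
          · exact fun j => Fin.cases (fun _ => rfl)
              (fun j hj => h.other' j fun e => hj (congrArg Fin.succ e)) j
          · exact Fin.cases le_rfl fun j => h.le j
          · exact Fin.cases le_rfl fun j => h.le' j

namespace Bimodule

variable {C : Type u} [Category.{v} C] [Preadditive C] [ExactCategory C] (M : Bimodule.{w} C)

lemma eq_zero_of_isZero_left {a b : C} (h : IsZero a) (x : M.Elt a b) : x = 0 := by
  rw [← M.pull_id a b x, h.eq_of_src (𝟙 a) 0, M.pull_zero_hom]

lemma eq_zero_of_isZero_right {a b : C} (h : IsZero b) (x : M.Elt a b) : x = 0 := by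
  rw [← M.push_id b a x, h.eq_of_src (𝟙 b) 0, M.push_zero_hom]

/-- The bimodule `M(X_ρ, Y_θ)` over a poset. -/
def ofDiagrams {P : Type} [Preorder P] (X Y : P ⥤ C) : PosetBimodule.{w} P where
  obj a b := M.Elt (X.obj a) (Y.obj b)
  pull h b := M.pull (X.map (homOfLE h)) (Y.obj b)
  push a _ _ h := M.push (Y.map (homOfLE h)) (X.obj a)
  pull_refl a b x := by
    rw [show homOfLE (le_refl a) = 𝟙 a from rfl, X.map_id, M.pull_id]
  push_refl a b x := by
    rw [show homOfLE (le_refl b) = 𝟙 b from rfl, Y.map_id, M.push_id]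
  pull_pull h h' b x := by
    rw [← M.pull_comp, ← X.map_comp, homOfLE_comp]
  push_push a _ _ _ h h' x := by
    rw [← M.push_comp, ← Y.map_comp, homOfLE_comp]
  push_pull h h' x := M.push_pull _ _ _

variable {n : ℕ} {p : Fin n → SimplexCategory}

/-- In the `S`-construction, exactness of `M` in the contravariant variable gives exactness. -/
lemma isExact_ofDiagrams {X Y : Cube p ⥤ C} (hX : isSDiagram C p X) (hY : isSDiagram C p Y) :
    (M.ofDiagrams X Y).IsExact where
  left_zero := fun a b ⟨i, h⟩ => M.eq_zero_of_isZero_left (by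
    rw [hX.1 a i h]
    exact isZero_zeroObj)
  right_zero := fun a b ⟨i, h⟩ => M.eq_zero_of_isZero_right (by
    rw [hY.1 b i h]
    exact isZero_zeroObj)
  injective h d x hx :=
    (M.exact_left (Y.obj d) _ _ (hX.2 _ _ _ _ h.choose_spec)).1 (hx.trans (map_zero _).symm)
  pull_pull_eq_zero h d x :=
    ((M.exact_left (Y.obj d) _ _ (hX.2 _ _ _ _ h.choose_spec)).2.1 _).2 ⟨x, rfl⟩
  exact h d x hx :=
    ((M.exact_left (Y.obj d) _ _ (hX.2 _ _ _ _ h.choose_spec)).2.1 x).1 hx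
  surjective h d := (M.exact_left (Y.obj d) _ _ (hX.2 _ _ _ _ h.choose_spec)).2.2

/-- The `M`-components of a diagram in `C ⋉ M` that satisfies the condition of the `S`-construction
form an inner derivation. -/
lemma exists_eq_pull_sub_push (Y : SCat (SplitExt M) p) :
    ∃ c : ∀ θ, M.Elt (Y.obj.obj θ).obj (Y.obj.obj θ).obj, ∀ (ρ θ : Cube p) (f : ρ ⟶ θ),
      Prod.snd (Y.obj.map f) =
        M.pull (Prod.fst (Y.obj.map f)) _ (c θ) - M.push (Prod.fst (Y.obj.map f)) _ (c ρ) := by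
  have hX : isSDiagram C p (Y.obj ⋙ SplitExt.proj M) :=
    ⟨fun θ i h => congrArg (SplitExt.proj M).obj (Y.property.1 θ i h),
      fun i θ θ' θ'' h => (Y.property.2 i θ θ' θ'' h).1⟩
  obtain ⟨c, hc⟩ := Cube.isAcyclic p _ (M.isExact_ofDiagrams hX hX)
    (fun ρ θ h => Prod.snd (Y.obj.map (homOfLE h))) (fun ρ θ σ h h' => by
      have e : Y.obj.map (homOfLE (h.trans h')) =
          Y.obj.map (homOfLE h) ≫ Y.obj.map (homOfLE h') := by
        rw [← Y.obj.map_comp, homOfLE_comp]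
      exact congrArg Prod.snd e)
  exact ⟨c, fun ρ θ f => hc ρ θ (leOfHom f)⟩

end Bimodule

/-! ### Absorption of the nerve direction -/

section Chains

variable {G : Type u} [Groupoid.{v} G] {m : ℕ} (F : Fin (m + 1) ⥤ G)

/-- The morphism between any two objects of a chain in a groupoid. -/
noncomputable def chainHom (i j : Fin (m + 1)) : F.obj i ⟶ F.obj j :=
  inv (F.map (homOfLE (Fin.zero_le i))) ≫ F.map (homOfLE (Fin.zero_le j))

lemma chainHom_comp (i j l : Fin (m + 1)) :
    chainHom F i j ≫ chainHom F j l = chainHom F i l := by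
  simp [chainHom]

lemma chainHom_self (i : Fin (m + 1)) : chainHom F i i = 𝟙 _ := by
  simp [chainHom]

lemma chainHom_of_le {i j : Fin (m + 1)} (f : i ⟶ j) : chainHom F i j = F.map f := by
  rw [chainHom, IsIso.inv_comp_eq, ← F.map_comp]
  rfl

lemma chainHom_of_ge {i j : Fin (m + 1)} (f : i ⟶ j) : chainHom F j i = inv (F.map f) := by
  rw [IsIso.eq_inv_of_hom_inv_id (f := F.map f) (g := chainHom F j i)]
  rw [← chainHom_of_le F f, chainHom_comp, chainHom_self]

end Chains

section Twist

variable {E : Type u} [Category.{v} E] [Preadditive E] [ConflationCategory E]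

variable (E) in
/-- The exact sequences are closed under isomorphism. This is an axiom of exact categories, but not
a part of `ConflationCategory`. -/
def ConflationsIsoClosed : Prop :=
  ∀ ⦃a b c a' b' c' : E⦄ (i : a ⟶ b) (q : b ⟶ c) (i' : a' ⟶ b') (q' : b' ⟶ c')
    (α : a ≅ a') (β : b ≅ b') (γ : c ≅ c'), i ≫ β.hom = α.hom ≫ i' → q ≫ γ.hom = β.hom ≫ q' →
    IsConflation i q → IsConflation i' q'

namespace SCat

variable {ι : Type} {p : ι → SimplexCategory} {m : ℕ}

section

variable (F : Fin (m + 1) ⥤ Core (SCat E p))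

/-- The isomorphism `F_i(θ) ⟶ F_j(θ)` of a chain of isomorphic diagrams. -/
noncomputable def trans (i j : Fin (m + 1)) (θ : Cube p) :
    (F.obj i).of.obj.obj θ ⟶ (F.obj j).of.obj.obj θ :=
  (chainHom F i j).iso.hom.hom.app θ

lemma trans_comp (i j l : Fin (m + 1)) (θ : Cube p) :
    trans F i j θ ≫ trans F j l θ = trans F i l θ :=
  congrArg (fun f => f.iso.hom.hom.app θ) (chainHom_comp F i j l)

lemma trans_self (i : Fin (m + 1)) (θ : Cube p) : trans F i i θ = 𝟙 _ :=
  congrArg (fun f => f.iso.hom.hom.app θ) (chainHom_self F i)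

lemma trans_of_le {i j : Fin (m + 1)} (f : i ⟶ j) (θ : Cube p) :
    trans F i j θ = (F.map f).iso.hom.hom.app θ :=
  congrArg (fun f => f.iso.hom.hom.app θ) (chainHom_of_le F f)

lemma trans_of_ge {i j : Fin (m + 1)} (f : i ⟶ j) (θ : Cube p) :
    trans F j i θ = (F.map f).iso.inv.hom.app θ :=
  congrArg (fun f => f.iso.hom.hom.app θ)
    ((chainHom_of_ge F f).trans (Groupoid.inv_eq_inv (F.map f)).symm)

lemma trans_naturality (i j : Fin (m + 1)) {ρ θ : Cube p} (f : ρ ⟶ θ) :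
    (F.obj i).of.obj.map f ≫ trans F i j θ = trans F i j ρ ≫ (F.obj j).of.obj.map f :=
  (chainHom F i j).iso.hom.hom.naturality f

lemma trans_naturality_assoc (i j : Fin (m + 1)) {ρ θ : Cube p} (f : ρ ⟶ θ) {Z : E}
    (g : (F.obj j).of.obj.obj θ ⟶ Z) :
    (F.obj i).of.obj.map f ≫ trans F i j θ ≫ g =
      trans F i j ρ ≫ (F.obj j).of.obj.map f ≫ g := by
  rw [← Category.assoc, trans_naturality, Category.assoc]

lemma trans_comp_assoc (i j l : Fin (m + 1)) (θ : Cube p) {Z : E}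
    (g : (F.obj l).of.obj.obj θ ⟶ Z) :
    trans F i j θ ≫ trans F j l θ ≫ g = trans F i l θ ≫ g := by
  rw [← Category.assoc, trans_comp]

lemma trans_const (X : Core (SCat E p)) (i j : Fin (m + 1)) (θ : Cube p) :
    trans ((Functor.const (Fin (m + 1))).obj X) i j θ = 𝟙 (X.of.obj.obj θ) := by
  rcases le_total i j with h | h
  · exact trans_of_le _ (homOfLE h) θ
  · exact trans_of_ge _ (homOfLE h) θ

/-- The isomorphisms of a chain at one `θ`. -/
noncomputable def transIso (i j : Fin (m + 1)) (θ : Cube p) :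
    (F.obj i).of.obj.obj θ ≅ (F.obj j).of.obj.obj θ where
  hom := trans F i j θ
  inv := trans F j i θ
  hom_inv_id := by rw [trans_comp, trans_self]
  inv_hom_id := by rw [trans_comp, trans_self]

/-- The diagram with the value `F_{a(θ)}(θ)` at `θ`. -/
noncomputable def mixFunctor (a : Cube p → Fin (m + 1)) : Cube p ⥤ E where
  obj θ := (F.obj (a θ)).of.obj.obj θ
  map {ρ θ} f := trans F (a ρ) (a θ) ρ ≫ (F.obj (a θ)).of.obj.map f
  map_id θ := by rw [trans_self, CategoryTheory.Functor.map_id, Category.id_comp]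
  map_comp {ρ θ σ} f g := by
    rw [Category.assoc, trans_naturality_assoc, trans_comp_assoc, Functor.map_comp]

variable (hE : ConflationsIsoClosed E)

include hE in
lemma mixFunctor_isSDiagram (a : Cube p → Fin (m + 1)) : isSDiagram E p (mixFunctor F a) := by
  refine ⟨fun θ i h => (F.obj (a θ)).of.property.1 θ i h, fun i θ θ' θ'' h => ?_⟩
  refine hE _ _ _ _ (transIso F (a θ'') (a θ) θ) (transIso F (a θ'') (a θ') θ')
    (transIso F (a θ'') (a θ'') θ'') ?_ ?_ ((F.obj (a θ'')).of.property.2 i θ θ' θ'' h)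
  · change _ ≫ trans F _ _ θ' = trans F _ _ θ ≫ trans F _ _ θ ≫ _
    rw [trans_comp_assoc, trans_naturality]
  · change _ ≫ trans F _ _ θ'' = trans F _ _ θ' ≫ trans F _ _ θ' ≫ _
    rw [trans_comp_assoc, trans_naturality]

/-- The diagram with the value `F_{a(θ)}(θ)` at `θ`, in the `S`-construction. -/
noncomputable def mix (a : Cube p → Fin (m + 1)) : SCat E p :=
  ⟨mixFunctor F a, mixFunctor_isSDiagram F hE a⟩

/-- The canonical map between two mixtures. -/
noncomputable def mixHom (a b : Cube p → Fin (m + 1)) : mix F hE a ⟶ mix F hE b :=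
  ObjectProperty.homMk
    { app := fun θ => trans F (a θ) (b θ) θ
      naturality := fun ρ θ f => by
        change (trans F _ _ ρ ≫ _) ≫ trans F _ _ θ = trans F _ _ ρ ≫ trans F _ _ ρ ≫ _
        rw [Category.assoc, trans_naturality, trans_comp_assoc, trans_comp_assoc] }

lemma mixHom_comp (a b c : Cube p → Fin (m + 1)) :
    mixHom F hE a b ≫ mixHom F hE b c = mixHom F hE a c := by
  ext θ
  exact trans_comp F _ _ _ θ

lemma mixHom_self (a : Cube p → Fin (m + 1)) : mixHom F hE a a = 𝟙 _ := by
  ext θ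
  exact trans_self F _ θ

/-- The chain of the mixtures for a chain of functions. -/
noncomputable def mixChain {l : ℕ} (a : Fin (l + 1) → Cube p → Fin (m + 1)) :
    Fin (l + 1) ⥤ Core (SCat E p) where
  obj j := ⟨mix F hE (a j)⟩
  map {i j} _ := ⟨⟨mixHom F hE (a i) (a j), mixHom F hE (a j) (a i),
    (mixHom_comp F hE _ _ _).trans (mixHom_self F hE _),
    (mixHom_comp F hE _ _ _).trans (mixHom_self F hE _)⟩⟩
  map_id _ := Core.hom_ext (mixHom_self F hE _)
  map_comp _ _ := Core.hom_ext (mixHom_comp F hE _ _ _).symm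

lemma trans_congr {i i' j j' : Fin (m + 1)} (h : i = i') (h' : j = j') {ρ θ : Cube p}
    (f : ρ ⟶ θ) : trans F i j ρ ≫ (F.obj j).of.obj.map f =
      eqToHom (by rw [h]) ≫ (trans F i' j' ρ ≫ (F.obj j').of.obj.map f) ≫ eqToHom (by rw [h']) := by
  subst h h'
  simp

lemma trans_congr' {i i' j j' : Fin (m + 1)} (h : i = i') (h' : j = j') (θ : Cube p) :
    trans F i j θ = eqToHom (by rw [h]) ≫ trans F i' j' θ ≫ eqToHom (by rw [h']) := by
  subst h h'
  simp

lemma mixChain_self : mixChain F hE (fun j _ => j) = F := by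
  refine functor_ext (fun _ _ => rfl) (fun j ρ θ f => ?_) (fun i j f θ => ?_)
  · change trans F j j ρ ≫ _ = _
    rw [trans_self, Category.id_comp]
    exact (Category.comp_id _).symm.trans (Category.id_comp _).symm
  · change trans F i j θ = _
    rw [trans_of_le F f]
    exact (Category.comp_id _).symm.trans (Category.id_comp _).symm

end

end SCat

end Twist

section Retraction

open Simplicial SSet

variable (E : Type u) [Category.{v} E] [Preadditive E] [ConflationCategory E]

/-- The simplicial set of the objects of the iterated `S`-construction. -/
def sObjects (n : ℕ) : SSet.{max u v} where
  obj k := SCat E (fun _ : Fin n => k.unop)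
  map f := TypeCat.ofHom (SCat.restrict (fun _ : Fin n => f.unop)).obj
  map_id _ := rfl
  map_comp _ _ := rfl

/-- Objects as constant chains. -/
def constChain (n : ℕ) : sObjects E n ⟶ kLevel E n where
  app k := TypeCat.ofHom fun X => (Functor.const (Fin (k.unop.len + 1))).obj ⟨X⟩
  naturality k l f := by
    refine ConcreteCategory.hom_ext _ _ fun X => ?_
    exact SCat.functor_ext (fun _ _ => rfl)
      (fun _ _ _ _ => (Category.comp_id _).symm.trans (Category.id_comp _).symm)
      (fun _ _ _ _ => (Category.comp_id _).symm.trans (Category.id_comp _).symm)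

variable {E} {n : ℕ}

/-- The simplicial structure of `kLevel E n`, on chains. -/
def mapChain {k l : SimplexCategory} (f : l ⟶ k)
    (F : Fin (k.len + 1) ⥤ Core (SCat E (fun _ : Fin n => k))) :
    Fin (l.len + 1) ⥤ Core (SCat E (fun _ : Fin n => l)) :=
  f.toOrderHom.monotone.functor ⋙ F ⋙ (SCat.restrict (fun _ : Fin n => f)).core

lemma trans_mapChain {k l : SimplexCategory} (f : l ⟶ k)
    (F : Fin (k.len + 1) ⥤ Core (SCat E (fun _ : Fin n => k)))
    (i j : Fin (l.len + 1)) (θ : Cube (fun _ : Fin n => l)) :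
    SCat.trans (mapChain f F) i j θ =
      SCat.trans F (f.toOrderHom i) (f.toOrderHom j) (fun s => Ar.map f (θ s)) := by
  rcases le_total i j with h | h
  · rw [SCat.trans_of_le _ (homOfLE h), SCat.trans_of_le _ (homOfLE (f.toOrderHom.monotone h))]
    rfl
  · rw [SCat.trans_of_ge _ (homOfLE h), SCat.trans_of_ge _ (homOfLE (f.toOrderHom.monotone h))]
    rfl

variable (hE : ConflationsIsoClosed E)

lemma mapChain_mixChain {k l : SimplexCategory} (f : l ⟶ k)
    (F : Fin (k.len + 1) ⥤ Core (SCat E (fun _ : Fin n => k)))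
    (a : Fin (k.len + 1) → Cube (fun _ : Fin n => k) → Fin (k.len + 1))
    (b : Fin (l.len + 1) → Cube (fun _ : Fin n => l) → Fin (l.len + 1))
    (h : ∀ j θ, a (f.toOrderHom j) (fun s => Ar.map f (θ s)) = f.toOrderHom (b j θ)) :
    mapChain f (SCat.mixChain F hE a) = SCat.mixChain (mapChain f F) hE b := by
  refine SCat.functor_ext
    (fun j θ => congrArg (fun i => (F.obj i).of.obj.obj (fun s => Ar.map f (θ s))) (h j θ))
    (fun j ρ θ g => ?_) (fun i j g θ => ?_)
  · refine (SCat.trans_congr F (h j ρ) (h j θ)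
      (homOfLE (fun s => (Ar.map f).monotone (leOfHom g s)))).trans ?_
    have e := trans_mapChain f F (b j ρ) (b j θ) ρ
    rw [← e]
    rfl
  · refine (SCat.trans_congr' F (h i θ) (h j θ) (fun s => Ar.map f (θ s))).trans ?_
    have e := trans_mapChain f F (b i θ) (b j θ) θ
    rw [← e]
    rfl

/-- The map from `kLevel E n` to the objects of the `S`-construction that takes a chain
`F` to the diagram with the value `F_a(θ)` at `θ`, where `a` is the source of the component of `θ`
in the direction `s`. -/
noncomputable def mixObjects (s : Fin n) : kLevel E n ⟶ sObjects E n where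
  app k := TypeCat.ofHom fun F => SCat.mix F hE fun θ => (θ s).src
  naturality k l f := by
    refine ConcreteCategory.hom_ext _ _ fun F => ?_
    refine ObjectProperty.FullSubcategory.ext (CategoryTheory.Functor.hext (fun _ => rfl)
      fun ρ θ g => heq_of_eq ?_)
    have e := trans_mapChain f.unop F (ρ s).src (θ s).src ρ
    refine (congrArg (· ≫ (F.obj (f.unop.toOrderHom (θ s).src)).of.obj.map
      (homOfLE (fun s => (Ar.map f.unop).monotone (leOfHom g s)))) e)

/-- The nerve direction of `kLevel E n` can be absorbed into one of the `S`-directions: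
`kLevel E n` is equivalent to its simplicial subset of objects. -/
lemma isEquivalence_mixObjects (s : Fin n) : IsEquivalence (mixObjects hE s) := by
  let b : ∀ (k : SimplexCategory) (t : k ⟶ ⦋1⦌) (j : Fin (k.len + 1))
      (θ : Cube (fun _ : Fin n => k)), Fin (k.len + 1) := fun k t j θ => switch t j j (θ s).src
  let H : HomotopyFamily (kLevel E n) (kLevel E n) :=
    { h := fun k t F => SCat.mixChain F hE (b k.unop t)
      natural := fun {k l} f t F => mapChain_mixChain hE f.unop F _ _ fun j θ =>
        (apply_switch t (f.unop.toOrderHom j) f.unop.toOrderHom j (θ s).src).symm }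
  refine (IsEquivalence.of_homotopyFamily (mixObjects hE s) (constChain E n) H (fun k F => ?_)
    (fun k F => ?_) fun k X => ?_).1
  · have e : b k.unop (HomotopyFamily.vertex k.unop 0) = fun j _ => j :=
      funext fun j => funext fun θ => switch_vertex_zero _ _ _ _
    change SCat.mixChain F hE (b k.unop (HomotopyFamily.vertex k.unop 0)) = F
    rw [e]
    exact SCat.mixChain_self F hE
  · have e : b k.unop (HomotopyFamily.vertex k.unop 1) = fun _ θ => (θ s).src :=
      funext fun j => funext fun θ => switch_vertex_one _ _ _ _
    change SCat.mixChain F hE (b k.unop (HomotopyFamily.vertex k.unop 1)) = _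
    rw [e]
    refine SCat.functor_ext (fun _ _ => rfl)
      (fun _ _ _ _ => (Category.comp_id _).symm.trans (Category.id_comp _).symm)
      (fun i j f θ => ?_)
    refine (SCat.trans_self F _ θ).trans ?_
    exact (Category.comp_id (𝟙 _)).symm.trans (Category.id_comp _).symm
  · refine ObjectProperty.FullSubcategory.ext (CategoryTheory.Functor.hext (fun _ => rfl)
      fun ρ θ g => heq_of_eq ?_)
    exact (congrArg (· ≫ X.obj.map g)
      (SCat.trans_const (⟨X⟩ : Core (SCat E _)) _ _ ρ)).trans (Category.id_comp _)

end Retraction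

/-! ### Conjugates of zero sections -/

section SplitExtension

open Simplicial SSet

variable {C : Type u} [Category.{v} C] [Preadditive C] [ExactCategory C] (M : Bimodule.{w} C)

/-- The vanishing of `q_* m + i^* n` says that the composite in `C ⋉ M` is zero, so exact sequences
are closed under isomorphisms of `C ⋉ M`. -/
lemma SplitExt.conflationsIsoClosed : ConflationsIsoClosed (SplitExt M) := by
  intro a b c a' b' c' i q i' q' α β γ h₁ h₂ h
  refine ⟨ExactCategory.of_iso ((SplitExt.proj M).mapIso α) ((SplitExt.proj M).mapIso β)
    ((SplitExt.proj M).mapIso γ) (congrArg Prod.fst h₁) (congrArg Prod.fst h₂) h.1, ?_⟩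
  -- the second condition says that the composite in `C ⋉ M` vanishes
  have h₃ : i ≫ q = 0 := SplitExt.hom_ext (ExactCategory.comp_zero h.1) h.2
  have h₄ : i' ≫ q' = 0 := by
    rw [← cancel_epi α.hom, ← Category.assoc, ← h₁, Category.assoc, ← h₂, ← Category.assoc, h₃,
      zero_comp, comp_zero]
  exact congrArg Prod.snd h₄

namespace Bimodule

/-- The families `f^* c - f_* c` satisfy the Leibniz rule. -/
lemma push_sub_add_pull_sub {a b d : C} (f : a ⟶ b) (g : b ⟶ d) (x : M.Elt a a) (y : M.Elt b b)
    (z : M.Elt d d) :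
    M.push g a (M.pull f b y - M.push f a x) + M.pull f d (M.pull g d z - M.push g b y) =
      M.pull (f ≫ g) d z - M.push (f ≫ g) a x := by
  rw [M.pull_comp, M.push_comp, map_sub, map_sub, M.push_pull]
  abel

section Conjugation

variable {n : ℕ} {p : Fin n → SimplexCategory}

/-- The diagram in `C ⋉ M` with the maps `(X(f), f^* c_θ - f_* c_ρ)`: the conjugate of the zero
section of `X` by the automorphisms `(id, c_θ)`. -/
def conjFunctor (X : Cube p ⥤ C) (c : ∀ θ, M.Elt (X.obj θ) (X.obj θ)) : Cube p ⥤ SplitExt M where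
  obj θ := ⟨X.obj θ⟩
  map {ρ θ} f := (X.map f, M.pull (X.map f) _ (c θ) - M.push (X.map f) _ (c ρ))
  map_id θ := SplitExt.hom_ext (X.map_id θ) (by
    rw [X.map_id, M.pull_id, M.push_id, sub_self]
    rfl)
  map_comp {ρ θ σ} f g := SplitExt.hom_ext (X.map_comp f g) (by
    rw [X.map_comp]
    exact (M.push_sub_add_pull_sub _ _ _ _ _).symm)

/-- The conjugate of the zero section, in the `S`-construction. -/
def conj (X : SCat C p) (c : ∀ θ, M.Elt (X.obj.obj θ) (X.obj.obj θ)) : SCat (SplitExt M) p :=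
  ⟨M.conjFunctor X.obj c, fun θ i h => congrArg SplitExt.mk (X.property.1 θ i h),
    fun i θ θ' θ'' h => by
      have hc := X.property.2 i θ θ' θ'' h
      have h₀ := ExactCategory.comp_zero hc
      refine ⟨hc, ?_⟩
      exact (M.push_sub_add_pull_sub (X.obj.map _) (X.obj.map _) (c θ) (c θ') (c θ'')).trans
        (by rw [h₀, M.push_zero_hom, M.pull_zero_hom, sub_zero]; rfl)⟩

/-- Every object of the `S`-construction of `C ⋉ M` is a conjugate of a zero section, because
derivations are inner. -/
lemma conj_surjective (Y : SCat (SplitExt M) p) : ∃ X c, M.conj X c = Y := by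
  obtain ⟨c, hc⟩ := M.exists_eq_pull_sub_push Y
  refine ⟨⟨Y.obj ⋙ SplitExt.proj M,
    fun θ i h => congrArg (SplitExt.proj M).obj (Y.property.1 θ i h),
    fun i θ θ' θ'' h => (Y.property.2 i θ θ' θ'' h).1⟩, c, ?_⟩
  refine ObjectProperty.FullSubcategory.ext (CategoryTheory.Functor.hext (fun _ => rfl)
    fun ρ θ f => heq_of_eq (SplitExt.hom_ext rfl (hc ρ θ f).symm))

lemma eq_of_conj_eq {X X' : SCat C p} {c : ∀ θ, M.Elt (X.obj.obj θ) (X.obj.obj θ)}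
    {c' : ∀ θ, M.Elt (X'.obj.obj θ) (X'.obj.obj θ)} (h : M.conj X c = M.conj X' c') : X = X' :=
  ObjectProperty.FullSubcategory.ext
    (congrArg (fun Y : SCat (SplitExt M) p => Y.obj ⋙ SplitExt.proj M) h)

/-- Two families of automorphisms give the same conjugate if and only if they differ by an
automorphism of the zero section. -/
lemma conj_eq_iff {X : SCat C p} {c c' : ∀ θ, M.Elt (X.obj.obj θ) (X.obj.obj θ)} :
    M.conj X c = M.conj X c' ↔ c - c' ∈ M.sBimod X X := by
  have key : ∀ {ρ θ : Cube p} (f : ρ ⟶ θ),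
      M.pull (X.obj.map f) _ (c θ) - M.push (X.obj.map f) _ (c ρ) =
        M.pull (X.obj.map f) _ (c' θ) - M.push (X.obj.map f) _ (c' ρ) ↔
      M.pull (X.obj.map f) _ ((c - c') θ) = M.push (X.obj.map f) _ ((c - c') ρ) := fun f => by
    rw [Pi.sub_apply, Pi.sub_apply, map_sub, map_sub, sub_eq_sub_iff_sub_eq_sub]
  constructor
  · intro h ρ θ f
    refine (key f).1 ?_
    have h' := CategoryTheory.Functor.congr_hom (congrArg (fun Y => Y.obj) h) f
    have e : ∀ {a b : SplitExt M} (g : a ⟶ b), eqToHom rfl ≫ g ≫ eqToHom rfl = g := fun g => by simp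
    exact congrArg Prod.snd (h'.trans (e _))
  · intro h
    refine ObjectProperty.FullSubcategory.ext (CategoryTheory.Functor.hext (fun _ => rfl)
      fun ρ θ f => heq_of_eq (SplitExt.hom_ext rfl ((key f).2 (h ρ θ f))))

end Conjugation

variable (n : ℕ)

/-- The simplicial set of the objects `X` of the iterated `S`-construction of `C` with elements
`c_θ` of `M(X_θ, X_θ)`. -/
def cochains : SSet.{max u v w} where
  obj k := Σ X : SCat C (fun _ : Fin n => k.unop), ∀ θ, M.Elt (X.obj.obj θ) (X.obj.obj θ)
  map f := TypeCat.ofHom fun x => ⟨(SCat.restrict (fun _ => f.unop)).obj x.1,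
    fun θ => x.2 (fun s => Ar.map f.unop (θ s))⟩
  map_id _ := rfl
  map_comp _ _ := rfl

/-- Conjugation of the zero section, as a simplicial map. -/
def conjMap : M.cochains n ⟶ sObjects (SplitExt M) n where
  app _ := TypeCat.ofHom fun x => M.conj x.1 x.2
  naturality _ _ _ := rfl

lemma conjMap_surjective (k : SimplexCategoryᵒᵖ) (Y : (sObjects (SplitExt M) n).obj k) :
    ∃ x, (M.conjMap n).app k x = Y := by
  obtain ⟨X, c, h⟩ := M.conj_surjective Y
  exact ⟨⟨X, c⟩, h⟩

/-- The simplicial set of the objects `X` of the iterated `S`-construction of `C` with a tuple of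
cochains `e_i` of which the differences `e_i - e_j` are natural. -/
def naturalTuples : SSet.{max u v w} where
  obj k := Σ X : SCat C (fun _ : Fin n => k.unop),
    {e : Fin (k.unop.len + 1) → ∀ θ, M.Elt (X.obj.obj θ) (X.obj.obj θ) //
      ∀ i j, e i - e j ∈ M.sBimod X X}
  map f := TypeCat.ofHom fun x => ⟨(SCat.restrict (fun _ => f.unop)).obj x.1,
    ⟨fun i θ => x.2.1 (f.unop.toOrderHom i) (fun s => Ar.map f.unop (θ s)),
      fun _ _ _ _ _ => x.2.2 _ _ _ _ _⟩⟩
  map_id _ := rfl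
  map_comp _ _ := rfl

/-- The comparison of `naturalTuples` with the Čech complex of `conjMap`. -/
def tuplesToCech : M.naturalTuples n ⟶ cech (M.conjMap n) where
  app _ := TypeCat.ofHom fun x => ⟨fun i => ⟨x.1, x.2.1 i⟩, fun i j => M.conj_eq_iff.2 (x.2.2 i j)⟩
  naturality _ _ _ := rfl

lemma isIso_tuplesToCech : IsIso (M.tuplesToCech n) := by
  have h : ∀ k, Function.Bijective ((M.tuplesToCech n).app k) := by
    refine fun k => ⟨?_, ?_⟩
    · rintro ⟨X, e, he⟩ ⟨X', e', he'⟩ h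
      have h' : ∀ i, (⟨X, e i⟩ : (M.cochains n).obj k) = ⟨X', e' i⟩ :=
        fun i => congrFun (congrArg Subtype.val h) i
      obtain rfl : X = X' := congrArg Sigma.fst (h' 0)
      obtain rfl : e = e' := funext fun i => eq_of_heq (Sigma.mk.inj (h' i)).2
      rfl
    · rintro ⟨c, hc⟩
      have hX : ∀ i, ∃ e, c i = (⟨(c 0).1, e⟩ : (M.cochains n).obj k) := fun i => by
        have : (c i).1 = (c 0).1 := M.eq_of_conj_eq (hc i 0)
        generalize c i = x at this
        obtain ⟨X, e⟩ := x
        obtain rfl : X = (c 0).1 := this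
        exact ⟨e, rfl⟩
      choose e he using hX
      generalize (c 0).1 = X at e he
      obtain rfl : c = fun i => ⟨X, e i⟩ := funext he
      exact ⟨⟨X, ⟨e, fun i j => M.conj_eq_iff.1 (hc i j)⟩⟩, rfl⟩
  have : ∀ k, IsIso ((M.tuplesToCech n).app k) := fun k => (isIso_iff_bijective _).2 (h k)
  exact NatIso.isIso_of_isIso_app _

/-- The element of `S^{(n)} M(X, X)` that a chain in the group `S^{(n)} M(X, X)` assigns to the
relation `0 ≤ i`. -/
def partialSum {k : SimplexCategoryᵒᵖ} (x : (M.kLevel n).obj k) (i : Fin (k.unop.len + 1)) :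
    M.sBimod x.1 x.1 :=
  Multiplicative.toAdd (x.2.map (homOfLE (Fin.zero_le i)))

variable {n}

lemma toAdd_map_comp {G : Type w} [AddCommGroup G] {m : ℕ}
    (F : Fin (m + 1) ⥤ SingleObj (Multiplicative G)) {i j l : Fin (m + 1)} (f : i ⟶ j)
    (g : j ⟶ l) : Multiplicative.toAdd (F.map (f ≫ g)) =
      Multiplicative.toAdd (F.map f) + Multiplicative.toAdd (F.map g) :=
  (congrArg Multiplicative.toAdd (F.map_comp f g)).trans (add_comm _ _)

lemma toAdd_map {k : SimplexCategoryᵒᵖ} (x : (M.kLevel n).obj k) {i j : Fin (k.unop.len + 1)}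
    (f : i ⟶ j) : Multiplicative.toAdd (x.2.map f) = M.partialSum n x j - M.partialSum n x i :=
  eq_sub_of_add_eq' (toAdd_map_comp x.2 (homOfLE (Fin.zero_le i)) f).symm

lemma partialSum_map {k l : SimplexCategoryᵒᵖ} (f : k ⟶ l) (x : (M.kLevel n).obj k)
    (i j : Fin (l.unop.len + 1)) (θ : Cube (fun _ : Fin n => l.unop)) :
    (M.partialSum n ((M.kLevel n).map f x) i).1 θ - (M.partialSum n ((M.kLevel n).map f x) j).1 θ =
      (M.partialSum n x (f.unop.toOrderHom i)).1 (fun s => Ar.map f.unop (θ s)) -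
        (M.partialSum n x (f.unop.toOrderHom j)).1 (fun s => Ar.map f.unop (θ s)) := by
  have key : ∀ i, (M.partialSum n ((M.kLevel n).map f x) i).1 θ =
      (M.partialSum n x (f.unop.toOrderHom i)).1 (fun s => Ar.map f.unop (θ s)) -
        (M.partialSum n x (f.unop.toOrderHom 0)).1 (fun s => Ar.map f.unop (θ s)) := fun i =>
    congrArg (fun m => m.1 (fun s => Ar.map f.unop (θ s)))
      (M.toAdd_map x (homOfLE (f.unop.toOrderHom.monotone (Fin.zero_le i))))
  exact (congrArg₂ (· - ·) (key i) (key j)).trans (sub_sub_sub_cancel_right _ _ _)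

/-- The map from `M.kLevel n` to tuples of cochains: the component of `e_i` at `θ` is the element
that the chain assigns to the relation between `i` and the source of the component of `θ` in the
direction `s`. -/
def toTuples (s : Fin n) : M.kLevel n ⟶ M.naturalTuples n where
  app k := TypeCat.ofHom fun x => ⟨x.1,
    ⟨fun i θ => (M.partialSum n x (θ s).src).1 θ - (M.partialSum n x i).1 θ, fun i j => by
      have : (fun θ => (M.partialSum n x (θ s).src).1 θ - (M.partialSum n x i).1 θ) -
          (fun θ => (M.partialSum n x (θ s).src).1 θ - (M.partialSum n x j).1 θ) =
          (M.partialSum n x j - M.partialSum n x i).1 :=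
        funext fun θ => sub_sub_sub_cancel_left _ _ _
      rw [this]
      exact (M.partialSum n x j - M.partialSum n x i).2⟩⟩
  naturality k l f := by
    refine ConcreteCategory.hom_ext _ _ fun x => ?_
    exact congrArg (Sigma.mk _) (Subtype.ext (funext fun i => funext fun θ =>
      M.partialSum_map f x (θ s).src i θ))

/-- The chain of the differences of a tuple. -/
def ofTuples : M.naturalTuples n ⟶ M.kLevel n where
  app _ := TypeCat.ofHom fun x => ⟨x.1,
    { obj := fun _ => SingleObj.star _
      map := fun {i j} _ => Multiplicative.ofAdd ⟨x.2.1 i - x.2.1 j, x.2.2 i j⟩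
      map_id := fun i => Subtype.ext (sub_self (x.2.1 i))
      map_comp := fun {i j l} _ _ => Subtype.ext
        ((sub_add_sub_cancel (x.2.1 i) (x.2.1 j) (x.2.1 l)).symm.trans (add_comm _ _)) }⟩
  naturality _ _ _ := rfl

/-- The chains in the groups `S^{(n)} M(X, X)` are equivalent to the tuples of cochains with
natural differences, because the nerve direction can be absorbed into one of the
`S`-directions. -/
lemma isEquivalence_toTuples (s : Fin n) : IsEquivalence (M.toTuples s) := by
  let H : HomotopyFamily (M.naturalTuples n) (M.naturalTuples n) :=
    { h := fun k t x => ⟨x.1, ⟨fun i θ => x.2.1 i θ - switch t (θ s).src 0 (x.2.1 (θ s).src θ),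
        fun i j => by
          have : (fun θ => x.2.1 i θ - switch t (θ s).src 0 (x.2.1 (θ s).src θ)) -
              (fun θ => x.2.1 j θ - switch t (θ s).src 0 (x.2.1 (θ s).src θ)) =
              x.2.1 i - x.2.1 j :=
            funext fun θ => sub_sub_sub_cancel_right _ _ _
          rw [this]
          exact x.2.2 i j⟩⟩
      natural := fun f t x => rfl }
  refine (IsEquivalence.of_homotopyFamily M.ofTuples (M.toTuples s) H (fun k x => ?_)
    (fun k x => ?_) fun k x => ?_).2
  · exact congrArg (Sigma.mk _) (Subtype.ext (funext fun i => funext fun θ =>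
      (congrArg (x.2.1 i θ - ·) (switch_vertex_zero _ _ _ _)).trans (sub_zero _)))
  · refine congrArg (Sigma.mk _) (Subtype.ext (funext fun i => funext fun θ =>
      (congrArg (x.2.1 i θ - ·) (switch_vertex_one _ _ _ _)).trans ?_))
    exact (sub_sub_sub_cancel_left (x.2.1 (θ s).src θ) (x.2.1 i θ) (x.2.1 0 θ)).symm
  · obtain ⟨X, F⟩ := x
    refine congrArg (Sigma.mk X) (CategoryTheory.Functor.hext (fun _ => rfl)
      fun i j f => heq_of_eq (Subtype.ext (funext fun θ => ?_)))
    have h := congrArg (fun m => m.1 θ) (M.toAdd_map (n := n) (k := k) ⟨X, F⟩ f)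
    exact (sub_sub_sub_cancel_left _ _ _).trans h.symm

lemma trans_psi {k : SimplexCategoryᵒᵖ} (x : (M.kLevel n).obj k) (i j : Fin (k.unop.len + 1))
    (θ : Cube (fun _ : Fin n => k.unop)) :
    SCat.trans (x.2 ⋙ M.psiFunctor x.1) i j θ =
      ((𝟙 (x.1.obj.obj θ), (M.partialSum n x j).1 θ - (M.partialSum n x i).1 θ) :
        (SplitExt.zeroSection M).obj (x.1.obj.obj θ) ⟶
          (SplitExt.zeroSection M).obj (x.1.obj.obj θ)) := by
  rcases le_total i j with h | h
  · refine (SCat.trans_of_le _ (homOfLE h) θ).trans (SplitExt.hom_ext rfl ?_)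
    exact congrArg (fun m => m.1 θ) (M.toAdd_map x (homOfLE h))
  · refine (SCat.trans_of_ge _ (homOfLE h) θ).trans (SplitExt.hom_ext rfl ?_)
    refine Eq.trans ?_ (neg_sub ((M.partialSum n x i).1 θ) ((M.partialSum n x j).1 θ))
    exact congrArg (fun m => -m.1 θ) (M.toAdd_map x (homOfLE h))

lemma push_sub_add_pull_zero {a b : C} (f : a ⟶ b) {y z : M.Elt a a} {y' z' : M.Elt b b}
    (hy : M.pull f b y' = M.push f a y) (hz : M.pull f b z' = M.push f a z) (x : M.Elt a a) :
    M.push f a (y - x) + M.pull (𝟙 a) b 0 = M.pull f b (y' - z') - M.push f a (x - z) := by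
  rw [map_zero, map_sub, map_sub, map_sub, hy, hz]
  abel

/-- Under the equivalences that absorb the nerve direction into the direction `s`, the map `psi`
becomes conjugation. -/
lemma psi_comp_mixObjects (s : Fin n) :
    M.psi n ≫ mixObjects (SplitExt.conflationsIsoClosed M) s =
      M.toTuples s ≫ M.tuplesToCech n ≫ cechBase (M.conjMap n) := by
  ext k x
  refine ObjectProperty.FullSubcategory.ext (CategoryTheory.Functor.hext (fun _ => rfl)
    fun ρ θ f => heq_of_eq ?_)
  change SCat.trans (x.2 ⋙ M.psiFunctor x.1) (ρ s).src (θ s).src ρ ≫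
    (SplitExt.zeroSection M).map (x.1.obj.map f) = _
  rw [trans_psi]
  refine SplitExt.hom_ext (Category.id_comp _) ?_
  exact M.push_sub_add_pull_zero (x.1.obj.map f) ((M.partialSum n x (θ s).src).2 ρ θ f)
    ((M.partialSum n x 0).2 ρ θ f) _

/-- In positive levels `psi` is an equivalence, since it becomes the augmentation of the Čech
complex of a surjection. -/
theorem isEquivalence_psi (s : Fin n) : IsEquivalence (M.psi n) := by
  have := M.isIso_tuplesToCech n
  refine IsEquivalence.of_comp_right ?_
    (isEquivalence_mixObjects (SplitExt.conflationsIsoClosed M) s)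
  rw [psi_comp_mixObjects]
  exact (M.isEquivalence_toTuples s).comp ((IsEquivalence.of_isIso _).comp
    (isEquivalence_cechBase _ (M.conjMap_surjective n)))

end Bimodule

end SplitExtension

theorem theorem2 {C : Type u} [Category.{v} C] [Preadditive C] [ExactCategory C]
    (M : Bimodule.{w} C) (n : ℕ) (hn : 1 ≤ n) :
    IsEquivalence (M.psiMap.app n) :=
  M.isEquivalence_psi ⟨0, hn⟩
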